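/- Let $K$ be an algebraically closed field of characteristic $\neq 2$ and let $F(X)=f_0+f_1X+\dots+f_6X^6\in K[X]$, $f_6\neq 0$, have six distinct roots $\theta_1,\dots,\theta_6$. **The surfaces.** Let $\mathcal K\subset\mathbb P^3$ be the Kummer surface of the curve $Y^2=F(X)$, i.e. the Zariski closure of the set of points $(1:x+u:xu:\beta_0)$, where $(x,y),(u,v)$ are points of the curve with $x\ne u$, $$\beta_0=\frac{F_0(x,u)-2yv}{(x-u)^2},$$ $$F_0(x,u)=2f_0+f_1(x+u)+2f_2xu+f_3xu(x+u)+2f_4(xu)^2+f_5(xu)^2(x+u)+2f_6(xu)^3 .$$ It is a quartic surface. Let $\mathcal K^*\subset(\mathbb P^3)^\vee$ be its projective dual (the closure of the set of tangent planes of $\mathcal K$ at smooth points). Identify $(p_0:\dots:p_5)\in\mathbb P^5$ with the class of the polynomial $P(X)=\sum_{j=0}^5 p_jX^j$, and let $\mathcal S\subset\mathbb P^5$ be the set of the $P$ for which $P^2$ is congruent modulo $F$ to a polynomial of degree at most $2$. **The maps.** The rational map $\kappa:\mathcal K\dashrightarrow\mathcal S$ sends the point belonging to a general pair $(x,y),(u,v)$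 ($x\neq u$, $yv\ne0$) to the class of the $P$ with $(X-x)(X-u)P\equiv M \bmod F$, where $M$ is the polynomial of degree at most $3$ with $M(x)=y$, $M(u)=v$ and $(X-x)^2(X-u)^2\mid M^2-F$. The rational map $\kappa^*:\mathcal K^*\dashrightarrow\mathcal S$ is determined by $\kappa^*(\eta)=\kappa(\xi)$ when $\eta$ is the tangent plane to $\mathcal K$ at the general point $\xi$. We say that such a map *blows up a point $N$ into* $\{s\in\mathcal S: (N,s)\in\Gamma\}$, where $\Gamma$ is the Zariski closure of the graph of the map (the total transform of $N$). The *strict transform* by $\kappa$ of a curve $B\subset \mathcal K$ is the Zariski closure of the union of the total transforms under $\kappa$ of the points of $B$ other than the nodes listed next. **Nodes and tropes.** The sixteen nodes of $\mathcal K$ are $N_0=(0:0:0:1)$ and, for $i\neq j$, the point $N_{ij}=N_{ji}$ belonging to $(\theta_i,0),(\theta_j,0)$. The trope $T_i$ is the plane containing $N_0$ and the five $N_{ij}$, $j\ne i$; for distinct $i,j,k$ the trope $T_{ijk}$ is the plane containing the six nodes $N_{mn}$ with $\{m,n\}\subset\{i,j,k\}$ or $\{m,n\}\cap\{i,j,k\}=\emptyset$.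 **The lines.** Put $P_i(X)=\prod_{m\neq i}(X-\theta_m)$ and $g_i=1-2P_i/P_i(\theta_i)$, and let $\varepsilon^{(i)}$ be the map of $\mathbb P^5$ that sends $P$ to $g_iP \bmod F$. Let $\Delta_0=\{p_0+p_1X\}$, $\Delta_i=\varepsilon^{(i)}(\Delta_0)$, $\Delta_{ij}=\varepsilon^{(i)}\varepsilon^{(j)}(\Delta_0)$ and $\Delta_{ijk}=\varepsilon^{(i)}\varepsilon^{(j)}\varepsilon^{(k)}(\Delta_0)$, for distinct indices. **Lemma.** 1. $\kappa$ blows up the node $N_0$ into the line $\Delta_0$ and each of the fifteen nodes $N_{ij}$ into the line $\Delta_{ij}$. 2. Each of the planes $T_i$ and $T_{ijk}$ exists, is unique, and is a point of $\mathcal K^*$; $\kappa^*$ blows up $T_i$ into $\Delta_i$ and $T_{ijk}$ into $\Delta_{ijk}$. 3. $\Delta_i$ and $\Delta_{ijk}$ are the strict transforms by $\kappa$ of the conics which the planes $T_i$ and $T_{ijk}$ cut on $\mathcal K$. 4. $\Delta_0\cap\Delta_i$ is the single point $(-\theta_i:1:0:0:0:0)$, and $\Delta_0\cap\Delta_{ij}=\Delta_0\cap\Delta_{ijk}=\emptyset$.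 The line $\Delta_{ijk}$ meets exactly six of the lines $\Delta_{mn}$, namely those with $\{m,n\}\subset\{i,j,k\}$ or $\{m,n\}\cap\{i,j,k\}=\emptyset$. -/

import Mathlib

namespace KummerSurface

open scoped LinearAlgebra.Projectivization

noncomputable section

/-! ### Zariski closures in projective spaces and in products of two projective spaces

A polynomial is said to vanish at a point if it vanishes at all homogeneous coordinate vectors of
the point. Over an infinite field this means that all its (bi)homogeneous components vanish there,
so the sets below are the closures for the usual Zariski topology. -/

/-- The Zariski closure of a set of points of the projective space of `Fin n → K`. -/
def zariskiClosure {K : Type*} [Field K] {n : ℕ} (A : Set (ℙ K (Fin n → K))) :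
    Set (ℙ K (Fin n → K)) :=
  {a | ∀ G : MvPolynomial (Fin n) K,
    (∀ (v : Fin n → K) (hv : v ≠ 0), Projectivization.mk K v hv ∈ A →
      MvPolynomial.eval v G = 0) →
    ∀ (v : Fin n → K) (hv : v ≠ 0), Projectivization.mk K v hv = a →
      MvPolynomial.eval v G = 0}

/-- The Zariski closure of a set of points of a product of two projective spaces. -/
def zariskiClosureProd {K : Type*} [Field K] {m n : ℕ}
    (A : Set (ℙ K (Fin m → K) × ℙ K (Fin n → K))) :
    Set (ℙ K (Fin m → K) × ℙ K (Fin n → K)) :=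
  {a | ∀ G : MvPolynomial (Fin m ⊕ Fin n) K,
    (∀ (v : Fin m → K) (hv : v ≠ 0) (w : Fin n → K) (hw : w ≠ 0),
      (Projectivization.mk K v hv, Projectivization.mk K w hw) ∈ A →
      MvPolynomial.eval (Sum.elim v w) G = 0) →
    ∀ (v : Fin m → K) (hv : v ≠ 0) (w : Fin n → K) (hw : w ≠ 0),
      (Projectivization.mk K v hv, Projectivization.mk K w hw) = a →
      MvPolynomial.eval (Sum.elim v w) G = 0}

/-- The polynomial `p₀ + p₁ X + ⋯ + p₅ X⁵` with coefficient vector `p`. -/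
def toPoly {K : Type*} [Field K] (p : Fin 6 → K) : Polynomial K :=
  ∑ j : Fin 6, Polynomial.C (p j) * Polynomial.X ^ (j : ℕ)

/-- A genus two curve `Y² = F(X)`, given by the leading coefficient `f₆ ≠ 0` and the six distinct
roots `θ₁, …, θ₆` of the sextic `F` (over an algebraically closed field every sextic with distinct
roots is of this form). The indices `1, …, 6` are the elements of `Fin 6`. -/
structure Sextic (K : Type*) [Field K] where
  /-- the leading coefficient of `F` -/
  lead : K
  lead_ne_zero : lead ≠ 0
  /-- the roots of `F` -/
  root : Fin 6 → K
  root_injective : Function.Injective root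

namespace Sextic

variable {K : Type*} [Field K] (S : Sextic K)

/-- The polynomial `F`. -/
def F : Polynomial K :=
  Polynomial.C S.lead * ∏ i : Fin 6, (Polynomial.X - Polynomial.C (S.root i))

/-- The coefficient `f_j` of `F`. -/
def f (j : ℕ) : K := S.F.coeff j

/-! ### The Kummer surface and its dual -/

/-- The form `F₀(x, u)`. -/
def F₀ (x u : K) : K :=
  2 * S.f 0 + S.f 1 * (x + u) + 2 * S.f 2 * (x * u) + S.f 3 * (x * u) * (x + u)
    + 2 * S.f 4 * (x * u) ^ 2 + S.f 5 * (x * u) ^ 2 * (x + u) + 2 * S.f 6 * (x * u) ^ 3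

/-- The coordinates `(1, x + u, x u, β₀)` of the point of the Kummer surface that belongs to the
divisor `(x, y) + (u, v)` (for `x ≠ u`). -/
def kummerCoords (x y u v : K) : Fin 4 → K :=
  ![1, x + u, x * u, (S.F₀ x u - 2 * (y * v)) / (x - u) ^ 2]

lemma kummerCoords_ne_zero (x y u v : K) : S.kummerCoords x y u v ≠ 0 := fun h => by
  simpa [kummerCoords] using congrFun h 0

/-- The same as a point of `ℙ³`. -/
def kummerPoint (x y u v : K) : ℙ K (Fin 4 → K) :=
  Projectivization.mk K (S.kummerCoords x y u v) (S.kummerCoords_ne_zero x y u v)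

/-- The Kummer surface `𝒦 ⊆ ℙ³`: the projective locus of the points `(1 : x + u : x u : β₀)`. -/
def kummer : Set (ℙ K (Fin 4 → K)) :=
  zariskiClosure {ξ | ∃ x y u v : K, y ^ 2 = S.F.eval x ∧ v ^ 2 = S.F.eval u ∧ x ≠ u ∧
    ξ = S.kummerPoint x y u v}

/-- The quartic form `K₂ ξ₄² + K₁ ξ₄ + K₀` that defines the Kummer surface. -/
def quartic : MvPolynomial (Fin 4) K :=
  let c : K → MvPolynomial (Fin 4) K := MvPolynomial.C
  let f : ℕ → K := S.f
  let ξ₁ : MvPolynomial (Fin 4) K := MvPolynomial.X 0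
  let ξ₂ : MvPolynomial (Fin 4) K := MvPolynomial.X 1
  let ξ₃ : MvPolynomial (Fin 4) K := MvPolynomial.X 2
  let ξ₄ : MvPolynomial (Fin 4) K := MvPolynomial.X 3
  let K₂ := ξ₂ ^ 2 - 4 * ξ₁ * ξ₃
  let K₁ := -2 * (2 * c (f 0) * ξ₁ ^ 3 + c (f 1) * ξ₁ ^ 2 * ξ₂ + 2 * c (f 2) * ξ₁ ^ 2 * ξ₃
    + c (f 3) * ξ₁ * ξ₂ * ξ₃ + 2 * c (f 4) * ξ₁ * ξ₃ ^ 2 + c (f 5) * ξ₂ * ξ₃ ^ 2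
    + 2 * c (f 6) * ξ₃ ^ 3)
  let K₀ := c (f 1 ^ 2 - 4 * f 0 * f 2) * ξ₁ ^ 4 - 4 * c (f 0 * f 3) * ξ₁ ^ 3 * ξ₂
    - 2 * c (f 1 * f 3) * ξ₁ ^ 3 * ξ₃ - 4 * c (f 0 * f 4) * ξ₁ ^ 2 * ξ₂ ^ 2
    + 4 * c (f 0 * f 5 - f 1 * f 4) * ξ₁ ^ 2 * ξ₂ * ξ₃
    + c (f 3 ^ 2 + 2 * f 1 * f 5 - 4 * f 2 * f 4 - 4 * f 0 * f 6) * ξ₁ ^ 2 * ξ₃ ^ 2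
    - 4 * c (f 0 * f 5) * ξ₁ * ξ₂ ^ 3
    + 4 * c (2 * f 0 * f 6 - f 1 * f 5) * ξ₁ * ξ₂ ^ 2 * ξ₃
    + 4 * c (f 1 * f 6 - f 2 * f 5) * ξ₁ * ξ₂ * ξ₃ ^ 2
    - 2 * c (f 3 * f 5) * ξ₁ * ξ₃ ^ 3 - 4 * c (f 0 * f 6) * ξ₂ ^ 4
    - 4 * c (f 1 * f 6) * ξ₂ ^ 3 * ξ₃ - 4 * c (f 2 * f 6) * ξ₂ ^ 2 * ξ₃ ^ 2
    - 4 * c (f 3 * f 6) * ξ₂ * ξ₃ ^ 3 + c (f 5 ^ 2 - 4 * f 4 * f 6) * ξ₃ ^ 4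
  K₂ * ξ₄ ^ 2 + K₁ * ξ₄ + K₀

/-- `η`, a point of the dual projective space, gives the tangent plane to `𝒦` at the (smooth)
point `ξ`: its coordinates are the partial derivatives of the quartic at `ξ`. -/
def IsTangentPlane (η ξ : ℙ K (Fin 4 → K)) : Prop :=
  ∃ (v : Fin 4 → K) (hv : v ≠ 0) (w : Fin 4 → K) (hw : w ≠ 0),
    ξ = Projectivization.mk K v hv ∧ η = Projectivization.mk K w hw ∧
    ∀ i, w i = MvPolynomial.eval v (MvPolynomial.pderiv i S.quartic)

/-- The projective dual `𝒦* ⊆ (ℙ³)ˇ` of the Kummer surface. -/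
def dualKummer : Set (ℙ K (Fin 4 → K)) :=
  zariskiClosure {η | ∃ ξ ∈ S.kummer, S.IsTangentPlane η ξ}

/-- The node `N₀ = (0 : 0 : 0 : 1)`. -/
def nodeZero : ℙ K (Fin 4 → K) :=
  Projectivization.mk K ![0, 0, 0, 1] (fun h => by simpa using congrFun h 3)

/-- The node `N_{ij}` (for `i ≠ j`), which belongs to the divisor `(θ_i, 0) + (θ_j, 0)`. -/
def node (i j : Fin 6) : ℙ K (Fin 4 → K) :=
  S.kummerPoint (S.root i) 0 (S.root j) 0

/-- The set of the sixteen nodes of `𝒦`. -/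
def nodes : Set (ℙ K (Fin 4 → K)) :=
  {ξ | ξ = nodeZero ∨ ∃ i j : Fin 6, i ≠ j ∧ ξ = S.node i j}

/-- The plane `T` is the trope `T_i`: it contains `N₀` and the `N_{ij}`, `j ≠ i`. A plane
contains a point if the dot product of their coordinate vectors is zero. -/
def IsTropeOne (i : Fin 6) (T : ℙ K (Fin 4 → K)) : Prop :=
  Projectivization.orthogonal T nodeZero ∧
    ∀ j : Fin 6, j ≠ i → Projectivization.orthogonal T (S.node i j)

/-- The plane `T` is the trope `T_{ijk}`: it contains the `N_{mn}`, `m ≠ n`, for which `{m, n}`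
is contained in `{i, j, k}` or disjoint from it. -/
def IsTropeThree (i j k : Fin 6) (T : ℙ K (Fin 4 → K)) : Prop :=
  ∀ m n : Fin 6, m ≠ n →
    (({m, n} : Finset (Fin 6)) ⊆ {i, j, k} ∨ Disjoint ({m, n} : Finset (Fin 6)) {i, j, k}) →
    Projectivization.orthogonal T (S.node m n)

/-- The curve (a conic, when `T` is a trope) that the plane `T` cuts on `𝒦`. -/
def planeSection (T : ℙ K (Fin 4 → K)) : Set (ℙ K (Fin 4 → K)) :=
  {ξ | ξ ∈ S.kummer ∧ Projectivization.orthogonal T ξ}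

/-! ### The desingularized Kummer surface and the maps `κ`, `κ*` -/

/-- The surface `𝒮 ⊆ ℙ⁵` of the `P = p₀ + ⋯ + p₅ X⁵` for which `P²` is congruent to a polynomial
of degree at most two modulo `F`. -/
def desing : Set (ℙ K (Fin 6 → K)) :=
  {a | ∀ (p : Fin 6 → K) (hp : p ≠ 0), Projectivization.mk K p hp = a →
    ∃ H : Polynomial K, H.natDegree ≤ 2 ∧ S.F ∣ toPoly p ^ 2 - H}

/-- The graph of `κ` on the dense open set of those points of `𝒦` which belong to divisors
`(x, y) + (u, v)` with `x ≠ u` and `y v ≠ 0`: let `M` be the cubic such that `Y - M(X)` vanishes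
twice on the divisor, i.e. `M(x) = y`, `M(u) = v` and `(X - x)² (X - u)²` divides `M² - F`; then
`κ` maps the point to the class of the `P` with `(X - x) (X - u) P ≡ M` modulo `F`. -/
def kappaGeneric : Set (ℙ K (Fin 4 → K) × ℙ K (Fin 6 → K)) :=
  {a | ∃ x y u v : K, y ^ 2 = S.F.eval x ∧ v ^ 2 = S.F.eval u ∧ y ≠ 0 ∧ v ≠ 0 ∧ x ≠ u ∧
    ∃ M : Polynomial K, M.natDegree ≤ 3 ∧ M.eval x = y ∧ M.eval u = v ∧
      ((Polynomial.X - Polynomial.C x) * (Polynomial.X - Polynomial.C u)) ^ 2 ∣ M ^ 2 - S.F ∧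
    ∃ (p : Fin 6 → K) (hp : p ≠ 0),
      S.F ∣ (Polynomial.X - Polynomial.C x) * (Polynomial.X - Polynomial.C u) * toPoly p - M ∧
      a = (S.kummerPoint x y u v, Projectivization.mk K p hp)}

/-- The graph of the rational map `κ : 𝒦 ⇢ 𝒮`, i.e. the closure of its graph over a dense open
subset of `𝒦`. -/
def kappaGraph : Set (ℙ K (Fin 4 → K) × ℙ K (Fin 6 → K)) :=
  zariskiClosureProd S.kappaGeneric

/-- The graph of the rational map `κ* : 𝒦* ⇢ 𝒮` that satisfies `κ*(η) = κ(ξ)` whenever `η` gives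
the tangent plane to `𝒦` at the general point `ξ`. -/
def kappaDualGraph : Set (ℙ K (Fin 4 → K) × ℙ K (Fin 6 → K)) :=
  zariskiClosureProd {a | ∃ ξ, S.IsTangentPlane a.1 ξ ∧ (ξ, a.2) ∈ S.kappaGeneric}

/-- The total transform of a point under a rational map to `𝒮` with graph `Γ`, that is, the
subset of `𝒮` into which the map blows up the point. When `Γ` is the graph of a birational map
whose inverse is a morphism, it is the fibre of the inverse over the point. -/
def blowUp (Γ : Set (ℙ K (Fin 4 → K) × ℙ K (Fin 6 → K))) (ξ : ℙ K (Fin 4 → K)) :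
    Set (ℙ K (Fin 6 → K)) :=
  {a | a ∈ S.desing ∧ (ξ, a) ∈ Γ}

/-- The strict transform by `κ` of a curve on `𝒦`: the closure of the transform of the curve
deprived of the nodes. -/
def strictTransform (B : Set (ℙ K (Fin 4 → K))) : Set (ℙ K (Fin 6 → K)) :=
  zariskiClosure {a | ∃ ξ ∈ B, ξ ∉ S.nodes ∧ a ∈ S.blowUp S.kappaGraph ξ}

/-! ### The involutions `ε^{(i)}` and the lines on `𝒮` -/

/-- The polynomial `P_i = ∏_{m ≠ i} (X - θ_m)`. -/
def P (i : Fin 6) : Polynomial K :=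
  ∏ m ∈ Finset.univ.erase i, (Polynomial.X - Polynomial.C (S.root m))

/-- The polynomial `g_i = 1 - 2 P_i / P_i(θ_i)`. -/
def g (i : Fin 6) : Polynomial K :=
  1 - Polynomial.C (2 / (S.P i).eval (S.root i)) * S.P i

/-- The linear map `P ↦ g_i P mod F` on coefficient vectors. -/
def epsLin (i : Fin 6) : (Fin 6 → K) →ₗ[K] (Fin 6 → K) where
  toFun p := fun j => ((S.g i * toPoly p) % S.F).coeff j
  map_add' p q := by
    have h : toPoly (p + q) = toPoly p + toPoly q := by
      simp [toPoly, add_mul, Finset.sum_add_distrib]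
    funext j
    simp [h, mul_add, Polynomial.add_mod]
  map_smul' c p := by
    have h : toPoly (c • p) = c • toPoly p := by
      simp [toPoly, Finset.smul_sum, Polynomial.smul_eq_C_mul, mul_assoc]
    funext j
    simp [h, Polynomial.mod_def, Polynomial.smul_modByMonic]

lemma epsLin_injective (i : Fin 6) : Function.Injective (S.epsLin i) := by
  rw [injective_iff_map_eq_zero]
  intro p hp
  have hF : S.F.natDegree = 6 := by
    rw [F, Polynomial.natDegree_C_mul S.lead_ne_zero, Polynomial.natDegree_finsetProd_X_sub_C_eq_card]
    simp
  have hF0 : S.F ≠ 0 := fun h => by simp [h] at hF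
  have hroot (m : Fin 6) : S.F.eval (S.root m) = 0 := by
    simp [F, Polynomial.eval_prod, Finset.prod_eq_zero (Finset.mem_univ m)]
  have hmod : (S.g i * toPoly p) % S.F = 0 := by
    ext n
    by_cases hn : n < 6
    · exact congrFun hp ⟨n, hn⟩
    · rw [Polynomial.coeff_zero]
      apply Polynomial.coeff_eq_zero_of_degree_lt
      refine (Polynomial.degree_mod_lt _ hF0).trans_le ?_
      rw [Polynomial.degree_eq_natDegree hF0, hF]
      exact_mod_cast not_lt.mp hn
  have hPi : (S.P i).eval (S.root i) ≠ 0 := by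
    simp only [P, Polynomial.eval_prod, Polynomial.eval_sub, Polynomial.eval_X, Polynomial.eval_C]
    refine Finset.prod_ne_zero_iff.mpr fun m hm => sub_ne_zero.mpr fun h => ?_
    exact (Finset.ne_of_mem_erase hm) (S.root_injective h).symm
  have hg (m : Fin 6) : (S.g i).eval (S.root m) ≠ 0 := by
    by_cases hm : m = i
    · subst hm
      simp [g, hPi]
      norm_num
    · have : (S.P i).eval (S.root m) = 0 := by
        simp only [P, Polynomial.eval_prod]
        exact Finset.prod_eq_zero (Finset.mem_erase.mpr ⟨hm, Finset.mem_univ m⟩) (by simp)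
      simp [g, this]
  have hzero (m : Fin 6) : (toPoly p).eval (S.root m) = 0 := by
    obtain ⟨q, hq⟩ := (EuclideanDomain.mod_eq_zero).mp hmod
    have := congrArg (Polynomial.eval (S.root m)) hq
    rw [Polynomial.eval_mul, Polynomial.eval_mul, hroot, zero_mul] at this
    exact (mul_eq_zero.mp this).resolve_left (hg m)
  have hdeg : (toPoly p).natDegree < 6 := by
    refine lt_of_le_of_lt (Polynomial.natDegree_sum_le_of_forall_le (n := 5) _ _ fun j _ => ?_)
      (by norm_num)
    exact (Polynomial.natDegree_C_mul_X_pow_le _ _).trans (by omega)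
  have h0 : toPoly p = 0 :=
    Polynomial.eq_zero_of_natDegree_lt_card_of_eval_eq_zero _ S.root_injective hzero (by simpa)
  funext j
  have := congrArg (fun q => Polynomial.coeff q (j : ℕ)) h0
  simpa [toPoly, Polynomial.coeff_X_pow, Fin.val_inj] using this

/-- The involution `ε^{(i)}`, as a map on `ℙ⁵`. -/
def eps (i : Fin 6) : ℙ K (Fin 6 → K) → ℙ K (Fin 6 → K) :=
  Projectivization.map (S.epsLin i) (S.epsLin_injective i)

/-- The line `Δ₀` of the points `p₀ + p₁ X`. -/
def lineZero : Set (ℙ K (Fin 6 → K)) :=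
  {a | ∃ (p : Fin 6 → K) (hp : p ≠ 0), a = Projectivization.mk K p hp ∧
    p 2 = 0 ∧ p 3 = 0 ∧ p 4 = 0 ∧ p 5 = 0}

/-- The line `Δ_i = ε^{(i)}(Δ₀)`. -/
def lineOne (i : Fin 6) : Set (ℙ K (Fin 6 → K)) := S.eps i '' lineZero

/-- The line `Δ_{ij} = ε^{(i)} ε^{(j)}(Δ₀)`. -/
def lineTwo (i j : Fin 6) : Set (ℙ K (Fin 6 → K)) := S.eps i '' (S.eps j '' lineZero)

/-- The line `Δ_{ijk} = ε^{(i)} ε^{(j)} ε^{(k)}(Δ₀)`. -/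
def lineThree (i j k : Fin 6) : Set (ℙ K (Fin 6 → K)) :=
  S.eps i '' (S.eps j '' (S.eps k '' lineZero))

/-- The point `(-θ_i : 1 : 0 : 0 : 0 : 0)`, i.e. the class of the polynomial `X - θ_i`. -/
def linearPoint (i : Fin 6) : ℙ K (Fin 6 → K) :=
  Projectivization.mk K ![-S.root i, 1, 0, 0, 0, 0] (fun h => by simpa using congrFun h 1)

end Sextic

end

end KummerSurface

/-!
# The lines on the desingularized Kummer surface over its nodes and tropes

A class `P` modulo `F` is determined by its values `π_m = P(θ_m)`, and `ε^{(i)}` changes the sign of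
the `i`-th one. So all the lines in question are `Δ_I`, the set of those `P` which after the sign
changes in a set `I` of indices have degree at most one (`lineSign`). Their intersections follow
from the fact that a nonzero polynomial of degree at most one has at most one root.

The link with `ℙ³` is through line geometry. The moments `b_j = ∑ θ_m ^ j π_m / F'(θ_m)` are
coordinates on the space of classes, and a linear map `line` takes them to Plücker coordinates in
such a way that the Plücker form becomes `∑ π_m ² / F'(θ_m)`. The class of `P` is on `𝒮` if and only
if `∑ θ_m ^ k π_m ² / F'(θ_m) = 0` for `k = 0, 1, 2`, that is, if the vectors attached to `P` and
`X P` are lines that meet. In this case they are distinct, and have exactly one common point and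
one common plane (`IsNull.point_unique`, `IsNull.plane_unique`). If `P = κ(ξ)` for a general point
`ξ` of `𝒦`, the common point is `ξ` and the common plane is the tangent plane at `ξ`
(`IsGenericMoments.join_kummerCoords`, `IsGenericMoments.meet_gradient`). Thus the graphs of `κ` and
`κ*` satisfy bilinear equations, and over a nonempty open set of points `ξ` each solution of these
equations is in the graph (`mem_kappaGeneric_of_join`).

The upper bounds for the total transforms come from the equations. The line attached to `P` passes
through the node of `I`, or lies in the trope of `I`, if and only if the moments `b₀, b₁, b₂` vanish
after the sign changes in `I` (`join_node_eq_zero_iff` and its analogues). For `P` and `X P`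
together this means that the first four moments vanish, so that `P` is on `Δ_I`. For the strict
transform of a trope conic one uses that through a point `ξ` of the plane there is a line of the
pencil spanned by the lines of `P` and `X P` that lies in the plane; then `P` is on `Δ_I` or on a
line `Δ_J` which belongs to a node (`mem_lineSign_or_of_meet`).

For the lower bounds we approach almost every point of `Δ_I` along an arc of nondegenerate
solutions over the power series ring. For `Δ₀` this is the arc of the divisors
`(x, y) + (x + t, -y + ⋯)`. In the other cases we take `π_m = ± √((θ_m - z)² + t)`, which stays on
`𝒮` because `π_m ²` is a polynomial of degree two in `θ_m`, and the common points and planes of the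
lines attached to it. By the Nullstellensatz the specialization of such an arc lies in the Zariski
closure (`eval_specialize_eq_zero`), and since the graphs are closed, all of `Δ_I` is reached.
-/

namespace KummerSurface

open scoped LinearAlgebra.Projectivization symmDiff

noncomputable section

/-! ### Lines in three-space -/

section Lines

variable {R : Type*} [CommRing R]

/-- The plane that joins the line with Plücker coordinates `l` and the point `ξ`; it is zero exactly
when `ξ` lies on the line. The coordinates are ordered as `l = (b₀, b₁, b₂, a₀, a₁, a₂)`, with
Plücker relation `a₀ b₀ + a₁ b₁ + a₂ b₂ = 0`. For an arbitrary `l` this is the product of an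
alternating matrix with `ξ`. -/
def join (l : Fin 6 → R) (ξ : Fin 4 → R) : Fin 4 → R :=
  ![ξ 2 * l 4 + ξ 1 * l 3 + ξ 3 * l 2,
    -(ξ 0 * l 3 - ξ 2 * l 5 + ξ 3 * l 1),
    -(ξ 1 * l 5) - ξ 0 * l 4 + ξ 3 * l 0,
    -(l 0 * ξ 2 - l 1 * ξ 1 + l 2 * ξ 0)]

/-- The coordinates of `l` as a line of the dual space, i.e. as an intersection of planes. -/
def dualLine (l : Fin 6 → R) : Fin 6 → R := ![-l 3, -l 4, -l 5, -l 0, -l 1, -l 2]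

/-- The intersection of the line `l` with the plane `η`, dual to `join`. -/
def meet (l : Fin 6 → R) (η : Fin 4 → R) : Fin 4 → R := join (dualLine l) η

/-- The polar form of the Plücker quadric. It vanishes on two lines that meet. -/
def linePair (l l' : Fin 6 → R) : R :=
  l 0 * l' 3 + l 1 * l' 4 + l 2 * l' 5 + l 3 * l' 0 + l 4 * l' 1 + l 5 * l' 2

/-- The Plücker quadratic form. -/
def quad (l : Fin 6 → R) : R := l 0 * l 3 + l 1 * l 4 + l 2 * l 5

lemma dualLine_dualLine (l : Fin 6 → R) : dualLine (dualLine l) = l := by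
  ext i; fin_cases i <;> simp [dualLine]

lemma meet_dualLine (l : Fin 6 → R) (η : Fin 4 → R) : meet (dualLine l) η = join l η := by
  rw [meet, dualLine_dualLine]

lemma linePair_self (l : Fin 6 → R) : linePair l l = 2 * quad l := by
  simp [linePair, quad]; ring

lemma join_add_left (l l' : Fin 6 → R) (ξ : Fin 4 → R) :
    join (l + l') ξ = join l ξ + join l' ξ := by
  ext i; fin_cases i <;> simp [join] <;> ring

lemma join_smul_left (c : R) (l : Fin 6 → R) (ξ : Fin 4 → R) :
    join (c • l) ξ = c • join l ξ := by
  ext i; fin_cases i <;> simp [join] <;> ring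

lemma join_smul_right (c : R) (l : Fin 6 → R) (ξ : Fin 4 → R) :
    join l (c • ξ) = c • join l ξ := by
  ext i; fin_cases i <;> simp [join] <;> ring

lemma dualLine_smul (c : R) (l : Fin 6 → R) : dualLine (c • l) = c • dualLine l := by
  ext i; fin_cases i <;> simp [dualLine]

lemma dualLine_add (l l' : Fin 6 → R) : dualLine (l + l') = dualLine l + dualLine l' := by
  ext i; fin_cases i <;> simp [dualLine] <;> ring

lemma meet_add_left (l l' : Fin 6 → R) (ξ : Fin 4 → R) :
    meet (l + l') ξ = meet l ξ + meet l' ξ := by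
  rw [meet, dualLine_add, join_add_left]; rfl

lemma meet_smul_left (c : R) (l : Fin 6 → R) (ξ : Fin 4 → R) :
    meet (c • l) ξ = c • meet l ξ := by
  rw [meet, dualLine_smul, join_smul_left]; rfl

lemma meet_smul_right (c : R) (l : Fin 6 → R) (ξ : Fin 4 → R) :
    meet l (c • ξ) = c • meet l ξ := join_smul_right _ _ _

lemma join_zero_right (l : Fin 6 → R) : join l 0 = 0 := by
  simpa using join_smul_right (0 : R) l 0

lemma map_join {R' : Type*} [CommRing R'] (φ : R →+* R') (l : Fin 6 → R) (ξ : Fin 4 → R) :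
    (fun i => φ (join l ξ i)) = join (fun i => φ (l i)) (fun i => φ (ξ i)) := by
  ext i; fin_cases i <;> simp [join]

lemma map_dualLine {R' : Type*} [CommRing R'] (φ : R →+* R') (l : Fin 6 → R) :
    (fun i => φ (dualLine l i)) = dualLine (fun i => φ (l i)) := by
  ext i; fin_cases i <;> simp [dualLine]

lemma map_meet {R' : Type*} [CommRing R'] (φ : R →+* R') (l : Fin 6 → R) (ξ : Fin 4 → R) :
    (fun i => φ (meet l ξ i)) = meet (fun i => φ (l i)) (fun i => φ (ξ i)) := by
  rw [meet, meet, map_join, map_dualLine]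

lemma join_meet_add (l l' : Fin 6 → R) (η : Fin 4 → R) :
    join l (meet l' η) + join l' (meet l η) = linePair l l' • η := by
  ext i; fin_cases i <;> simp [join, meet, dualLine, linePair] <;> ring

lemma meet_join_add (l l' : Fin 6 → R) (η : Fin 4 → R) :
    meet l (join l' η) + meet l' (join l η) = linePair l l' • η := by
  ext i; fin_cases i <;> simp [join, meet, dualLine, linePair] <;> ring

lemma join_meet_self (l : Fin 6 → R) (η : Fin 4 → R) : join l (meet l η) = quad l • η := by
  ext i; fin_cases i <;> simp [join, meet, dualLine, quad] <;> ring

lemma meet_join_self (l : Fin 6 → R) (η : Fin 4 → R) : meet l (join l η) = quad l • η := by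
  ext i; fin_cases i <;> simp [join, meet, dualLine, quad] <;> ring

/-- A line through `ξ` meets a plane through `ξ` in the point `ξ`, unless it is contained in the
plane. -/
lemma meet_proportional {l : Fin 6 → R} {ξ η : Fin 4 → R} (h : join l ξ = 0)
    (hη : η ⬝ᵥ ξ = 0) (i j : Fin 4) : ξ i * meet l η j = ξ j * meet l η i := by
  have h0 := congrFun h 0
  have h1 := congrFun h 1
  have h2 := congrFun h 2
  have h3 := congrFun h 3
  simp [join] at h0 h1 h2 h3
  simp [dotProduct, Fin.sum_univ_four] at hη
  fin_cases i <;> fin_cases j <;> simp [meet, join, dualLine] <;> grind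

lemma join_proportional {l : Fin 6 → R} {ξ η : Fin 4 → R} (h : meet l η = 0)
    (hξ : η ⬝ᵥ ξ = 0) (i j : Fin 4) : η i * join l ξ j = η j * join l ξ i := by
  rw [← meet_dualLine]
  exact meet_proportional h (by rw [dotProduct_comm, hξ]) i j

/-- A plane that contains a line contains each point of that line. -/
lemma line_mul_incidence {l : Fin 6 → R} {ξ η : Fin 4 → R} (h : join l ξ = 0)
    (hη : meet l η = 0) (i : Fin 6) : l i * (η ⬝ᵥ ξ) = 0 := by
  have h0 := congrFun h 0
  have h1 := congrFun h 1
  have h2 := congrFun h 2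
  have h3 := congrFun h 3
  have k0 := congrFun hη 0
  have k1 := congrFun hη 1
  have k2 := congrFun hη 2
  have k3 := congrFun hη 3
  simp [join] at h0 h1 h2 h3
  simp [meet, join, dualLine] at k0 k1 k2 k3
  simp [dotProduct, Fin.sum_univ_four]
  fin_cases i <;> simp <;> grind

/-- If `l` and `l'` are orthogonal for the polar form and the product of the matrices of `meet l`
and `join l'` vanishes, then `l` and `l'` are the same line. -/
lemma line_proportional {l l' : Fin 6 → R} (h : ∀ ξ, meet l (join l' ξ) = 0)
    (hl : linePair l l' = 0) (i j : Fin 6) : l i * l' j = l j * l' i := by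
  have h0 := fun k => congrFun (h ![1, 0, 0, 0]) k
  have h1 := fun k => congrFun (h ![0, 1, 0, 0]) k
  have h2 := fun k => congrFun (h ![0, 0, 1, 0]) k
  have h3 := fun k => congrFun (h ![0, 0, 0, 1]) k
  simp [Fin.forall_fin_succ, join, meet, dualLine] at h0 h1 h2 h3
  simp [linePair] at hl
  obtain ⟨a0, a1, a2, a3⟩ := h0
  obtain ⟨b0, b1, b2, b3⟩ := h1
  obtain ⟨c0, c1, c2, c3⟩ := h2
  obtain ⟨d0, d1, d2, d3⟩ := h3
  fin_cases i <;> fin_cases j <;> simp <;> grind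

lemma dotProduct_meet_join (l l' : Fin 6 → R) (ξ η : Fin 4 → R) :
    η ⬝ᵥ meet l (join l' ξ) = ξ ⬝ᵥ join l' (meet l η) := by
  simp [dotProduct, Fin.sum_univ_four, join, meet, dualLine]; ring

lemma dotProduct_join_comm (l : Fin 6 → R) (ξ η : Fin 4 → R) :
    join l η ⬝ᵥ ξ = -(η ⬝ᵥ join l ξ) := by
  simp [dotProduct, Fin.sum_univ_four, join]; ring

lemma dotProduct_meet_comm (l : Fin 6 → R) (ξ η : Fin 4 → R) :
    meet l η ⬝ᵥ ξ = -(η ⬝ᵥ meet l ξ) := dotProduct_join_comm _ _ _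

end Lines

/-! ### Zariski closures and specialization -/

section Closure

variable {K : Type*} [Field K]

lemma mk_eq_mk_of_proportional {n : ℕ} {a b : Fin n → K} (ha : a ≠ 0)
    (hb : b ≠ 0) (h : ∀ i j, a i * b j = a j * b i) :
    Projectivization.mk K a ha = Projectivization.mk K b hb := by
  obtain ⟨i, hi⟩ := Function.ne_iff.1 hb
  simp only [Pi.zero_apply] at hi
  refine (Projectivization.mk_eq_mk_iff' K _ _ _ _).2 ⟨a i / b i, ?_⟩
  ext j
  simp only [Pi.smul_apply, smul_eq_mul]
  field_simp
  linear_combination h i j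

lemma mem_zariskiClosure_mk {n : ℕ} {A : Set (ℙ K (Fin n → K))} {v : Fin n → K} (hv : v ≠ 0)
    (h : ∀ G : MvPolynomial (Fin n) K,
      (∀ (v : Fin n → K) (hv : v ≠ 0), Projectivization.mk K v hv ∈ A →
        MvPolynomial.eval v G = 0) →
      ∀ c : K, c ≠ 0 → MvPolynomial.eval (c • v) G = 0) :
    Projectivization.mk K v hv ∈ zariskiClosure A := by
  intro G hG v' hv' e
  obtain ⟨c, rfl⟩ := (Projectivization.mk_eq_mk_iff' K _ _ hv' hv).1 e
  exact h G hG c (fun h => hv' (by simp [h]))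

lemma mem_zariskiClosureProd_mk {m n : ℕ} {A : Set (ℙ K (Fin m → K) × ℙ K (Fin n → K))}
    {v : Fin m → K} (hv : v ≠ 0) {w : Fin n → K} (hw : w ≠ 0)
    (h : ∀ G : MvPolynomial (Fin m ⊕ Fin n) K,
      (∀ (v : Fin m → K) (hv : v ≠ 0) (w : Fin n → K) (hw : w ≠ 0),
        (Projectivization.mk K v hv, Projectivization.mk K w hw) ∈ A →
        MvPolynomial.eval (Sum.elim v w) G = 0) →
      ∀ c d : K, c ≠ 0 → d ≠ 0 → MvPolynomial.eval (Sum.elim (c • v) (d • w)) G = 0) :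
    (Projectivization.mk K v hv, Projectivization.mk K w hw) ∈ zariskiClosureProd A := by
  intro G hG v' hv' w' hw' e
  rw [Prod.mk.injEq] at e
  obtain ⟨c, rfl⟩ := (Projectivization.mk_eq_mk_iff' K _ _ hv' hv).1 e.1
  obtain ⟨d, rfl⟩ := (Projectivization.mk_eq_mk_iff' K _ _ hw' hw).1 e.2
  exact h G hG c d (fun h => hv' (by simp [h])) (fun h => hw' (by simp [h]))

lemma subset_zariskiClosure {n : ℕ} (A : Set (ℙ K (Fin n → K))) : A ⊆ zariskiClosure A := by
  rintro a ha G hG v hv rfl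
  exact hG v hv ha

lemma zariskiClosure_mono {n : ℕ} {A B : Set (ℙ K (Fin n → K))} (h : A ⊆ B) :
    zariskiClosure A ⊆ zariskiClosure B :=
  fun _ ha G hG => ha G fun v hv hvA => hG v hv (h hvA)

lemma zariskiClosureProd_fst {m n : ℕ} {A : Set (ℙ K (Fin m → K) × ℙ K (Fin n → K))}
    {a : ℙ K (Fin m → K) × ℙ K (Fin n → K)} (ha : a ∈ zariskiClosureProd A) :
    a.1 ∈ zariskiClosure (Prod.fst '' A) := by
  obtain ⟨a, b⟩ := a
  intro G hG v hv e
  induction b with | h w hw =>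
  have := ha (MvPolynomial.rename Sum.inl G) (fun v hv w hw h => by
    rw [MvPolynomial.eval_rename]
    exact hG v hv ⟨_, h, rfl⟩) v hv w hw (by rw [e])
  rwa [MvPolynomial.eval_rename] at this

lemma eval_line_eq_zero [Infinite K] {ι : Type*} (E : MvPolynomial ι K) (p q : ι → K) {B : Set K}
    (hB : B.Finite) (h : ∀ τ ∉ B, MvPolynomial.eval (p + τ • q) E = 0) :
    MvPolynomial.eval p E = 0 := by
  let Q : Polynomial K := MvPolynomial.aeval
    (fun i => Polynomial.C (p i) + Polynomial.X * Polynomial.C (q i)) E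
  have hQ (τ : K) : Q.eval τ = MvPolynomial.eval (p + τ • q) E := by
    have := MvPolynomial.comp_aeval_apply
      (fun i => Polynomial.C (p i) + Polynomial.X * Polynomial.C (q i)) (Polynomial.aeval τ) E
    rw [← Polynomial.coe_aeval_eq_eval, ← MvPolynomial.coe_aeval_eq_eval]
    change (Polynomial.aeval τ) Q = _
    rw [this]
    simp only [map_add, map_mul, Polynomial.aeval_C, Polynomial.aeval_X, Algebra.algebraMap_self,
      RingHom.id_apply]
    rfl
  have h0 : Q = 0 := by
    refine Polynomial.eq_zero_of_infinite_isRoot _ (hB.infinite_compl.mono fun τ hτ => ?_)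
    exact (hQ τ).trans (h τ hτ)
  simpa [h0] using (hQ 0).symm

lemma zariskiClosure_line [Infinite K] {n : ℕ} {A : Set (ℙ K (Fin n → K))} {p q : Fin n → K}
    (hp : p ≠ 0) {B : Set K} (hB : B.Finite)
    (h : ∀ τ ∉ B, ∃ hτ : p + τ • q ≠ 0, Projectivization.mk K _ hτ ∈ zariskiClosure A) :
    Projectivization.mk K p hp ∈ zariskiClosure A := by
  refine mem_zariskiClosure_mk hp fun G hG c hc =>
    eval_line_eq_zero G _ (c • q) hB fun τ hτ => ?_
  obtain ⟨h0, h1⟩ := h τ hτ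
  have e : c • p + τ • c • q = c • (p + τ • q) := by rw [smul_add, smul_comm]
  rw [e]
  exact h1 G hG _ (smul_ne_zero hc h0) ((Projectivization.mk_eq_mk_iff' K _ _ _ _).2 ⟨c, rfl⟩)

lemma zariskiClosureProd_line [Infinite K] {m n : ℕ}
    {A : Set (ℙ K (Fin m → K) × ℙ K (Fin n → K))} {a : ℙ K (Fin m → K)} {p q : Fin n → K}
    (hp : p ≠ 0) {B : Set K} (hB : B.Finite)
    (h : ∀ τ ∉ B, ∃ hτ : p + τ • q ≠ 0, (a, Projectivization.mk K _ hτ) ∈ zariskiClosureProd A) :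
    (a, Projectivization.mk K p hp) ∈ zariskiClosureProd A := by
  induction a with | h v hv =>
  refine mem_zariskiClosureProd_mk hv hp fun G hG c d hc hd =>
    eval_line_eq_zero G _ (Sum.elim (0 : Fin m → K) (d • q)) hB fun τ hτ => ?_
  obtain ⟨h0, h1⟩ := h τ hτ
  have e : (Sum.elim (c • v) (d • p) : Fin m ⊕ Fin n → K) + τ • Sum.elim (0 : Fin m → K) (d • q)
      = Sum.elim (c • v) (d • (p + τ • q)) := by
    ext (i | i)
    · simp
    · simp
      ring
  rw [e]
  exact h1 G hG _ (smul_ne_zero hc hv) _ (smul_ne_zero hd h0) (Prod.ext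
    ((Projectivization.mk_eq_mk_iff' K _ _ _ _).2 ⟨c, rfl⟩)
    ((Projectivization.mk_eq_mk_iff' K _ _ _ _).2 ⟨d, rfl⟩))

/-- Specialization: let `E` vanish at all `K`-points of the locally closed set `eqs = 0`, `u ≠ 0`,
and let `a` be a point of it over a domain `R`. Then `E` vanishes at the image of `a` under any
`φ : R → K`, even if `u` vanishes there. By the Nullstellensatz a power of `E u` is in the ideal of
`eqs`. -/
lemma eval_specialize_eq_zero [IsAlgClosed K] {σ : Type*} [Finite σ] {R : Type*} [CommRing R]
    [IsDomain R] [Algebra K R] (φ : R →ₐ[K] K) (eqs : Set (MvPolynomial σ K))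
    (E u : MvPolynomial σ K)
    (h : ∀ a : σ → K, (∀ e ∈ eqs, MvPolynomial.eval a e = 0) → MvPolynomial.eval a u ≠ 0 →
      MvPolynomial.eval a E = 0)
    (a : σ → R) (ha : ∀ e ∈ eqs, MvPolynomial.aeval a e = 0) (hu : MvPolynomial.aeval a u ≠ 0) :
    MvPolynomial.eval (fun i => φ (a i)) E = 0 := by
  have hmem : E * u ∈ (Ideal.span eqs).radical := by
    rw [← MvPolynomial.vanishingIdeal_zeroLocus_eq_radical (K := K),
      MvPolynomial.mem_vanishingIdeal_iff]
    intro x hx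
    rw [MvPolynomial.mem_zeroLocus_iff] at hx
    rw [MvPolynomial.aeval_eq_eval, map_mul]
    by_cases hxu : MvPolynomial.eval x u = 0
    · rw [hxu, mul_zero]
    · rw [h x (fun e he => ?_) hxu, zero_mul]
      have := hx e (Ideal.subset_span he)
      rwa [MvPolynomial.aeval_eq_eval] at this
  obtain ⟨n, hn⟩ := hmem
  have hker : Ideal.span eqs ≤ RingHom.ker (MvPolynomial.aeval a : MvPolynomial σ K →ₐ[K] R) :=
    Ideal.span_le.2 fun e he => ha e he
  have h1 : MvPolynomial.aeval a (E * u) = 0 := by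
    have := hker hn
    rw [RingHom.mem_ker, map_pow] at this
    exact eq_zero_of_pow_eq_zero this
  rw [map_mul] at h1
  have h2 := (mul_eq_zero.1 h1).resolve_right hu
  have := MvPolynomial.comp_aeval_apply a φ E
  rw [h2, map_zero] at this
  rw [← MvPolynomial.coe_aeval_eq_eval]
  exact this.symm

/-- The specialization principle for the closure of a subset of a product of two projective spaces,
where `V` and `W` give the coordinates of the two points in terms of the parameters. -/
lemma mem_zariskiClosureProd_of_specialize [IsAlgClosed K] {m n : ℕ}
    {A : Set (ℙ K (Fin m → K) × ℙ K (Fin n → K))} {σ : Type*} [Finite σ]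
    {R : Type*} [CommRing R] [IsDomain R] [Algebra K R] (φ : R →ₐ[K] K)
    (eqs : Set (MvPolynomial σ K)) (u : MvPolynomial σ K)
    (V : Fin m → MvPolynomial σ K) (W : Fin n → MvPolynomial σ K)
    (h : ∀ a : σ → K, (∀ e ∈ eqs, MvPolynomial.eval a e = 0) → MvPolynomial.eval a u ≠ 0 →
      ∃ (hv : (fun i => MvPolynomial.eval a (V i)) ≠ 0)
        (hw : (fun i => MvPolynomial.eval a (W i)) ≠ 0),
        (Projectivization.mk K _ hv, Projectivization.mk K _ hw) ∈ A)
    (a : σ → R) (ha : ∀ e ∈ eqs, MvPolynomial.aeval a e = 0) (hu : MvPolynomial.aeval a u ≠ 0)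
    {v : Fin m → K} (hv : v ≠ 0) (hva : (fun i => φ (MvPolynomial.aeval a (V i))) = v)
    {w : Fin n → K} (hw : w ≠ 0) (hwa : (fun i => φ (MvPolynomial.aeval a (W i))) = w) :
    (Projectivization.mk K v hv, Projectivization.mk K w hw) ∈ zariskiClosureProd A := by
  refine mem_zariskiClosureProd_mk hv hw fun G hG c d hc hd => ?_
  let Z : Fin m ⊕ Fin n → MvPolynomial σ K := Sum.elim (c • V) (d • W)
  have key := eval_specialize_eq_zero φ eqs (MvPolynomial.bind₁ Z G) u (fun a ha hu => by
    obtain ⟨hv, hw, hA⟩ := h a ha hu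
    have e : (fun i => MvPolynomial.eval a (Z i)) = Sum.elim
        (c • (fun i => MvPolynomial.eval a (V i))) (d • (fun i => MvPolynomial.eval a (W i))) := by
      ext i
      rcases i with i | i <;> simp [Z]
    have e' : MvPolynomial.eval a (MvPolynomial.bind₁ Z G)
        = MvPolynomial.eval (fun i => MvPolynomial.eval a (Z i)) G :=
      MvPolynomial.eval₂Hom_bind₁ _ _ _ _
    rw [e', e]
    refine hG _ (smul_ne_zero hc hv) _ (smul_ne_zero hd hw) ?_
    rwa [(Projectivization.mk_eq_mk_iff' K _ _ (smul_ne_zero hc hv) hv).2 ⟨c, rfl⟩,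
      (Projectivization.mk_eq_mk_iff' K _ _ (smul_ne_zero hd hw) hw).2 ⟨d, rfl⟩]) a ha hu
  have e' : MvPolynomial.eval (fun i => φ (a i)) (MvPolynomial.bind₁ Z G)
      = MvPolynomial.eval (fun i => MvPolynomial.eval (fun i => φ (a i)) (Z i)) G :=
    MvPolynomial.eval₂Hom_bind₁ _ _ _ _
  rw [e'] at key
  have hφ (q : MvPolynomial σ K) : MvPolynomial.eval (fun i => φ (a i)) q
      = φ (MvPolynomial.aeval a q) := by
    rw [MvPolynomial.comp_aeval_apply]; rfl
  have e : Sum.elim (c • v) (d • w)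
      = fun i => MvPolynomial.eval (fun i => φ (a i)) (Z i) := by
    ext i
    rcases i with i | i
    · simp [Z, hφ, ← hva]
    · simp [Z, hφ, ← hwa]
  rw [e, key]

end Closure

/-! ### Square roots of power series -/

section PowerSeries

variable {K : Type*} [Field K]

open PowerSeries in
/-- Square roots of power series, from the Catalan series `c` with `c = 1 + c² X`: the square of
`1 - 2 h c(h)` is `1 - 4 h`. -/
lemma exists_powerSeries_sq (hK : (2 : K) ≠ 0) (f : PowerSeries K) (a : K) (ha : a ≠ 0)
    (hf : constantCoeff f = a ^ 2) : ∃ g : PowerSeries K, g ^ 2 = f ∧ constantCoeff g = a := by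
  set h : PowerSeries K := C (1 / 4 : K) * (1 - C (a⁻¹ ^ 2) * f) with hh
  have h4 : (4 : K) ≠ 0 := by
    have := mul_ne_zero hK hK
    norm_num at this
    exact this
  have h0 : constantCoeff h = 0 := by
    simp [hh, hf]
    right
    field_simp
    ring
  have hs : HasSubst h := HasSubst.of_constantCoeff_zero' h0
  have hcat : (catalanSeries.map (Nat.castRingHom K)) ^ 2 * X + 1
      = catalanSeries.map (Nat.castRingHom K) := by
    have := congrArg (PowerSeries.map (Nat.castRingHom K)) catalanSeries_sq_mul_X_add_one
    simpa using this
  set c := (catalanSeries.map (Nat.castRingHom K)).subst h with hc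
  have hce : c ^ 2 * h + 1 = c := by
    have := congrArg (substAlgHom hs) hcat
    rw [map_add, map_mul, map_pow, map_one, substAlgHom_X, coe_substAlgHom] at this
    exact this
  have hfh : f = C (a ^ 2) * (1 - 4 * h) := by
    have e1 : (C (1 / 4 : K) : PowerSeries K) * 4 = 1 := by
      rw [show (4 : PowerSeries K) = C (4 : K) from (map_ofNat (C : K →+* PowerSeries K) 4).symm,
        ← map_mul, one_div, inv_mul_cancel₀ h4, map_one]
    have e2 : (C (a ^ 2) : PowerSeries K) * C (a⁻¹ ^ 2) = 1 := by
      rw [← map_mul, ← mul_pow, mul_inv_cancel₀ ha, one_pow, map_one]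
    rw [hh]
    linear_combination (-f) * e2 + (C (a ^ 2) * (1 - C (a⁻¹ ^ 2) * f)) * e1
  refine ⟨C a * (1 - 2 * h * c), ?_, ?_⟩
  · rw [hfh, map_pow]
    linear_combination (C a ^ 2 * 4 * h) * hce
  · simp [h0]

open PowerSeries in
/-- A nonzero square times a power series of order one is not a square. -/
lemma eq_zero_of_sq_eq_sq_mul_X {a b w : PowerSeries K} (hw : constantCoeff w ≠ 0)
    (h : a ^ 2 = b ^ 2 * (X * w)) : b = 0 := by
  by_contra hb
  have hw0 : order w = 0 := by
    by_contra h'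
    exact hw (by simpa using coeff_of_lt_order 0 (by simpa [pos_iff_ne_zero] using h'))
  have h1 := congrArg order h
  rw [order_mul, order_mul, order_pow, order_pow, order_X, hw0] at h1
  have hb' : order b ≠ ⊤ := order_eq_top.not.2 hb
  lift order b to ℕ using hb' with n hn
  have ha : order a ≠ ⊤ := by
    intro ha
    rw [ha] at h1
    simp only [two_nsmul, add_zero, top_add] at h1
    exact ENat.natCast_ne_top (n + n + 1) (by exact_mod_cast h1.symm)
  lift order a to ℕ using ha with m hm
  have : m + m = n + n + 1 := by
    simp only [two_nsmul, add_zero] at h1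
    exact_mod_cast h1
  omega

end PowerSeries

namespace Sextic

variable {K : Type*} [Field K] (S : Sextic K)

/-! ### Moments -/

lemma natDegree_F : S.F.natDegree = 6 := by
  rw [F, Polynomial.natDegree_C_mul S.lead_ne_zero,
    Polynomial.natDegree_finsetProd_X_sub_C_eq_card]
  simp

lemma F_ne_zero : S.F ≠ 0 := fun h => by simpa [h] using S.natDegree_F

lemma f_six_ne_zero : S.f 6 ≠ 0 := by
  have := Polynomial.leadingCoeff_ne_zero.2 S.F_ne_zero
  rwa [Polynomial.leadingCoeff, natDegree_F] at this

lemma F_eq : S.F = Polynomial.C (S.f 0) + Polynomial.C (S.f 1) * Polynomial.X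
    + Polynomial.C (S.f 2) * Polynomial.X ^ 2 + Polynomial.C (S.f 3) * Polynomial.X ^ 3
    + Polynomial.C (S.f 4) * Polynomial.X ^ 4 + Polynomial.C (S.f 5) * Polynomial.X ^ 5
    + Polynomial.C (S.f 6) * Polynomial.X ^ 6 := by
  conv_lhs => rw [S.F.as_sum_range_C_mul_X_pow, natDegree_F]
  simp [Finset.sum_range_succ, f]

lemma eval_F (x : K) : S.F.eval x = S.f 0 + S.f 1 * x + S.f 2 * x ^ 2 + S.f 3 * x ^ 3
    + S.f 4 * x ^ 4 + S.f 5 * x ^ 5 + S.f 6 * x ^ 6 := by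
  rw [F_eq]; simp

lemma eval_derivative_F (x : K) : S.F.derivative.eval x = S.f 1 + 2 * S.f 2 * x
    + 3 * S.f 3 * x ^ 2 + 4 * S.f 4 * x ^ 3 + 5 * S.f 5 * x ^ 4 + 6 * S.f 6 * x ^ 5 := by
  rw [F_eq]; simp; ring

lemma eval_F_root (m : Fin 6) : S.F.eval (S.root m) = 0 := by
  simp [F, Polynomial.eval_prod, Finset.prod_eq_zero (Finset.mem_univ m)]

lemma exists_root_of_eval_F {x : K} (h : S.F.eval x = 0) : ∃ m, x = S.root m := by
  simp only [F, Polynomial.eval_mul, Polynomial.eval_C, Polynomial.eval_prod, mul_eq_zero,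
    S.lead_ne_zero, false_or, Finset.prod_eq_zero_iff] at h
  obtain ⟨m, -, hm⟩ := h
  exact ⟨m, by simpa [sub_eq_zero] using hm⟩

lemma eval_derivative_root_ne_zero (m : Fin 6) : S.F.derivative.eval (S.root m) ≠ 0 := by
  have h : S.F = (Polynomial.X - Polynomial.C (S.root m)) *
      (Polynomial.C S.lead * ∏ i ∈ Finset.univ.erase m,
        (Polynomial.X - Polynomial.C (S.root i))) := by
    rw [F, ← Finset.mul_prod_erase Finset.univ _ (Finset.mem_univ m)]; ring
  rw [h, Polynomial.derivative_mul]
  simp only [Polynomial.derivative_sub, Polynomial.derivative_X, Polynomial.derivative_C, sub_zero,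
    one_mul, Polynomial.eval_add, Polynomial.eval_mul, Polynomial.eval_sub, Polynomial.eval_X,
    Polynomial.eval_C, sub_self, zero_mul, add_zero, Polynomial.eval_prod]
  refine mul_ne_zero S.lead_ne_zero (Finset.prod_ne_zero_iff.2 fun i hi =>
    sub_ne_zero.2 fun h => ?_)
  exact (Finset.ne_of_mem_erase hi) (S.root_injective h).symm

/-- The weight `1 / F'(θ_m)` of the root `θ_m`. -/
def weight (m : Fin 6) : K := (S.F.derivative.eval (S.root m))⁻¹

lemma weight_ne_zero (m : Fin 6) : S.weight m ≠ 0 :=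
  inv_ne_zero (S.eval_derivative_root_ne_zero m)

section Algebra

variable {R : Type*} [CommRing R] [Algebra K R]

/-- The moments `b_j = ∑ θ_m ^ j π_m / F'(θ_m)`, `0 ≤ j ≤ 5`, of a function `π` on the set of roots.
Values in a `K`-algebra `R` are allowed, so that points may vary along arcs. -/
def vec (π : Fin 6 → R) : Fin 6 → R :=
  fun j => ∑ m, algebraMap K R (S.weight m * S.root m ^ (j : ℕ)) * π m

/-- The coefficient vector of the polynomial `P` of degree at most five for which the function
`m ↦ P(θ_m)` has the moments `b`. -/
def coeffs (b : Fin 6 → R) : Fin 6 → R :=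
  let f : ℕ → R := fun j => algebraMap K R (S.f j)
  ![f 1 * b 0 + f 2 * b 1 + f 3 * b 2 + f 4 * b 3 + f 5 * b 4 + f 6 * b 5,
    f 2 * b 0 + f 3 * b 1 + f 4 * b 2 + f 5 * b 3 + f 6 * b 4,
    f 3 * b 0 + f 4 * b 1 + f 5 * b 2 + f 6 * b 3,
    f 4 * b 0 + f 5 * b 1 + f 6 * b 2,
    f 5 * b 0 + f 6 * b 1,
    f 6 * b 0]

/-- The line of `ℙ³` (a vector of Plücker coordinates) attached to the moments `b` of a polynomial.
The constants are such that the Plücker form becomes `∑ π_m ² / F'(θ_m)`; see `linePair_line_vec`.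
-/
def line (b : Fin 6 → R) : Fin 6 → R :=
  let f : ℕ → R := fun j => algebraMap K R (S.f j)
  ![b 0, b 1, b 2,
    f 1 * b 0 + 2 * f 2 * b 1 + 2 * f 3 * b 2 + 2 * f 4 * b 3 + 2 * f 5 * b 4 + 2 * f 6 * b 5,
    f 3 * b 1 + 2 * f 4 * b 2 + 2 * f 5 * b 3 + 2 * f 6 * b 4,
    f 5 * b 2 + 2 * f 6 * b 3]

/-- The line attached to `X P` modulo `F`, in terms of the moments `b` of `P`; see `lineX_vec`. -/
def lineX (b : Fin 6 → R) : Fin 6 → R :=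
  let f : ℕ → R := fun j => algebraMap K R (S.f j)
  ![b 1, b 2, b 3,
    -(2 * f 0 * b 0) - f 1 * b 1,
    f 3 * b 2 + 2 * f 4 * b 3 + 2 * f 5 * b 4 + 2 * f 6 * b 5,
    f 5 * b 3 + 2 * f 6 * b 4]

variable {R' : Type*} [CommRing R'] [Algebra K R'] (φ : R →ₐ[K] R')

lemma map_coeffs (b : Fin 6 → R) :
    (fun i => φ (S.coeffs b i)) = S.coeffs (fun i => φ (b i)) := by
  ext i; fin_cases i <;> simp [coeffs]

lemma map_line (b : Fin 6 → R) : (fun i => φ (S.line b i)) = S.line (fun i => φ (b i)) := by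
  ext i; fin_cases i <;> simp [line, map_ofNat φ 2]

lemma map_lineX (b : Fin 6 → R) : (fun i => φ (S.lineX b i)) = S.lineX (fun i => φ (b i)) := by
  ext i; fin_cases i <;> simp [lineX, map_ofNat φ 2]

lemma map_vec (π : Fin 6 → R) : (fun i => φ (S.vec π i)) = S.vec (fun i => φ (π i)) := by
  ext i; simp [vec, map_sum]

lemma coeffs_smul (c : R) (b : Fin 6 → R) : S.coeffs (c • b) = c • S.coeffs b := by
  ext i; fin_cases i <;> simp [coeffs] <;> ring

lemma coeffs_zero : S.coeffs (0 : Fin 6 → R) = 0 := by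
  simpa using S.coeffs_smul (0 : R) 0

lemma line_smul (c : R) (b : Fin 6 → R) : S.line (c • b) = c • S.line b := by
  ext i; fin_cases i <;> simp [line] <;> ring

lemma lineX_smul (c : R) (b : Fin 6 → R) : S.lineX (c • b) = c • S.lineX b := by
  ext i; fin_cases i <;> simp [lineX] <;> ring

lemma line_add (b b' : Fin 6 → R) : S.line (b + b') = S.line b + S.line b' := by
  ext i; fin_cases i <;> simp [line] <;> ring

lemma vec_smul (c : R) (π : Fin 6 → R) : S.vec (c • π) = c • S.vec π := by
  ext i
  simp only [vec, Pi.smul_apply, smul_eq_mul, Finset.mul_sum]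
  exact Finset.sum_congr rfl fun m _ => by ring

lemma vec_add (π π' : Fin 6 → R) : S.vec (π + π') = S.vec π + S.vec π' := by
  ext i
  simp only [vec, Pi.add_apply, ← Finset.sum_add_distrib]
  exact Finset.sum_congr rfl fun m _ => by ring

/-- The kernel `(F(s) - F(t)) / (s - t)` on pairs of roots. It inverts the moment map. -/
lemma geom_kernel (m n : Fin 6) :
    ∑ j : Fin 6, S.coeffs (fun i : Fin 6 => S.root m ^ (i : ℕ)) j * S.root n ^ (j : ℕ)
      = if m = n then (S.weight m)⁻¹ else 0 := by
  have key : (S.root m - S.root n) *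
      ∑ j : Fin 6, S.coeffs (fun i : Fin 6 => S.root m ^ (i : ℕ)) j * S.root n ^ (j : ℕ)
        = S.F.eval (S.root m) - S.F.eval (S.root n) := by
    simp [Fin.sum_univ_six, coeffs, eval_F]; ring
  split_ifs with h
  · subst h
    rw [weight, inv_inv, eval_derivative_F]
    simp [Fin.sum_univ_six, coeffs]; ring
  · rw [eval_F_root, eval_F_root, sub_zero] at key
    exact (mul_eq_zero.1 key).resolve_left (sub_ne_zero.2 fun e => h (S.root_injective e))

lemma coeffs_vec (π : Fin 6 → R) (j : Fin 6) : S.coeffs (S.vec π) j =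
    ∑ m, algebraMap K R (S.weight m * S.coeffs (fun i : Fin 6 => S.root m ^ (i : ℕ)) j) * π m := by
  fin_cases j <;>
  · simp only [coeffs, vec, Finset.mul_sum, ← Finset.sum_add_distrib, Fin.zero_eta, Fin.mk_one,
      Fin.reduceFinMk, Matrix.cons_val, Matrix.cons_val_zero, Matrix.cons_val_one]
    refine Finset.sum_congr rfl fun m _ => ?_
    simp
    ring

lemma sum_coeffs_vec (π : Fin 6 → R) (n : Fin 6) :
    ∑ j : Fin 6, S.coeffs (S.vec π) j * algebraMap K R (S.root n) ^ (j : ℕ) = π n := by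
  simp only [coeffs_vec, Finset.sum_mul]
  rw [Finset.sum_comm]
  have h (m : Fin 6) : ∑ j : Fin 6, algebraMap K R (S.weight m *
      S.coeffs (fun i : Fin 6 => S.root m ^ (i : ℕ)) j) * π m * algebraMap K R (S.root n) ^ (j : ℕ)
      = algebraMap K R (S.weight m * if m = n then (S.weight m)⁻¹ else 0) * π m := by
    rw [← geom_kernel, Finset.mul_sum, map_sum, Finset.sum_mul]
    refine Finset.sum_congr rfl fun j _ => ?_
    simp only [map_mul, map_pow]
    ring
  rw [Finset.sum_congr rfl fun m _ => h m, Finset.sum_eq_single n]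
  · simp [S.weight_ne_zero]
  · intro m _ hm; simp [hm]
  · simp

lemma line_vec_apply (π : Fin 6 → R) (j : Fin 6) : S.line (S.vec π) j =
    ∑ m, algebraMap K R (S.weight m * S.line (fun i : Fin 6 => S.root m ^ (i : ℕ)) j) * π m := by
  fin_cases j <;>
  simp only [line, vec, Finset.mul_sum, ← Finset.sum_add_distrib, Fin.zero_eta, Fin.mk_one,
      Fin.reduceFinMk, Matrix.cons_val, Matrix.cons_val_zero, Matrix.cons_val_one] <;>
  refine Finset.sum_congr rfl fun m _ => ?_ <;>
  simp [map_ofNat (algebraMap K R) 2] <;>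
  ring

lemma lineX_vec_apply (π : Fin 6 → R) (j : Fin 6) : S.lineX (S.vec π) j =
    ∑ m, algebraMap K R (S.weight m * S.lineX (fun i : Fin 6 => S.root m ^ (i : ℕ)) j) * π m := by
  fin_cases j <;>
  simp only [lineX, vec, Finset.mul_sum, ← Finset.sum_add_distrib, ← Finset.sum_sub_distrib,
      ← Finset.sum_neg_distrib, Fin.zero_eta, Fin.mk_one,
      Fin.reduceFinMk, Matrix.cons_val, Matrix.cons_val_zero, Matrix.cons_val_one] <;>
  refine Finset.sum_congr rfl fun m _ => ?_ <;>
  simp [map_ofNat (algebraMap K R) 2] <;>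
  ring

/-- The values of `X P` at the roots, where `π` gives those of `P`. -/
def mulRoot (π : Fin 6 → R) : Fin 6 → R := fun m => algebraMap K R (S.root m) * π m

lemma lineX_vec (π : Fin 6 → R) : S.lineX (S.vec π) = S.line (S.vec (S.mulRoot π)) := by
  have h (m j : Fin 6) : S.lineX (fun i : Fin 6 => S.root m ^ (i : ℕ)) j
      = S.line (fun i : Fin 6 => S.root m ^ (i : ℕ)) j * S.root m := by
    have := S.eval_F_root m
    rw [eval_F] at this
    fin_cases j <;> simp [line, lineX]
    · ring
    · ring
    · linear_combination (-2) * this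
    · ring
    · ring
  ext j
  rw [lineX_vec_apply, line_vec_apply]
  refine Finset.sum_congr rfl fun m _ => ?_
  rw [h, mulRoot]
  simp only [map_mul]
  ring

lemma linePair_geom (m n : Fin 6) : linePair (S.line (fun i : Fin 6 => S.root m ^ (i : ℕ)))
    (S.line (fun i : Fin 6 => S.root n ^ (i : ℕ))) = if m = n then 2 * (S.weight m)⁻¹ else 0 := by
  have key : (S.root m - S.root n) * linePair (S.line (fun i : Fin 6 => S.root m ^ (i : ℕ)))
      (S.line (fun i : Fin 6 => S.root n ^ (i : ℕ)))
        = 2 * (S.F.eval (S.root m) - S.F.eval (S.root n)) := by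
    simp [linePair, line, eval_F]; ring
  split_ifs with h
  · subst h
    rw [weight, inv_inv, eval_derivative_F]
    simp [linePair, line]; ring
  · rw [eval_F_root, eval_F_root, sub_zero, mul_zero] at key
    exact (mul_eq_zero.1 key).resolve_left (sub_ne_zero.2 fun e => h (S.root_injective e))

lemma linePair_line_vec (π π' : Fin 6 → R) : linePair (S.line (S.vec π)) (S.line (S.vec π'))
    = 2 * ∑ m, algebraMap K R (S.weight m) * (π m * π' m) := by
  have h : linePair (S.line (S.vec π)) (S.line (S.vec π')) = ∑ m, ∑ n,
      algebraMap K R (S.weight m * S.weight n *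
        linePair (S.line (fun i : Fin 6 => S.root m ^ (i : ℕ)))
          (S.line (fun i : Fin 6 => S.root n ^ (i : ℕ)))) * (π m * π' n) := by
    simp only [linePair, line_vec_apply, Finset.sum_mul_sum, ← Finset.sum_add_distrib]
    refine Finset.sum_congr rfl fun m _ => Finset.sum_congr rfl fun n _ => ?_
    simp only [map_mul, map_add]
    ring
  rw [h, Finset.mul_sum]
  refine Finset.sum_congr rfl fun m _ => ?_
  rw [Finset.sum_eq_single m]
  · rw [linePair_geom, if_pos rfl]
    have : S.weight m * S.weight m * (2 * (S.weight m)⁻¹) = 2 * S.weight m := by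
      field_simp [S.weight_ne_zero m]
    rw [this, map_mul, map_ofNat]
    ring
  · intro n _ hn; simp [linePair_geom, hn.symm]
  · simp

end Algebra

/-- The values of `p₀ + ⋯ + p₅ X⁵` at the roots of `F`. -/
def ev (p : Fin 6 → K) : Fin 6 → K := fun m => (toPoly p).eval (S.root m)

lemma eval_toPoly (p : Fin 6 → K) (x : K) : (toPoly p).eval x = ∑ j, p j * x ^ (j : ℕ) := by
  simp [toPoly, Polynomial.eval_finsetSum]

lemma natDegree_toPoly_lt (p : Fin 6 → K) : (toPoly p).natDegree < 6 := by
  refine lt_of_le_of_lt (Polynomial.natDegree_sum_le_of_forall_le (n := 5) _ _ fun j _ => ?_)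
      (by norm_num)
  exact (Polynomial.natDegree_C_mul_X_pow_le _ _).trans (by omega)

lemma coeff_toPoly (p : Fin 6 → K) (j : Fin 6) : (toPoly p).coeff j = p j := by
  simp [toPoly, Polynomial.finsetSum_coeff, Polynomial.coeff_X_pow, Fin.val_inj]

lemma eq_zero_of_eval_root {P : Polynomial K} (hP : P.natDegree < 6)
    (h : ∀ m, P.eval (S.root m) = 0) : P = 0 :=
  Polynomial.eq_zero_of_natDegree_lt_card_of_eval_eq_zero _ S.root_injective h (by simpa)

lemma ev_injective : Function.Injective S.ev := by
  intro p q h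
  have h0 : toPoly p - toPoly q = 0 := by
    refine S.eq_zero_of_eval_root ?_ fun m => ?_
    · exact lt_of_le_of_lt (Polynomial.natDegree_sub_le _ _)
        (max_lt (natDegree_toPoly_lt p) (natDegree_toPoly_lt q))
    · rw [Polynomial.eval_sub, sub_eq_zero]
      exact congrFun h m
  ext j
  rw [← coeff_toPoly p, sub_eq_zero.1 h0, coeff_toPoly]

lemma ev_coeffs_vec (π : Fin 6 → K) : S.ev (S.coeffs (S.vec π)) = π := by
  ext n
  simpa [ev, eval_toPoly] using S.sum_coeffs_vec π n

lemma coeffs_vec_ev (p : Fin 6 → K) : S.coeffs (S.vec (S.ev p)) = p :=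
  S.ev_injective (S.ev_coeffs_vec _)

lemma coeffs_injective : Function.Injective (S.coeffs : (Fin 6 → K) → (Fin 6 → K)) := by
  have h6 := S.f_six_ne_zero
  intro b b' h
  have h5 := congrFun h 5
  have h4 := congrFun h 4
  have h3 := congrFun h 3
  have h2 := congrFun h 2
  have h1 := congrFun h 1
  have h0 := congrFun h 0
  simp [coeffs] at h0 h1 h2 h3 h4 h5
  have e0 : b 0 = b' 0 := by simpa [h6] using h5
  rw [e0] at h0 h1 h2 h3 h4
  have e1 : b 1 = b' 1 := by simpa [h6] using h4
  rw [e1] at h0 h1 h2 h3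
  have e2 : b 2 = b' 2 := by simpa [h6] using h3
  rw [e2] at h0 h1 h2
  have e3 : b 3 = b' 3 := by simpa [h6] using h2
  rw [e3] at h0 h1
  have e4 : b 4 = b' 4 := by simpa [h6] using h1
  rw [e4] at h0
  have e5 : b 5 = b' 5 := by simpa [h6] using h0
  ext i
  fin_cases i <;> simp [e0, e1, e2, e3, e4, e5]

lemma vec_ev_coeffs (b : Fin 6 → K) : S.vec (S.ev (S.coeffs b)) = b :=
  S.coeffs_injective (S.coeffs_vec_ev _)

/-- Euler's identities for the sums `∑ θ_m ^ n / F'(θ_m)`. -/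
lemma sum_weight (n : ℕ) (hn : n ≤ 4) : ∑ m, S.weight m * S.root m ^ n = 0 := by
  have h := S.coeffs_vec_ev ![1, 0, 0, 0, 0, 0]
  have hev : S.ev ![1, 0, 0, 0, 0, 0] = 1 := by
    ext m; simp [ev, eval_toPoly, Fin.sum_univ_six]
  rw [hev] at h
  have h6 := S.f_six_ne_zero
  have h5 := congrFun h 5
  have h4 := congrFun h 4
  have h3 := congrFun h 3
  have h2 := congrFun h 2
  have h1 := congrFun h 1
  simp [coeffs, h6] at h1 h2 h3 h4 h5
  simp [h5, h6] at h4
  simp [h5, h6, h4] at h3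
  simp [h5, h6, h4, h3] at h2
  simp [h5, h6, h4, h3, h2] at h1
  simp [vec] at h1 h2 h3 h4 h5
  interval_cases n <;> simpa

/-! ### The map at general points of the Kummer surface -/

section Algebra

variable {R : Type*} [CommRing R] [Algebra K R]

/-- `b` consists of the moments of a multiple of the polynomial `P` that `κ` attaches to the divisor
`(x, y) + (u, v)`. The multiple is chosen so that the moments are polynomials in `x, y, u, v`, and
the equations also make sense when `x` and `u` coincide. -/
structure IsGenericMoments (x u y v : R) (b : Fin 6 → R) : Prop where
  sq_left : y ^ 2 = Polynomial.aeval x S.F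
  sq_right : v ^ 2 = Polynomial.aeval u S.F
  low : ∀ j : Fin 6, (j : ℕ) ≤ 3 →
    b j = 2 * (x - u) ^ 2 * (y * u ^ (j : ℕ) - v * x ^ (j : ℕ))
  four : algebraMap K R (S.f 6) * b 4 =
    algebraMap K R (S.f 6) * (2 * (x - u) ^ 2 * (y * u ^ 4 - v * x ^ 4)) +
      (Polynomial.aeval x S.F.derivative * (x - u) * v - 4 * v * y ^ 2
        + (Polynomial.aeval u S.F.derivative * (x - u) * y + 4 * v ^ 2 * y))
  five : algebraMap K R (S.f 6) * b 5 + algebraMap K R (S.f 5) * b 4 =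
    algebraMap K R (S.f 6) * (2 * (x - u) ^ 2 * (y * u ^ 5 - v * x ^ 5)) +
    algebraMap K R (S.f 5) * (2 * (x - u) ^ 2 * (y * u ^ 4 - v * x ^ 4)) +
      2 * v * (x - u) * y ^ 2 + 2 * v ^ 2 * (x - u) * y
      - u * (Polynomial.aeval x S.F.derivative * (x - u) * v - 4 * v * y ^ 2)
      - x * (Polynomial.aeval u S.F.derivative * (x - u) * y + 4 * v ^ 2 * y)

lemma aeval_F (x : R) : Polynomial.aeval x S.F = algebraMap K R (S.f 0)
    + algebraMap K R (S.f 1) * x + algebraMap K R (S.f 2) * x ^ 2 + algebraMap K R (S.f 3) * x ^ 3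
    + algebraMap K R (S.f 4) * x ^ 4 + algebraMap K R (S.f 5) * x ^ 5
    + algebraMap K R (S.f 6) * x ^ 6 := by
  conv_lhs => rw [F_eq]
  simp

lemma aeval_derivative_F (x : R) : Polynomial.aeval x S.F.derivative = algebraMap K R (S.f 1)
    + 2 * algebraMap K R (S.f 2) * x + 3 * algebraMap K R (S.f 3) * x ^ 2
    + 4 * algebraMap K R (S.f 4) * x ^ 3 + 5 * algebraMap K R (S.f 5) * x ^ 4
    + 6 * algebraMap K R (S.f 6) * x ^ 5 := by
  conv_lhs => rw [F_eq]
  simp only [Polynomial.derivative_C_mul, Polynomial.derivative_C,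
    Polynomial.derivative_X, Polynomial.derivative_X_pow, map_add, map_mul, Polynomial.aeval_C,
    map_pow, Polynomial.aeval_X, map_one, map_zero, map_natCast]
  push_cast
  ring

/-- The coordinates of the point of `𝒦` that belongs to `(x, y) + (u, v)`, without denominators. -/
def scaledCoords (x u y v : R) : Fin 4 → R :=
  let f : ℕ → R := fun j => algebraMap K R (S.f j)
  ![(x - u) ^ 2, (x - u) ^ 2 * (x + u), (x - u) ^ 2 * (x * u),
    2 * f 0 + f 1 * (x + u) + 2 * f 2 * (x * u) + f 3 * (x * u) * (x + u)
    + 2 * f 4 * (x * u) ^ 2 + f 5 * (x * u) ^ 2 * (x + u) + 2 * f 6 * (x * u) ^ 3 - 2 * (y * v)]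

variable {S}

lemma IsGenericMoments.join_line {x u y v : R} {b : Fin 6 → R}
    (h : S.IsGenericMoments x u y v b) :
    join (S.line b) (S.scaledCoords x u y v) = 0 := by
  obtain ⟨hy, hv, hl, h4, h5⟩ := h
  have h0 := hl 0 (by decide)
  have h1 := hl 1 (by decide)
  have h2 := hl 2 (by decide)
  have h3 := hl 3 (by decide)
  simp only [aeval_F, aeval_derivative_F] at hy hv h4 h5
  simp at h0 h1 h2 h3
  ext i
  fin_cases i <;> simp [join, line, scaledCoords, h0, h1, h2, h3]
  · linear_combination (2 * (x - u) ^ 2 * (x * u)) * h4 + (2 * (x - u) ^ 2 * (x + u)) * h5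
      + 4 * (x - u) ^ 2 * (x ^ 2 * v * hy - u ^ 2 * y * hv)
  · linear_combination -(2 * (x - u) ^ 2) * h5
      - 4 * (x - u) ^ 2 * (x * v * hy - u * y * hv)
  · linear_combination -(2 * (x - u) ^ 2) * h4
      + 4 * (x - u) ^ 2 * (v * hy - y * hv)
  · ring

lemma IsGenericMoments.join_lineX {x u y v : R} {b : Fin 6 → R}
    (h : S.IsGenericMoments x u y v b) :
    join (S.lineX b) (S.scaledCoords x u y v) = 0 := by
  obtain ⟨hy, hv, hl, h4, h5⟩ := h
  have h0 := hl 0 (by decide)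
  have h1 := hl 1 (by decide)
  have h2 := hl 2 (by decide)
  have h3 := hl 3 (by decide)
  simp only [aeval_F, aeval_derivative_F] at hy hv h4 h5
  simp at h0 h1 h2 h3
  ext i
  fin_cases i <;> simp [join, lineX, scaledCoords, h0, h1, h2, h3]
  · linear_combination (2 * (x - u) ^ 2 * (x * u)) * h5
      + 4 * (x - u) ^ 2 * ((x * u * (x + u) - u ^ 3) * v * hy
        - (x * u * (x + u) - x ^ 3) * y * hv)
  · linear_combination (2 * (x - u) ^ 2 * (x * u)) * h4
      - 4 * (x - u) ^ 2 * ((2 * (x * u) - u ^ 2) * v * hy - (2 * (x * u) - x ^ 2) * y * hv)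
  · linear_combination -(2 * (x - u) ^ 2 * (x + u)) * h4 - (2 * (x - u) ^ 2) * h5
      + 4 * (x - u) ^ 2 * (x * v * hy - u * y * hv)
  · ring

end Algebra

lemma scaledCoords_eq {x u : K} (hxu : x ≠ u) (y v : K) :
    S.scaledCoords x u y v = (x - u) ^ 2 • S.kummerCoords x y u v := by
  have hd : (x - u) ^ 2 ≠ 0 := pow_ne_zero _ (sub_ne_zero.2 hxu)
  ext i
  fin_cases i <;> simp [scaledCoords, kummerCoords]
  rw [mul_div_cancel₀ _ hd, F₀]

lemma toPoly_eq (p : Fin 6 → K) : toPoly p = Polynomial.C (p 0) + Polynomial.C (p 1) * Polynomial.X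
    + Polynomial.C (p 2) * Polynomial.X ^ 2 + Polynomial.C (p 3) * Polynomial.X ^ 3
    + Polynomial.C (p 4) * Polynomial.X ^ 4 + Polynomial.C (p 5) * Polynomial.X ^ 5 := by
  simp [toPoly, Fin.sum_univ_six]

lemma eq_of_natDegree_le_three {M : Polynomial K} (hM : M.natDegree ≤ 3) :
    M = Polynomial.C (M.coeff 0) + Polynomial.C (M.coeff 1) * Polynomial.X
      + Polynomial.C (M.coeff 2) * Polynomial.X ^ 2
      + Polynomial.C (M.coeff 3) * Polynomial.X ^ 3 := by
  conv_lhs => rw [M.as_sum_range_C_mul_X_pow' (n := 4) (by omega)]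
  simp [Finset.sum_range_succ]

lemma coeff_eq_zero_of_sum_eq_zero {n : ℕ} {c : Fin n → K}
    (h : ∑ i, Polynomial.C (c i) * Polynomial.X ^ (i : ℕ) = 0) (i : Fin n) : c i = 0 := by
  have := congrArg (fun q => Polynomial.coeff q (i : ℕ)) h
  simpa [Polynomial.finsetSum_coeff, Polynomial.coeff_X_pow, Fin.val_inj] using this

/-- The moments of `κ(ξ)` at a general point `ξ`. With `G P = M + R F`, where `G = (X - x) (X - u)`
and `R = r₀ + r₁ X`, the values of `R` at `x` and `u` are `-1 / y` and `-1 / v`. This determines `R`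
and therefore the moments `b₀, …, b₃`; the last two moments come from the coefficients of the
Hermite interpolation polynomial `M`. -/
lemma isGenericMoments_of_cubic {x y u v : K} (hy : y ^ 2 = S.F.eval x) (hv : v ^ 2 = S.F.eval u)
    (hy0 : y ≠ 0) (hv0 : v ≠ 0) {M : Polynomial K} (hM : M.natDegree ≤ 3)
    (hMx : M.eval x = y) (hMu : M.eval u = v)
    (hMF : ((Polynomial.X - Polynomial.C x) * (Polynomial.X - Polynomial.C u)) ^ 2 ∣ M ^ 2 - S.F)
    {p : Fin 6 → K} (hp : S.F ∣ (Polynomial.X - Polynomial.C x) * (Polynomial.X - Polynomial.C u)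
      * toPoly p - M) :
    S.IsGenericMoments x u y v ((2 * y * v * (x - u) ^ 3) • S.vec (S.ev p)) := by
  have h6 := S.f_six_ne_zero
  obtain ⟨Q, hQ⟩ := hMF
  have hDx : 2 * y * M.derivative.eval x = S.F.derivative.eval x := by
    have := congrArg (fun q => Polynomial.eval x (Polynomial.derivative q)) hQ
    simp [Polynomial.derivative_pow, hMx] at this
    linear_combination this
  have hDu : 2 * v * M.derivative.eval u = S.F.derivative.eval u := by
    have := congrArg (fun q => Polynomial.eval u (Polynomial.derivative q)) hQ
    simp [Polynomial.derivative_pow, hMu] at this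
    linear_combination this
  obtain ⟨R, hR⟩ := hp
  have hRdeg : R.natDegree ≤ 1 := by
    by_contra! hlt
    have hR0 : R ≠ 0 := fun h => by simp [h] at hlt
    have h1 := congrArg Polynomial.natDegree hR
    rw [Polynomial.natDegree_mul S.F_ne_zero hR0, natDegree_F] at h1
    have h2 : ((Polynomial.X - Polynomial.C x) * (Polynomial.X - Polynomial.C u)
      * toPoly p - M).natDegree ≤ 7 := by
      refine (Polynomial.natDegree_sub_le _ _).trans (max_le ?_ (by omega))
      refine Polynomial.natDegree_mul_le.trans ?_
      have e1 := Polynomial.natDegree_mul_le (p := Polynomial.X - Polynomial.C x)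
        (q := Polynomial.X - Polynomial.C u)
      rw [Polynomial.natDegree_X_sub_C, Polynomial.natDegree_X_sub_C] at e1
      have e2 := natDegree_toPoly_lt p
      omega
    omega
  obtain ⟨r₁, r₀, rfl⟩ := Polynomial.exists_eq_X_add_C_of_natDegree_le_one hRdeg
  have hrx : y * (r₀ + r₁ * x) = -1 := by
    have := congrArg (Polynomial.eval x) hR
    simp [hMx, ← hy] at this
    apply mul_left_cancel₀ hy0
    linear_combination -this
  have hru : v * (r₀ + r₁ * u) = -1 := by
    have := congrArg (Polynomial.eval u) hR
    simp [hMu, ← hv] at this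
    apply mul_left_cancel₀ hv0
    linear_combination -this
  set b := S.vec (S.ev p) with hb
  have hpb : p = S.coeffs b := (S.coeffs_vec_ev p).symm
  obtain ⟨m₀, m₁, m₂, m₃, hM'⟩ : ∃ m₀ m₁ m₂ m₃ : K, M = Polynomial.C m₀
      + Polynomial.C m₁ * Polynomial.X + Polynomial.C m₂ * Polynomial.X ^ 2
      + Polynomial.C m₃ * Polynomial.X ^ 3 := ⟨_, _, _, _, eq_of_natDegree_le_three hM⟩
  have hcoeff := coeff_eq_zero_of_sum_eq_zero (n := 8) (c := ![
      (x * u) * p 0 - m₀ - S.f 0 * r₀,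
      (x * u) * p 1 - (x + u) * p 0 - m₁ - S.f 1 * r₀ - S.f 0 * r₁,
      (x * u) * p 2 - (x + u) * p 1 + p 0 - m₂ - S.f 2 * r₀ - S.f 1 * r₁,
      (x * u) * p 3 - (x + u) * p 2 + p 1 - m₃ - S.f 3 * r₀ - S.f 2 * r₁,
      (x * u) * p 4 - (x + u) * p 3 + p 2 - S.f 4 * r₀ - S.f 3 * r₁,
      (x * u) * p 5 - (x + u) * p 4 + p 3 - S.f 5 * r₀ - S.f 4 * r₁,
      -(x + u) * p 5 + p 4 - S.f 6 * r₀ - S.f 5 * r₁,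
      p 5 - S.f 6 * r₁]) (by
    rw [hM', toPoly_eq, F_eq] at hR
    rw [← sub_eq_zero] at hR
    rw [← hR]
    simp [Fin.sum_univ_eight]
    ring)
  have c7 := hcoeff 7
  have c6 := hcoeff 6
  have c5 := hcoeff 5
  have c4 := hcoeff 4
  have c3 := hcoeff 3
  have c2 := hcoeff 2
  rw [hpb] at c2 c3 c4 c5 c6 c7
  simp [coeffs] at c2 c3 c4 c5 c6 c7
  have b0 : b 0 = r₁ := by
    apply mul_left_cancel₀ h6
    linear_combination c7
  rw [b0] at c2 c3 c4 c5 c6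
  have b1 : b 1 = r₀ + (x + u) * r₁ := by
    apply mul_left_cancel₀ h6
    linear_combination c6
  rw [b1] at c2 c3 c4 c5
  have b2 : b 2 = (x + u) * (r₀ + (x + u) * r₁) - x * u * r₁ := by
    apply mul_left_cancel₀ h6
    linear_combination c5
  rw [b2] at c2 c3 c4
  have b3 : b 3 = (x + u) * ((x + u) * (r₀ + (x + u) * r₁) - x * u * r₁)
      - x * u * (r₀ + (x + u) * r₁) := by
    apply mul_left_cancel₀ h6
    linear_combination c4
  rw [b3] at c2 c3
  subst hM'
  simp at hMx hMu hDx hDu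
  -- the two leading coefficients of the Hermite interpolation polynomial with given values and
  -- derivatives at `x` and `u`
  have k3 : (x - u) ^ 3 * m₃ = (x - u) * ((m₁ + m₂ * (2 * x) + m₃ * (3 * x ^ 2))
      + (m₁ + m₂ * (2 * u) + m₃ * (3 * u ^ 2))) - 2 * (y - v) := by
    rw [← hMx, ← hMu]; ring
  have k2 : (x - u) ^ 3 * (m₂ + (x + u) * m₃) = (x - u) * (y + v)
      - u * ((x - u) * (m₁ + m₂ * (2 * x) + m₃ * (3 * x ^ 2)) - 2 * y)
      - x * ((x - u) * (m₁ + m₂ * (2 * u) + m₃ * (3 * u ^ 2)) + 2 * v) := by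
    rw [← hMx, ← hMu]; ring
  refine ⟨by simpa using hy, by simpa using hv, ?_, ?_, ?_⟩
  · intro j hj
    fin_cases j
    · simp [b0]
      linear_combination 2 * (x - u) ^ 2 * (v * hrx - y * hru)
    · simp [b1]
      linear_combination 2 * (x - u) ^ 2 * (x * v * hrx - u * y * hru)
    · simp [b2]
      linear_combination 2 * (x - u) ^ 2 * (x ^ 2 * v * hrx - u ^ 2 * y * hru)
    · simp [b3]
      linear_combination 2 * (x - u) ^ 2 * (x ^ 3 * v * hrx - u ^ 3 * y * hru)
    · simp at hj
    · simp at hj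
  · simp [← hDx, ← hDu]
    linear_combination (2 * y * v * (x - u) ^ 3) * c3 + 2 * y * v * k3
      + S.f 6 * 2 * (x - u) ^ 2 * (x ^ 4 * v * hrx - u ^ 4 * y * hru)
  · simp [← hDx, ← hDu]
    linear_combination (2 * y * v * (x - u) ^ 3) * (c2 + (x + u) * c3) + 2 * y * v * k2
      + S.f 6 * 2 * (x - u) ^ 2 * (x ^ 5 * v * hrx - u ^ 5 * y * hru)
      + S.f 5 * 2 * (x - u) ^ 2 * (x ^ 4 * v * hrx - u ^ 4 * y * hru)

variable {S} in
/-- A general point `ξ` of `𝒦` lies on the lines attached to `P` and `X P`, where `P = κ(ξ)`. -/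
lemma IsGenericMoments.join_kummerCoords {x u y v c : K} {b : Fin 6 → K} (hc : c ≠ 0)
    (hxu : x ≠ u) (h : S.IsGenericMoments x u y v (c • b)) :
    join (S.line b) (S.kummerCoords x y u v) = 0 ∧
      join (S.lineX b) (S.kummerCoords x y u v) = 0 := by
  have hd : (x - u) ^ 2 ≠ 0 := pow_ne_zero _ (sub_ne_zero.2 hxu)
  have h1 := h.join_line
  have h2 := h.join_lineX
  rw [scaledCoords_eq _ hxu, join_smul_right] at h1 h2
  rw [line_smul, join_smul_left] at h1
  rw [lineX_smul, join_smul_left] at h2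
  simpa [hd, hc] using And.intro h1 h2

/-! ### The tangent planes at general points -/

/-- The gradient of the quartic form of `𝒦`. -/
def gradient (v : Fin 4 → K) : Fin 4 → K :=
  fun i => MvPolynomial.eval v (MvPolynomial.pderiv i S.quartic)

lemma gradient_eq (ξ : Fin 4 → K) : S.gradient ξ =
    let f := S.f
    let ξ₁ := ξ 0
    let ξ₂ := ξ 1
    let ξ₃ := ξ 2
    let β := ξ 3
  ![-4 * ξ₃ * β ^ 2 - 2 * (6 * f 0 * ξ₁ ^ 2 + 2 * f 1 * ξ₁ * ξ₂ + 4 * f 2 * ξ₁ * ξ₃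
      + f 3 * ξ₂ * ξ₃ + 2 * f 4 * ξ₃ ^ 2) * β
      + 4 * (f 1 ^ 2 - 4 * f 0 * f 2) * ξ₁ ^ 3 - 12 * (f 0 * f 3) * ξ₁ ^ 2 * ξ₂
    - 6 * (f 1 * f 3) * ξ₁ ^ 2 * ξ₃ - 8 * (f 0 * f 4) * ξ₁ * ξ₂ ^ 2
    + 8 * (f 0 * f 5 - f 1 * f 4) * ξ₁ * ξ₂ * ξ₃
    + 2 * (f 3 ^ 2 + 2 * f 1 * f 5 - 4 * f 2 * f 4 - 4 * f 0 * f 6) * ξ₁ * ξ₃ ^ 2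
    - 4 * (f 0 * f 5) * ξ₂ ^ 3
    + 4 * (2 * f 0 * f 6 - f 1 * f 5) * ξ₂ ^ 2 * ξ₃
    + 4 * (f 1 * f 6 - f 2 * f 5) * ξ₂ * ξ₃ ^ 2
    - 2 * (f 3 * f 5) * ξ₃ ^ 3,
    2 * ξ₂ * β ^ 2 - 2 * (f 1 * ξ₁ ^ 2 + f 3 * ξ₁ * ξ₃ + f 5 * ξ₃ ^ 2) * β
    - 4 * (f 0 * f 3) * ξ₁ ^ 3 - 8 * (f 0 * f 4) * ξ₁ ^ 2 * ξ₂
    + 4 * (f 0 * f 5 - f 1 * f 4) * ξ₁ ^ 2 * ξ₃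
    - 12 * (f 0 * f 5) * ξ₁ * ξ₂ ^ 2
    + 8 * (2 * f 0 * f 6 - f 1 * f 5) * ξ₁ * ξ₂ * ξ₃
    + 4 * (f 1 * f 6 - f 2 * f 5) * ξ₁ * ξ₃ ^ 2
    - 16 * (f 0 * f 6) * ξ₂ ^ 3
    - 12 * (f 1 * f 6) * ξ₂ ^ 2 * ξ₃ - 8 * (f 2 * f 6) * ξ₂ * ξ₃ ^ 2
    - 4 * (f 3 * f 6) * ξ₃ ^ 3,
    -4 * ξ₁ * β ^ 2 - 2 * (2 * f 2 * ξ₁ ^ 2 + f 3 * ξ₁ * ξ₂ + 4 * f 4 * ξ₁ * ξ₃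
      + 2 * f 5 * ξ₂ * ξ₃ + 6 * f 6 * ξ₃ ^ 2) * β
    - 2 * (f 1 * f 3) * ξ₁ ^ 3
    + 4 * (f 0 * f 5 - f 1 * f 4) * ξ₁ ^ 2 * ξ₂
    + 2 * (f 3 ^ 2 + 2 * f 1 * f 5 - 4 * f 2 * f 4 - 4 * f 0 * f 6) * ξ₁ ^ 2 * ξ₃
    + 4 * (2 * f 0 * f 6 - f 1 * f 5) * ξ₁ * ξ₂ ^ 2
    + 8 * (f 1 * f 6 - f 2 * f 5) * ξ₁ * ξ₂ * ξ₃
    - 6 * (f 3 * f 5) * ξ₁ * ξ₃ ^ 2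
    - 4 * (f 1 * f 6) * ξ₂ ^ 3 - 8 * (f 2 * f 6) * ξ₂ ^ 2 * ξ₃
    - 12 * (f 3 * f 6) * ξ₂ * ξ₃ ^ 2 + 4 * (f 5 ^ 2 - 4 * f 4 * f 6) * ξ₃ ^ 3,
    2 * (ξ₂ ^ 2 - 4 * ξ₁ * ξ₃) * β - 2 * (2 * f 0 * ξ₁ ^ 3 + f 1 * ξ₁ ^ 2 * ξ₂
      + 2 * f 2 * ξ₁ ^ 2 * ξ₃ + f 3 * ξ₁ * ξ₂ * ξ₃ + 2 * f 4 * ξ₁ * ξ₃ ^ 2 + f 5 * ξ₂ * ξ₃ ^ 2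
      + 2 * f 6 * ξ₃ ^ 3)] := by
  have h4 : (4 : MvPolynomial (Fin 4) K) = MvPolynomial.C 4 := (map_ofNat MvPolynomial.C 4).symm
  have h2 : (2 : MvPolynomial (Fin 4) K) = MvPolynomial.C 2 := (map_ofNat MvPolynomial.C 2).symm
  ext i
  simp only [gradient, quartic, h4, h2]
  fin_cases i <;>
  · simp [MvPolynomial.pderiv_X, Derivation.leibniz, Derivation.leibniz_pow]
    ring

variable {S}

lemma gradient_kummerCoords_three {x u : K} (hxu : x ≠ u) (y v : K) :
    S.gradient (S.kummerCoords x y u v) 3 = -4 * (y * v) := by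
  have hd : (x - u) ^ 2 ≠ 0 := pow_ne_zero _ (sub_ne_zero.2 hxu)
  have hβ : (x - u) ^ 2 * ((S.F₀ x u - 2 * (y * v)) / (x - u) ^ 2) = S.F₀ x u - 2 * (y * v) :=
    mul_div_cancel₀ _ hd
  simp only [gradient_eq, kummerCoords] at *
  simp
  generalize (S.F₀ x u - 2 * (y * v)) / (x - u) ^ 2 = β at *
  rw [F₀] at hβ
  linear_combination 2 * hβ

lemma gradient_dotProduct_kummerCoords {x u y v : K} (hxu : x ≠ u) (hy : y ^ 2 = S.F.eval x)
    (hv : v ^ 2 = S.F.eval u) :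
    S.gradient (S.kummerCoords x y u v) ⬝ᵥ S.kummerCoords x y u v = 0 := by
  have hd : (x - u) ^ 2 ≠ 0 := pow_ne_zero _ (sub_ne_zero.2 hxu)
  have hβ : (x - u) ^ 2 * ((S.F₀ x u - 2 * (y * v)) / (x - u) ^ 2) = S.F₀ x u - 2 * (y * v) :=
    mul_div_cancel₀ _ hd
  simp only [gradient_eq, kummerCoords, dotProduct, Fin.sum_univ_four] at *
  simp
  generalize (S.F₀ x u - 2 * (y * v)) / (x - u) ^ 2 = β at *
  rw [F₀] at hβ
  rw [eval_F] at hy hv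
  apply mul_left_cancel₀ hd
  linear_combination (4 * ((x - u) ^ 2 * β - (2 * S.f 0 + S.f 1 * (x + u) + 2 * S.f 2 * (x * u)
    + S.f 3 * (x * u) * (x + u) + 2 * S.f 4 * (x * u) ^ 2 + S.f 5 * (x * u) ^ 2 * (x + u)
    + 2 * S.f 6 * (x * u) ^ 3) - 2 * (y * v))) * hβ + 16 * v ^ 2 * hy
    + 16 * (S.f 0 + S.f 1 * x + S.f 2 * x ^ 2 + S.f 3 * x ^ 3 + S.f 4 * x ^ 4 + S.f 5 * x ^ 5
      + S.f 6 * x ^ 6) * hv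

set_option maxHeartbeats 1000000 in
/-- Only one coordinate is needed: a line through `ξ` meets the tangent plane in a multiple of `ξ`,
and the first coordinate of `ξ` is `1`. -/
lemma IsGenericMoments.meet_line_zero {x u y v : K} {b : Fin 6 → K}
    (hxu : x ≠ u) (h : S.IsGenericMoments x u y v b) :
    meet (S.line b) (S.gradient (S.kummerCoords x y u v)) 0 = 0 := by
  have hd : (x - u) ^ 2 ≠ 0 := pow_ne_zero _ (sub_ne_zero.2 hxu)
  have hβ : (x - u) ^ 2 * ((S.F₀ x u - 2 * (y * v)) / (x - u) ^ 2) = S.F₀ x u - 2 * (y * v) :=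
    mul_div_cancel₀ _ hd
  have h3w := S.gradient_kummerCoords_three hxu y v
  obtain ⟨hy, hv, hl, h4, h5⟩ := h
  have h0 := hl 0 (by decide)
  have h1 := hl 1 (by decide)
  have h2 := hl 2 (by decide)
  have h3 := hl 3 (by decide)
  simp only [aeval_F] at hy hv
  simp at h0 h1 h2 h3 hy hv
  simp [meet, join, dualLine, line, h0, h1, h2, h3, h3w]
  simp only [gradient_eq, kummerCoords] at *
  simp
  generalize (S.F₀ x u - 2 * (y * v)) / (x - u) ^ 2 = β at *
  rw [F₀] at hβ
  apply mul_left_cancel₀ hd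
  linear_combination (-4 * (x - u) * (v + y) * ((x - u) ^ 2 * β +
      (2 * S.f 0 + S.f 1 * (x + u) + 2 * S.f 2 * (x * u)
    + S.f 3 * (x * u) * (x + u) + 2 * S.f 4 * (x * u) ^ 2 + S.f 5 * (x * u) ^ 2 * (x + u)
    + 2 * S.f 6 * (x * u) ^ 3) - 2 * (y * v)) + 2 * (x - u) ^ 2 *
    ((v - y) * (-2 * (S.f 1 + S.f 3 * (x * u) + S.f 5 * (x * u) ^ 2))
      + (v * x - y * u) * (-2 * (2 * S.f 2 + S.f 3 * (x + u) + 4 * S.f 4 * (x * u)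
        + 2 * S.f 5 * (x + u) * (x * u) + 6 * S.f 6 * (x * u) ^ 2)))) * hβ
    - 16 * (x - u) * (v + y) * (v ^ 2 * hy + (S.f 0 + S.f 1 * x + S.f 2 * x ^ 2 + S.f 3 * x ^ 3
      + S.f 4 * x ^ 4 + S.f 5 * x ^ 5 + S.f 6 * x ^ 6) * hv)
    + 16 * (x - u) * (2 * S.f 0 + S.f 1 * (x + u) + 2 * S.f 2 * (x * u)
    + S.f 3 * (x * u) * (x + u) + 2 * S.f 4 * (x * u) ^ 2 + S.f 5 * (x * u) ^ 2 * (x + u)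
    + 2 * S.f 6 * (x * u) ^ 3) * (y * hv + v * hy)
    - 4 * (x - u) ^ 2 * ((y * hv - v * hy) *
      (-2 * (S.f 1 + S.f 3 * (x * u) + S.f 5 * (x * u) ^ 2))
      + (x * y * hv - u * v * hy) * (-2 * (2 * S.f 2 + S.f 3 * (x + u) + 4 * S.f 4 * (x * u)
        + 2 * S.f 5 * (x + u) * (x * u) + 6 * S.f 6 * (x * u) ^ 2)))
    + 8 * (x - u) ^ 4 * (S.f 5 * (-x ^ 2 * y * hv + u ^ 2 * v * hy)
      + 2 * S.f 6 * (-x ^ 3 * y * hv + u ^ 3 * v * hy))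

set_option maxHeartbeats 1000000 in
lemma IsGenericMoments.meet_lineX_zero {x u y v : K} {b : Fin 6 → K}
    (hxu : x ≠ u) (h : S.IsGenericMoments x u y v b) :
    meet (S.lineX b) (S.gradient (S.kummerCoords x y u v)) 0 = 0 := by
  have hd : (x - u) ^ 2 ≠ 0 := pow_ne_zero _ (sub_ne_zero.2 hxu)
  have hβ : (x - u) ^ 2 * ((S.F₀ x u - 2 * (y * v)) / (x - u) ^ 2) = S.F₀ x u - 2 * (y * v) :=
    mul_div_cancel₀ _ hd
  have h3w := S.gradient_kummerCoords_three hxu y v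
  obtain ⟨hy, hv, hl, h4, h5⟩ := h
  have h0 := hl 0 (by decide)
  have h1 := hl 1 (by decide)
  have h2 := hl 2 (by decide)
  have h3 := hl 3 (by decide)
  simp only [aeval_F, aeval_derivative_F] at hy hv h4
  simp at h0 h1 h2 h3 hy hv h4
  simp [meet, join, dualLine, lineX, h0, h1, h2, h3, h3w]
  simp only [gradient_eq, kummerCoords] at *
  simp
  generalize (S.F₀ x u - 2 * (y * v)) / (x - u) ^ 2 = β at *
  rw [F₀] at hβ
  apply mul_left_cancel₀ hd
  linear_combination (-4 * (x - u) * (x * v + u * y) * ((x - u) ^ 2 * β +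
      (2 * S.f 0 + S.f 1 * (x + u) + 2 * S.f 2 * (x * u)
    + S.f 3 * (x * u) * (x + u) + 2 * S.f 4 * (x * u) ^ 2 + S.f 5 * (x * u) ^ 2 * (x + u)
    + 2 * S.f 6 * (x * u) ^ 3) - 2 * (y * v)) + 2 * (x - u) ^ 2 *
    ((v * x - y * u) * (-2 * (S.f 1 + S.f 3 * (x * u) + S.f 5 * (x * u) ^ 2))
      + (v * x ^ 2 - y * u ^ 2) * (-2 * (2 * S.f 2 + S.f 3 * (x + u) + 4 * S.f 4 * (x * u)
        + 2 * S.f 5 * (x + u) * (x * u) + 6 * S.f 6 * (x * u) ^ 2)))) * hβ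
    + 8 * (y * v) * (x - u) ^ 2 * h4
    - 16 * (x - u) * (x * v + u * y) * (v ^ 2 * hy + (S.f 0 + S.f 1 * x + S.f 2 * x ^ 2
      + S.f 3 * x ^ 3 + S.f 4 * x ^ 4 + S.f 5 * x ^ 5 + S.f 6 * x ^ 6) * hv)
    + 16 * (x - u) * (2 * S.f 0 + S.f 1 * (x + u) + 2 * S.f 2 * (x * u)
    + S.f 3 * (x * u) * (x + u) + 2 * S.f 4 * (x * u) ^ 2 + S.f 5 * (x * u) ^ 2 * (x + u)
    + 2 * S.f 6 * (x * u) ^ 3) * (x * y * hv + u * v * hy)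
    - 4 * (x - u) ^ 2 * ((x * y * hv - u * v * hy) *
      (-2 * (S.f 1 + S.f 3 * (x * u) + S.f 5 * (x * u) ^ 2))
      + (x ^ 2 * y * hv - u ^ 2 * v * hy) * (-2 * (2 * S.f 2 + S.f 3 * (x + u)
        + 4 * S.f 4 * (x * u)
        + 2 * S.f 5 * (x + u) * (x * u) + 6 * S.f 6 * (x * u) ^ 2)))
    + 8 * (x - u) ^ 4 * (S.f 5 * (-x ^ 3 * y * hv + u ^ 3 * v * hy)
      + 2 * S.f 6 * (-x ^ 4 * y * hv + u ^ 4 * v * hy))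
    + 8 * (x - u) ^ 2 * ((S.f 1 + 2 * S.f 2 * x + 3 * S.f 3 * x ^ 2 + 4 * S.f 4 * x ^ 3
        + 5 * S.f 5 * x ^ 4 + 6 * S.f 6 * x ^ 5) * (x - u) * y * hv
      + (S.f 1 + 2 * S.f 2 * u + 3 * S.f 3 * u ^ 2 + 4 * S.f 4 * u ^ 3
        + 5 * S.f 5 * u ^ 4 + 6 * S.f 6 * u ^ 5) * (x - u) * v * hy
      + 4 * (v - y) * (v ^ 2 * hy + (S.f 0 + S.f 1 * x + S.f 2 * x ^ 2
      + S.f 3 * x ^ 3 + S.f 4 * x ^ 4 + S.f 5 * x ^ 5 + S.f 6 * x ^ 6) * hv))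

/-- The tangent plane of `𝒦` at a general point `ξ` contains the lines attached to `P` and `X P`,
where `P = κ(ξ)`. -/
lemma IsGenericMoments.meet_gradient {x u y v c : K} {b : Fin 6 → K} (hc : c ≠ 0)
    (hxu : x ≠ u) (h : S.IsGenericMoments x u y v (c • b)) :
    meet (S.line b) (S.gradient (S.kummerCoords x y u v)) = 0 ∧
      meet (S.lineX b) (S.gradient (S.kummerCoords x y u v)) = 0 := by
  have hdot : S.gradient (S.kummerCoords x y u v) ⬝ᵥ S.kummerCoords x y u v = 0 :=
    gradient_dotProduct_kummerCoords hxu (by simpa using h.sq_left) (by simpa using h.sq_right)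
  obtain ⟨k1, k2⟩ := h.join_kummerCoords hc hxu
  have m1 := h.meet_line_zero hxu
  have m2 := h.meet_lineX_zero hxu
  rw [line_smul, meet_smul_left, Pi.smul_apply, smul_eq_zero] at m1
  rw [lineX_smul, meet_smul_left, Pi.smul_apply, smul_eq_zero] at m2
  have e : S.kummerCoords x y u v 0 = 1 := rfl
  constructor
  · ext j
    have := meet_proportional k1 hdot 0 j
    rw [e, one_mul, m1.resolve_left hc, mul_zero] at this
    exact this
  · ext j
    have := meet_proportional k2 hdot 0 j
    rw [e, one_mul, m2.resolve_left hc, mul_zero] at this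
    exact this

variable (S)

/-! ### The common point and the common plane -/

section Algebra

variable {R : Type*} [CommRing R] [Algebra K R]

/-- The sums `∑ θ_m ^ k π_m ² / F'(θ_m)`, `k = 0, 1, 2`, vanish. For the values `π` of a polynomial
this says that its class lies on `𝒮`. -/
def IsNull (π : Fin 6 → R) : Prop :=
  ∀ k ≤ 2, ∑ m, algebraMap K R (S.weight m * S.root m ^ k) * π m ^ 2 = 0

/-- This follows from `sum_weight`. -/
lemma isNull_of_sq_eq {π : Fin 6 → R} (h₀ h₁ h₂ : R)
    (h : ∀ m, π m ^ 2 = h₀ + h₁ * algebraMap K R (S.root m)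
      + h₂ * algebraMap K R (S.root m) ^ 2) : S.IsNull π := by
  intro k hk
  have e (n : ℕ) (hn : n ≤ 4) : ∑ m, algebraMap K R (S.weight m * S.root m ^ n) = 0 := by
    rw [← map_sum, S.sum_weight n hn, map_zero]
  have : ∑ m, algebraMap K R (S.weight m * S.root m ^ k) * π m ^ 2
      = h₀ * ∑ m, algebraMap K R (S.weight m * S.root m ^ k)
      + h₁ * ∑ m, algebraMap K R (S.weight m * S.root m ^ (k + 1))
      + h₂ * ∑ m, algebraMap K R (S.weight m * S.root m ^ (k + 2)) := by
    simp only [Finset.mul_sum, ← Finset.sum_add_distrib]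
    refine Finset.sum_congr rfl fun m _ => ?_
    rw [h m]
    simp only [map_mul, map_pow]
    ring
  rw [this, e _ (by omega), e _ (by omega), e _ (by omega)]
  ring

/-- For `P` on `𝒮` the lines attached to `P` and `X P` span a pencil of concurrent coplanar lines.
-/
lemma IsNull.linePair_eq_zero {π : Fin 6 → R} (hπ : S.IsNull π) :
    linePair (S.line (S.vec π)) (S.line (S.vec π)) = 0 ∧
    linePair (S.line (S.vec π)) (S.lineX (S.vec π)) = 0 ∧
    linePair (S.lineX (S.vec π)) (S.lineX (S.vec π)) = 0 := by
  have h0 := hπ 0 (by norm_num)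
  have h1 := hπ 1 (by norm_num)
  have h2 := hπ 2 (by norm_num)
  simp only [lineX_vec, linePair_line_vec]
  refine ⟨?_, ?_, ?_⟩
  · rw [← mul_zero (2 : R), ← h0]
    refine congrArg _ (Finset.sum_congr rfl fun m _ => ?_)
    simp; ring
  · rw [← mul_zero (2 : R), ← h1]
    refine congrArg _ (Finset.sum_congr rfl fun m _ => ?_)
    simp [mulRoot]; ring
  · rw [← mul_zero (2 : R), ← h2]
    refine congrArg _ (Finset.sum_congr rfl fun m _ => ?_)
    simp [mulRoot]; ring

lemma isUnit_two (hK : (2 : K) ≠ 0) : IsUnit (2 : R) := by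
  have := (IsUnit.mk0 _ hK).map (algebraMap K R)
  rwa [map_ofNat] at this

variable {S}

lemma IsNull.quad_eq_zero (hK : (2 : K) ≠ 0) {π : Fin 6 → R} (hπ : S.IsNull π) :
    quad (S.line (S.vec π)) = 0 ∧ quad (S.lineX (S.vec π)) = 0 := by
  have h := hπ.linePair_eq_zero
  simp only [linePair_self] at h
  have h2 := isUnit_two (R := R) hK
  exact ⟨h2.mul_right_eq_zero.1 h.1, h2.mul_right_eq_zero.1 h.2.2⟩

/-- A common point of the lines attached to `P` and `X P`, for `P` on `𝒮`: intersect the first line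
with the plane spanned by the second one and an arbitrary point `c`. -/
lemma IsNull.join_meet_join (hK : (2 : K) ≠ 0) {π : Fin 6 → R} (hπ : S.IsNull π)
    (c : Fin 4 → R) :
    join (S.line (S.vec π)) (meet (S.line (S.vec π)) (join (S.lineX (S.vec π)) c)) = 0 ∧
    join (S.lineX (S.vec π)) (meet (S.line (S.vec π)) (join (S.lineX (S.vec π)) c)) = 0 := by
  obtain ⟨q1, q2⟩ := hπ.quad_eq_zero hK
  obtain ⟨-, p, -⟩ := hπ.linePair_eq_zero
  refine ⟨by rw [join_meet_self, q1, zero_smul], ?_⟩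
  have := join_meet_add (S.line (S.vec π)) (S.lineX (S.vec π)) (join (S.lineX (S.vec π)) c)
  rwa [meet_join_self, q2, zero_smul, join_zero_right, zero_add, p, zero_smul] at this

/-- A common plane of the lines attached to `P` and `X P`, for `P` on `𝒮`. -/
lemma IsNull.meet_join_meet (hK : (2 : K) ≠ 0) {π : Fin 6 → R} (hπ : S.IsNull π)
    (c : Fin 4 → R) :
    meet (S.line (S.vec π)) (join (S.line (S.vec π)) (meet (S.lineX (S.vec π)) c)) = 0 ∧
    meet (S.lineX (S.vec π)) (join (S.line (S.vec π)) (meet (S.lineX (S.vec π)) c)) = 0 := by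
  obtain ⟨q1, q2⟩ := hπ.quad_eq_zero hK
  obtain ⟨-, p, -⟩ := hπ.linePair_eq_zero
  refine ⟨by rw [meet_join_self, q1, zero_smul], ?_⟩
  have := meet_join_add (S.line (S.vec π)) (S.lineX (S.vec π)) (meet (S.lineX (S.vec π)) c)
  rwa [join_meet_self, q2, zero_smul, meet, join_zero_right, zero_add, p, zero_smul] at this

end Algebra

lemma line_eq_zero (hK : (2 : K) ≠ 0) {b : Fin 6 → K} (h : S.line b = 0) : b = 0 := by
  have h6 := S.f_six_ne_zero
  have e0 := congrFun h 0
  have e1 := congrFun h 1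
  have e2 := congrFun h 2
  have e3 := congrFun h 3
  have e4 := congrFun h 4
  have e5 := congrFun h 5
  simp [line] at e0 e1 e2 e3 e4 e5
  simp [e2, hK, h6] at e5
  simp [e1, e2, e5, hK, h6] at e4
  simp [e0, e1, e2, e5, e4, hK, h6] at e3
  ext i
  fin_cases i <;> simp [e0, e1, e2, e3, e4, e5]

lemma vec_injective : Function.Injective (S.vec : (Fin 6 → K) → Fin 6 → K) := by
  intro π π' h
  rw [← S.ev_coeffs_vec π, h, S.ev_coeffs_vec]

variable {S}

/-- If the two lines were equal, then `P` would vanish at all roots but one, which is impossible on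
`𝒮`. -/
lemma IsNull.line_not_proportional (hK : (2 : K) ≠ 0) {π : Fin 6 → K} (hπ : S.IsNull π)
    (h0 : π ≠ 0) :
    ¬ ∀ i j, S.line (S.vec π) i * S.lineX (S.vec π) j
      = S.line (S.vec π) j * S.lineX (S.vec π) i := by
  intro h
  have hl : S.line (S.vec π) ≠ 0 := fun e => h0 (S.vec_injective (by
    rw [S.line_eq_zero hK e, S.line_eq_zero hK (b := S.vec 0) ?_]
    ext j; rw [S.line_vec_apply]; simp))
  obtain ⟨i, hi⟩ := Function.ne_iff.1 hl
  simp only [Pi.zero_apply] at hi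
  set lam := S.lineX (S.vec π) i / S.line (S.vec π) i with hlam
  have e1 : S.line (S.vec (S.mulRoot π + (-lam) • π)) = 0 := by
    rw [vec_add, vec_smul, line_add, line_smul, ← lineX_vec]
    ext j
    simp only [Pi.add_apply, Pi.smul_apply, smul_eq_mul, Pi.zero_apply, hlam]
    field_simp
    linear_combination h i j
  have e2 : S.mulRoot π + (-lam) • π = 0 := S.vec_injective (by
    rw [S.line_eq_zero hK e1, S.line_eq_zero hK (b := S.vec 0) ?_]
    ext j; rw [S.line_vec_apply]; simp)
  have e3 (m : Fin 6) : (S.root m - lam) * π m = 0 := by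
    have := congrFun e2 m
    simp [mulRoot] at this
    linear_combination this
  obtain ⟨m, hm⟩ := Function.ne_iff.1 h0
  simp only [Pi.zero_apply] at hm
  have hm' : S.root m = lam := sub_eq_zero.1 ((mul_eq_zero.1 (e3 m)).resolve_right hm)
  have hn (n : Fin 6) (hnm : n ≠ m) : π n = 0 := by
    refine (mul_eq_zero.1 (e3 n)).resolve_left (sub_ne_zero.2 fun e => hnm ?_)
    exact S.root_injective (e.trans hm'.symm)
  have := hπ 0 (by norm_num)
  rw [Finset.sum_eq_single m (fun n _ hnm => by rw [hn n hnm]; simp) (by simp)] at this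
  simp [S.weight_ne_zero, hm] at this

lemma IsNull.exists_point (hK : (2 : K) ≠ 0) {π : Fin 6 → K} (hπ : S.IsNull π) (h0 : π ≠ 0) :
    ∃ c, meet (S.line (S.vec π)) (join (S.lineX (S.vec π)) c) ≠ 0 := by
  by_contra! h
  exact hπ.line_not_proportional hK h0 fun i j =>
    line_proportional h hπ.linePair_eq_zero.2.1 i j

lemma IsNull.exists_plane (hK : (2 : K) ≠ 0) {π : Fin 6 → K} (hπ : S.IsNull π) (h0 : π ≠ 0) :
    ∃ c, join (S.line (S.vec π)) (meet (S.lineX (S.vec π)) c) ≠ 0 := by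
  by_contra! h
  obtain ⟨c, hc⟩ := hπ.exists_point hK h0
  refine hc (dotProduct_eq_zero _ fun η => ?_)
  rw [dotProduct_comm, dotProduct_meet_join]
  have := join_meet_add (S.line (S.vec π)) (S.lineX (S.vec π)) η
  rw [h, zero_add, hπ.linePair_eq_zero.2.1, zero_smul] at this
  rw [this, dotProduct_zero]

lemma point_proportional {π : Fin 6 → K}
    {ξ : Fin 4 → K} (h1 : join (S.line (S.vec π)) ξ = 0) (h2 : join (S.lineX (S.vec π)) ξ = 0)
    (c : Fin 4 → K) (i j : Fin 4) :
    ξ i * meet (S.line (S.vec π)) (join (S.lineX (S.vec π)) c) j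
      = ξ j * meet (S.line (S.vec π)) (join (S.lineX (S.vec π)) c) i :=
  meet_proportional h1 (by rw [dotProduct_join_comm, h2, dotProduct_zero, neg_zero]) i j

lemma plane_proportional {π : Fin 6 → K}
    {η : Fin 4 → K} (h1 : meet (S.line (S.vec π)) η = 0) (h2 : meet (S.lineX (S.vec π)) η = 0)
    (c : Fin 4 → K) (i j : Fin 4) :
    η i * join (S.line (S.vec π)) (meet (S.lineX (S.vec π)) c) j
      = η j * join (S.line (S.vec π)) (meet (S.lineX (S.vec π)) c) i :=
  join_proportional h1 (by
    rw [dotProduct_comm, dotProduct_meet_comm, h2, dotProduct_zero, neg_zero]) i j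

/-- For `P` on `𝒮` the lines attached to `P` and `X P` have exactly one common point. -/
lemma IsNull.point_unique (hK : (2 : K) ≠ 0) {π : Fin 6 → K} (hπ : S.IsNull π) (h0 : π ≠ 0)
    {ξ ξ' : Fin 4 → K} (hξ : ξ ≠ 0) (hξ' : ξ' ≠ 0)
    (h1 : join (S.line (S.vec π)) ξ = 0) (h2 : join (S.lineX (S.vec π)) ξ = 0)
    (h1' : join (S.line (S.vec π)) ξ' = 0) (h2' : join (S.lineX (S.vec π)) ξ' = 0) :
    Projectivization.mk K ξ hξ = Projectivization.mk K ξ' hξ' := by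
  obtain ⟨c, hc⟩ := hπ.exists_point hK h0
  exact (mk_eq_mk_of_proportional hξ hc (point_proportional h1 h2 c)).trans
    (mk_eq_mk_of_proportional hξ' hc (point_proportional h1' h2' c)).symm

/-- For `P` on `𝒮` the lines attached to `P` and `X P` lie in exactly one common plane. -/
lemma IsNull.plane_unique (hK : (2 : K) ≠ 0) {π : Fin 6 → K} (hπ : S.IsNull π) (h0 : π ≠ 0)
    {η η' : Fin 4 → K} (hη : η ≠ 0) (hη' : η' ≠ 0)
    (h1 : meet (S.line (S.vec π)) η = 0) (h2 : meet (S.lineX (S.vec π)) η = 0)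
    (h1' : meet (S.line (S.vec π)) η' = 0) (h2' : meet (S.lineX (S.vec π)) η' = 0) :
    Projectivization.mk K η hη = Projectivization.mk K η' hη' := by
  obtain ⟨c, hc⟩ := hπ.exists_plane hK h0
  exact (mk_eq_mk_of_proportional hη hc (plane_proportional h1 h2 c)).trans
    (mk_eq_mk_of_proportional hη' hc (plane_proportional h1' h2' c)).symm

variable (S)

lemma ev_smul (c : K) (p : Fin 6 → K) : S.ev (c • p) = c • S.ev p := by
  ext m; simp [ev, eval_toPoly, Finset.mul_sum, mul_assoc]

lemma ev_ne_zero {p : Fin 6 → K} (hp : p ≠ 0) : S.ev p ≠ 0 := fun h => hp (S.ev_injective (by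
  rw [h]; ext m; simp [ev, eval_toPoly]))

lemma F_dvd_iff {Q : Polynomial K} : S.F ∣ Q ↔ ∀ m, Q.eval (S.root m) = 0 := by
  constructor
  · rintro ⟨G, rfl⟩ m
    simp [eval_F_root]
  · intro h
    rw [F, (Polynomial.isUnit_C.2 (IsUnit.mk0 _ S.lead_ne_zero)).mul_left_dvd]
    exact Finset.prod_dvd_of_coprime (fun i _ j _ hij =>
      Polynomial.pairwise_coprime_X_sub_C S.root_injective hij) fun m _ =>
        Polynomial.dvd_iff_isRoot.2 (h m)

lemma mem_desing_iff {p : Fin 6 → K} (hp : p ≠ 0) :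
    Projectivization.mk K p hp ∈ S.desing ↔ ∃ h₀ h₁ h₂ : K, ∀ m, S.ev p m ^ 2 = h₀
      + h₁ * S.root m + h₂ * S.root m ^ 2 := by
  have key (q : Fin 6 → K) (h₀ h₁ h₂ : K) : (∀ m, S.ev q m ^ 2 = h₀
      + h₁ * S.root m + h₂ * S.root m ^ 2) ↔ S.F ∣ toPoly q ^ 2 - (Polynomial.C h₀
        + Polynomial.C h₁ * Polynomial.X + Polynomial.C h₂ * Polynomial.X ^ 2) := by
    rw [F_dvd_iff]
    refine forall_congr' fun m => ?_
    rw [← sub_eq_zero]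
    simp [ev]
  constructor
  · intro h
    obtain ⟨H, hH, hd⟩ := h p hp rfl
    refine ⟨H.coeff 0, H.coeff 1, H.coeff 2, (key _ _ _ _).2 ?_⟩
    convert hd using 2
    conv_rhs => rw [H.as_sum_range_C_mul_X_pow' (n := 3) (by omega)]
    simp [Finset.sum_range_succ]
  · rintro ⟨h₀, h₁, h₂, h⟩ q hq e
    obtain ⟨c, rfl⟩ := (Projectivization.mk_eq_mk_iff' K _ _ hq hp).1 e
    refine ⟨_, ?_, (key (c • p) (c ^ 2 * h₀) (c ^ 2 * h₁) (c ^ 2 * h₂)).1 fun m => ?_⟩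
    · compute_degree
    · rw [ev_smul, Pi.smul_apply, smul_eq_mul, mul_pow, h m]; ring

lemma isNull_of_mem_desing {p : Fin 6 → K} (hp : p ≠ 0)
    (h : Projectivization.mk K p hp ∈ S.desing) : S.IsNull (S.ev p) := by
  obtain ⟨h₀, h₁, h₂, e⟩ := (S.mem_desing_iff hp).1 h
  exact S.isNull_of_sq_eq h₀ h₁ h₂ (by simpa using e)

/-! ### Lines through a node or in a trope -/

/-- The sign vector of `I`, the values of `∏ i ∈ I, g_i` at the roots. -/
def signs {R : Type*} [CommRing R] (I : Finset (Fin 6)) : Fin 6 → R :=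
  fun m => if m ∈ I then -1 else 1

lemma join_sum {ι R : Type*} [CommRing R] (t : Finset ι) (c : ι → R) (l : ι → Fin 6 → R)
    (ξ : Fin 4 → R) : join (∑ i ∈ t, c i • l i) ξ = ∑ i ∈ t, c i • join (l i) ξ := by
  classical
  induction t using Finset.induction_on with
  | empty =>
    simpa using join_smul_left (0 : R) 0 ξ
  | insert a t ha ih => rw [Finset.sum_insert ha, Finset.sum_insert ha, join_add_left, ih,
      join_smul_left]

lemma meet_sum {ι R : Type*} [CommRing R] (t : Finset ι) (c : ι → R) (l : ι → Fin 6 → R)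
    (ξ : Fin 4 → R) : meet (∑ i ∈ t, c i • l i) ξ = ∑ i ∈ t, c i • meet (l i) ξ := by
  classical
  induction t using Finset.induction_on with
  | empty =>
    simpa using meet_smul_left (0 : R) 0 ξ
  | insert a t ha ih => rw [Finset.sum_insert ha, Finset.sum_insert ha, meet_add_left, ih,
      meet_smul_left]

/-- The line attached to the moments `b_j = x ^ j`, i.e. to the class of `F / (X - x)` if `x` is a
root. -/
def geomLine (x : K) : Fin 6 → K := S.line (fun i : Fin 6 => x ^ (i : ℕ))

lemma line_vec_eq_sum (π : Fin 6 → K) :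
    S.line (S.vec π) = ∑ m, (S.weight m * π m) • S.geomLine (S.root m) := by
  ext j
  rw [line_vec_apply]
  simp only [Finset.sum_apply, Pi.smul_apply, smul_eq_mul, geomLine, Algebra.algebraMap_self,
    RingHom.id_apply]
  exact Finset.sum_congr rfl fun m _ => by ring

lemma sum_eq_moments {π : Fin 6 → K} {I : Finset (Fin 6)} {c : Fin 6 → K} {d₀ d₁ d₂ : K}
    (h : ∀ m, c m = (signs I m : K) * (d₀ + d₁ * S.root m + d₂ * S.root m ^ 2)) :
    ∑ m, S.weight m * π m * c m = d₀ * S.vec (signs I * π) 0 + d₁ * S.vec (signs I * π) 1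
      + d₂ * S.vec (signs I * π) 2 := by
  simp only [vec, Finset.mul_sum, ← Finset.sum_add_distrib]
  refine Finset.sum_congr rfl fun m _ => ?_
  rw [h m]
  simp
  ring

/-- A coordinate of the join that on the lines of the roots is, up to the signs of `I`, quadratic in
the root is a combination of the first three moments of the function with changed signs. -/
lemma join_line_vec_apply {π : Fin 6 → K} {I : Finset (Fin 6)} {ξ : Fin 4 → K} {k : Fin 4}
    {d₀ d₁ d₂ : K} (h : ∀ m, join (S.geomLine (S.root m)) ξ k
      = (signs I m : K) * (d₀ + d₁ * S.root m + d₂ * S.root m ^ 2)) :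
    join (S.line (S.vec π)) ξ k = d₀ * S.vec (signs I * π) 0 + d₁ * S.vec (signs I * π) 1
      + d₂ * S.vec (signs I * π) 2 := by
  rw [line_vec_eq_sum, join_sum, Finset.sum_apply]
  exact S.sum_eq_moments h

lemma meet_line_vec_apply {π : Fin 6 → K} {I : Finset (Fin 6)} {ξ : Fin 4 → K} {k : Fin 4}
    {d₀ d₁ d₂ : K} (h : ∀ m, meet (S.geomLine (S.root m)) ξ k
      = (signs I m : K) * (d₀ + d₁ * S.root m + d₂ * S.root m ^ 2)) :
    meet (S.line (S.vec π)) ξ k = d₀ * S.vec (signs I * π) 0 + d₁ * S.vec (signs I * π) 1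
      + d₂ * S.vec (signs I * π) 2 := by
  rw [line_vec_eq_sum, meet_sum, Finset.sum_apply]
  exact S.sum_eq_moments h

/-- The moments `b₀, b₁, b₂` of the function obtained from `π` by the sign changes in `I` vanish.
These are the equations for the line attached to `π` to pass through a node, or to lie in a trope.
-/
def LowMoments (I : Finset (Fin 6)) (π : Fin 6 → K) : Prop :=
  S.vec (signs I * π) 0 = 0 ∧ S.vec (signs I * π) 1 = 0 ∧ S.vec (signs I * π) 2 = 0

lemma F_eq_prod_mul (I : Finset (Fin 6)) :
    S.F = (∏ i ∈ I, (Polynomial.X - Polynomial.C (S.root i))) *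
      (Polynomial.C S.lead * ∏ i ∈ Iᶜ, (Polynomial.X - Polynomial.C (S.root i))) := by
  rw [F, ← Finset.prod_mul_prod_compl I]; ring

lemma eval_prod_eq_zero_iff (I : Finset (Fin 6)) (m : Fin 6) :
    (∏ i ∈ I, (Polynomial.X - Polynomial.C (S.root i))).eval (S.root m) = 0 ↔ m ∈ I := by
  simp only [Polynomial.eval_prod, Finset.prod_eq_zero_iff, Polynomial.eval_sub, Polynomial.eval_X,
    Polynomial.eval_C, sub_eq_zero, S.root_injective.eq_iff]
  simp

/-- The factorization of `F` by the roots in `I` and the other roots. -/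
lemma exists_cofactor (I : Finset (Fin 6)) : ∃ C : Polynomial K, C.natDegree ≤ 6 - I.card ∧
    S.F = (∏ i ∈ I, (Polynomial.X - Polynomial.C (S.root i))) * C ∧
    ∀ m, C.eval (S.root m) = 0 ↔ m ∉ I := by
  refine ⟨_, ?_, S.F_eq_prod_mul I, fun m => ?_⟩
  · rw [Polynomial.natDegree_C_mul S.lead_ne_zero,
      Polynomial.natDegree_finsetProd_X_sub_C_eq_card, Finset.card_compl]
    simp
  · rw [Polynomial.eval_mul, Polynomial.eval_C, mul_eq_zero, S.eval_prod_eq_zero_iff]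
    simp [S.lead_ne_zero]

/-- The cofactor of `(X - θ_a) (X - θ_b)` in `F`, in coefficients. -/
lemma exists_coeffs_pair {a b : Fin 6} (hab : a ≠ b) : ∃ c₀ c₁ c₂ c₃ c₄ : K,
    let s := S.root a + S.root b
    let r := S.root a * S.root b
    (S.f 0 = r * c₀ ∧ S.f 1 = r * c₁ - s * c₀ ∧ S.f 2 = r * c₂ - s * c₁ + c₀ ∧
      S.f 3 = r * c₃ - s * c₂ + c₁ ∧ S.f 4 = r * c₄ - s * c₃ + c₂ ∧ S.f 5 = -s * c₄ + c₃ ∧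
      S.f 6 = c₄) ∧
    ∀ m, c₀ + c₁ * S.root m + c₂ * S.root m ^ 2 + c₃ * S.root m ^ 3 + c₄ * S.root m ^ 4 = 0 ↔
      m ∉ ({a, b} : Finset (Fin 6)) := by
  obtain ⟨C, hC, hF, hz⟩ := S.exists_cofactor {a, b}
  rw [Finset.card_pair hab] at hC
  have hC' : C = Polynomial.C (C.coeff 0) + Polynomial.C (C.coeff 1) * Polynomial.X
      + Polynomial.C (C.coeff 2) * Polynomial.X ^ 2 + Polynomial.C (C.coeff 3) * Polynomial.X ^ 3
      + Polynomial.C (C.coeff 4) * Polynomial.X ^ 4 := by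
    conv_lhs => rw [C.as_sum_range_C_mul_X_pow' (n := 5) (by omega)]
    simp [Finset.sum_range_succ]
  refine ⟨C.coeff 0, C.coeff 1, C.coeff 2, C.coeff 3, C.coeff 4, ?_, fun m => ?_⟩
  rotate_left
  · rw [← hz m]
    conv_rhs => rw [hC']
    simp
  · rw [Finset.prod_pair hab] at hF
    have h := coeff_eq_zero_of_sum_eq_zero (n := 7) (c := ![
      S.f 0 - (S.root a * S.root b) * C.coeff 0,
      S.f 1 - ((S.root a * S.root b) * C.coeff 1 - (S.root a + S.root b) * C.coeff 0),
      S.f 2 - ((S.root a * S.root b) * C.coeff 2 - (S.root a + S.root b) * C.coeff 1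
        + C.coeff 0),
      S.f 3 - ((S.root a * S.root b) * C.coeff 3 - (S.root a + S.root b) * C.coeff 2
        + C.coeff 1),
      S.f 4 - ((S.root a * S.root b) * C.coeff 4 - (S.root a + S.root b) * C.coeff 3
        + C.coeff 2),
      S.f 5 - (-(S.root a + S.root b) * C.coeff 4 + C.coeff 3),
      S.f 6 - C.coeff 4]) (by
      rw [F_eq] at hF
      rw [← sub_eq_zero] at hF
      rw [← hF]
      conv_rhs => rw [hC']
      simp [Fin.sum_univ_seven]
      ring)
    simp only [Fin.forall_fin_succ] at h
    simp [sub_eq_zero] at h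
    simpa using h

/-- The cofactor of `X - θ_a` in `F`, in coefficients. -/
lemma exists_coeffs_single (a : Fin 6) : ∃ c₀ c₁ c₂ c₃ c₄ c₅ : K,
    let t := S.root a
    (S.f 0 = -t * c₀ ∧ S.f 1 = c₀ - t * c₁ ∧ S.f 2 = c₁ - t * c₂ ∧
      S.f 3 = c₂ - t * c₃ ∧ S.f 4 = c₃ - t * c₄ ∧ S.f 5 = c₄ - t * c₅ ∧ S.f 6 = c₅) ∧
    ∀ m, c₀ + c₁ * S.root m + c₂ * S.root m ^ 2 + c₃ * S.root m ^ 3 + c₄ * S.root m ^ 4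
      + c₅ * S.root m ^ 5 = 0 ↔ m ∉ ({a} : Finset (Fin 6)) := by
  obtain ⟨C, hC, hF, hz⟩ := S.exists_cofactor {a}
  rw [Finset.card_singleton] at hC
  have hC' : C = Polynomial.C (C.coeff 0) + Polynomial.C (C.coeff 1) * Polynomial.X
      + Polynomial.C (C.coeff 2) * Polynomial.X ^ 2 + Polynomial.C (C.coeff 3) * Polynomial.X ^ 3
      + Polynomial.C (C.coeff 4) * Polynomial.X ^ 4
      + Polynomial.C (C.coeff 5) * Polynomial.X ^ 5 := by
    conv_lhs => rw [C.as_sum_range_C_mul_X_pow' (n := 6) (by omega)]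
    simp [Finset.sum_range_succ]
  refine ⟨C.coeff 0, C.coeff 1, C.coeff 2, C.coeff 3, C.coeff 4, C.coeff 5, ?_, fun m => ?_⟩
  rotate_left
  · rw [← hz m]
    conv_rhs => rw [hC']
    simp
  · rw [Finset.prod_singleton] at hF
    have h := coeff_eq_zero_of_sum_eq_zero (n := 7) (c := ![
      S.f 0 - (-S.root a * C.coeff 0),
      S.f 1 - (C.coeff 0 - S.root a * C.coeff 1),
      S.f 2 - (C.coeff 1 - S.root a * C.coeff 2),
      S.f 3 - (C.coeff 2 - S.root a * C.coeff 3),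
      S.f 4 - (C.coeff 3 - S.root a * C.coeff 4),
      S.f 5 - (C.coeff 4 - S.root a * C.coeff 5),
      S.f 6 - C.coeff 5]) (by
      rw [F_eq] at hF
      rw [← sub_eq_zero] at hF
      rw [← hF]
      conv_rhs => rw [hC']
      simp [Fin.sum_univ_seven]
      ring)
    simp only [Fin.forall_fin_succ] at h
    simp [sub_eq_zero] at h
    refine ⟨by linear_combination h.1, ?_⟩
    simpa using h.2

/-- The cofactor of `(X - θ_a) (X - θ_b) (X - θ_c)` in `F`, in coefficients. -/
lemma exists_coeffs_triple {a b c : Fin 6} (hab : a ≠ b) (hac : a ≠ c) (hbc : b ≠ c) :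
    ∃ c₀ c₁ c₂ c₃ : K,
    let e₁ := S.root a + S.root b + S.root c
    let e₂ := S.root a * S.root b + S.root a * S.root c + S.root b * S.root c
    let e₃ := S.root a * S.root b * S.root c
    (S.f 0 = -e₃ * c₀ ∧ S.f 1 = e₂ * c₀ - e₃ * c₁ ∧ S.f 2 = -e₁ * c₀ + e₂ * c₁ - e₃ * c₂ ∧
      S.f 3 = c₀ - e₁ * c₁ + e₂ * c₂ - e₃ * c₃ ∧ S.f 4 = c₁ - e₁ * c₂ + e₂ * c₃ ∧
      S.f 5 = c₂ - e₁ * c₃ ∧ S.f 6 = c₃) ∧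
    ∀ m, c₀ + c₁ * S.root m + c₂ * S.root m ^ 2 + c₃ * S.root m ^ 3 = 0 ↔
      m ∉ ({a, b, c} : Finset (Fin 6)) := by
  obtain ⟨C, hC, hF, hz⟩ := S.exists_cofactor {a, b, c}
  rw [Finset.card_eq_three.2 ⟨a, b, c, hab, hac, hbc, rfl⟩] at hC
  have hC' := eq_of_natDegree_le_three hC
  refine ⟨C.coeff 0, C.coeff 1, C.coeff 2, C.coeff 3, ?_, fun m => ?_⟩
  rotate_left
  · rw [← hz m]
    conv_rhs => rw [hC']
    simp
  · rw [Finset.prod_insert (by simp [hab, hac]), Finset.prod_pair hbc] at hF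
    have h := coeff_eq_zero_of_sum_eq_zero (n := 7) (c := ![
      S.f 0 - (-(S.root a * S.root b * S.root c) * C.coeff 0),
      S.f 1 - ((S.root a * S.root b + S.root a * S.root c + S.root b * S.root c) * C.coeff 0
        - (S.root a * S.root b * S.root c) * C.coeff 1),
      S.f 2 - (-(S.root a + S.root b + S.root c) * C.coeff 0
        + (S.root a * S.root b + S.root a * S.root c + S.root b * S.root c) * C.coeff 1
        - (S.root a * S.root b * S.root c) * C.coeff 2),
      S.f 3 - (C.coeff 0 - (S.root a + S.root b + S.root c) * C.coeff 1
        + (S.root a * S.root b + S.root a * S.root c + S.root b * S.root c) * C.coeff 2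
        - (S.root a * S.root b * S.root c) * C.coeff 3),
      S.f 4 - (C.coeff 1 - (S.root a + S.root b + S.root c) * C.coeff 2
        + (S.root a * S.root b + S.root a * S.root c + S.root b * S.root c) * C.coeff 3),
      S.f 5 - (C.coeff 2 - (S.root a + S.root b + S.root c) * C.coeff 3),
      S.f 6 - C.coeff 3]) (by
      rw [F_eq] at hF
      rw [← sub_eq_zero] at hF
      rw [← hF]
      conv_rhs => rw [hC']
      simp [Fin.sum_univ_seven]
      ring)
    simp only [Fin.forall_fin_succ] at h
    simp [sub_eq_zero] at h
    refine ⟨by linear_combination h.1, ?_⟩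
    simpa using h.2

lemma signs_of_mem {R : Type*} [CommRing R] {I : Finset (Fin 6)} {m : Fin 6} (h : m ∈ I) :
    (signs I m : R) = -1 := if_pos h

lemma signs_of_notMem {R : Type*} [CommRing R] {I : Finset (Fin 6)} {m : Fin 6} (h : m ∉ I) :
    (signs I m : R) = 1 := if_neg h

lemma kummerCoords_root {a b : Fin 6} (hab : a ≠ b) {c₀ c₁ c₂ c₃ c₄ : K}
    (h0 : S.f 0 = S.root a * S.root b * c₀)
    (h1 : S.f 1 = S.root a * S.root b * c₁ - (S.root a + S.root b) * c₀)
    (h2 : S.f 2 = S.root a * S.root b * c₂ - (S.root a + S.root b) * c₁ + c₀)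
    (h3 : S.f 3 = S.root a * S.root b * c₃ - (S.root a + S.root b) * c₂ + c₁)
    (h4 : S.f 4 = S.root a * S.root b * c₄ - (S.root a + S.root b) * c₃ + c₂)
    (h5 : S.f 5 = -(S.root a + S.root b) * c₄ + c₃) (h6 : S.f 6 = c₄) :
    S.kummerCoords (S.root a) 0 (S.root b) 0 = ![1, S.root a + S.root b, S.root a * S.root b,
      -c₀ - S.root a * S.root b * c₂ - (S.root a * S.root b) ^ 2 * c₄] := by
  have hd : S.root a - S.root b ≠ 0 := sub_ne_zero.2 (S.root_injective.ne hab)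
  have : (S.F₀ (S.root a) (S.root b) - 2 * (0 * 0)) / (S.root a - S.root b) ^ 2
      = -c₀ - S.root a * S.root b * c₂ - (S.root a * S.root b) ^ 2 * c₄ := by
    rw [div_eq_iff (pow_ne_zero 2 hd), F₀, h0, h1, h2, h3, h4, h5, h6]
    ring
  rw [kummerCoords, this]

/-- The line attached to `P` passes through `N_{ab}` if and only if the first three moments of
`ε^{(a)} ε^{(b)} P` vanish. The coordinates of the join with `N_{ab}` take opposite quadratic values
at `θ_a, θ_b` and at the other roots, because the node is built from the cofactor of
`(X - θ_a) (X - θ_b)` in `F`. -/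
lemma join_node_eq_zero_iff {a b : Fin 6} (hab : a ≠ b) (π : Fin 6 → K) :
    join (S.line (S.vec π)) (S.kummerCoords (S.root a) 0 (S.root b) 0) = 0 ↔
      S.LowMoments {a, b} π := by
  obtain ⟨c₀, c₁, c₂, c₃, c₄, ⟨h0, h1, h2, h3, h4, h5, h6⟩, hz⟩ := S.exists_coeffs_pair hab
  rw [S.kummerCoords_root hab h0 h1 h2 h3 h4 h5 h6]
  set s := S.root a + S.root b with hs
  set r := S.root a * S.root b with hr
  have hθ : S.root a ≠ S.root b := S.root_injective.ne hab
  have key (k : Fin 4) (d₀ d₁ d₂ : K) (c : K → K)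
      (hC : ∀ x, join (S.geomLine x) ![1, s, r, -c₀ - r * c₂ - r ^ 2 * c₄] k
        = d₀ + d₁ * x + d₂ * x ^ 2
          + c x * (c₀ + c₁ * x + c₂ * x ^ 2 + c₃ * x ^ 3 + c₄ * x ^ 4))
      (hI : ∀ x, x ^ 2 = s * x - r →
        join (S.geomLine x) ![1, s, r, -c₀ - r * c₂ - r ^ 2 * c₄] k
        = -(d₀ + d₁ * x + d₂ * x ^ 2)) :
      join (S.line (S.vec π)) ![1, s, r, -c₀ - r * c₂ - r ^ 2 * c₄] k
        = d₀ * S.vec (signs {a, b} * π) 0 + d₁ * S.vec (signs {a, b} * π) 1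
          + d₂ * S.vec (signs {a, b} * π) 2 := by
    refine S.join_line_vec_apply fun m => ?_
    by_cases hm : m ∈ ({a, b} : Finset (Fin 6))
    · rw [signs_of_mem hm, hI]
      · ring
      · simp only [Finset.mem_insert, Finset.mem_singleton] at hm
        rcases hm with rfl | rfl <;> rw [hs, hr] <;> ring
    · rw [signs_of_notMem hm, hC, (hz m).2 hm]
      ring
  have p3 (x : K) (hx : x ^ 2 = s * x - r) : x ^ 3 = (s ^ 2 - r) * x - s * r := by
    linear_combination (x + s) * hx
  have p4 (x : K) (hx : x ^ 2 = s * x - r) :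
      x ^ 4 = (s ^ 3 - 2 * s * r) * x - (s ^ 2 - r) * r := by
    linear_combination x * p3 x hx + (s ^ 2 - r) * hx
  have p5 (x : K) (hx : x ^ 2 = s * x - r) :
      x ^ 5 = (s ^ 4 - 3 * s ^ 2 * r + r ^ 2) * x - (s ^ 3 - 2 * s * r) * r := by
    linear_combination x * p4 x hx + (s ^ 3 - 2 * s * r) * hx
  have k3 := key 3 (-r) s (-1) 0 (fun x => by simp [join, geomLine, line]; ring)
    (fun x hx => by simp [join, geomLine, line]; linear_combination (-2) * hx)
  have h2C (x : K) : join (S.geomLine x) ![1, s, r, -c₀ - r * c₂ - r ^ 2 * c₄] 2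
        = (c₀ - r * c₂ - r ^ 2 * c₄) + (c₁ + s * c₂ - r * c₃) * x
          + (s * c₃ + (s ^ 2 - 2 * r) * c₄) * x ^ 2
          + (-2) * (c₀ + c₁ * x + c₂ * x ^ 2 + c₃ * x ^ 3 + c₄ * x ^ 4) := by
    simp [join, geomLine, line, h1, h2, h3, h4, h5, h6]; ring
  have k2 := key 2 _ _ _ (fun _ => -2) h2C fun x hx => by
    rw [h2C]
    linear_combination 2 * (s * c₃ + (s ^ 2 - 2 * r) * c₄) * hx - 2 * c₂ * hx
      - 2 * c₃ * p3 x hx - 2 * c₄ * p4 x hx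
  have h1C (x : K) : join (S.geomLine x) ![1, s, r, -c₀ - r * c₂ - r ^ 2 * c₄] 1
        = -(s * c₀ + r * c₁) + (c₀ - r * c₂ + r ^ 2 * c₄) * x
          + -(r * c₃ + r * s * c₄) * x ^ 2
          + (-2 * (x - s)) * (c₀ + c₁ * x + c₂ * x ^ 2 + c₃ * x ^ 3 + c₄ * x ^ 4) := by
    simp [join, geomLine, line, h1, h2, h3, h4, h5, h6]; ring
  have k1 := key 1 _ _ _ (fun x => -2 * (x - s)) h1C fun x hx => by
    rw [h1C]
    linear_combination -2 * (r * c₃ + r * s * c₄) * hx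
      - 2 * (c₁ * hx + c₂ * p3 x hx + c₃ * p4 x hx + c₄ * p5 x hx)
      + 2 * s * (c₂ * hx + c₃ * p3 x hx + c₄ * p4 x hx)
  have hself (l : Fin 6 → K) (β : K) : join l ![1, s, r, β] 0 = -(s * join l ![1, s, r, β] 1
      + r * join l ![1, s, r, β] 2 + β * join l ![1, s, r, β] 3) := by
    simp [join]; ring
  constructor
  · intro h
    rw [h] at k1 k2 k3
    simp only [Pi.zero_apply] at k1 k2 k3
    set V₀ := S.vec (signs {a, b} * π) 0
    set V₁ := S.vec (signs {a, b} * π) 1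
    set V₂ := S.vec (signs {a, b} * π) 2
    have hA : c₀ + c₁ * S.root a + c₂ * S.root a ^ 2 + c₃ * S.root a ^ 3 + c₄ * S.root a ^ 4 ≠ 0 :=
      fun h => by simpa using (hz a).1 h
    have hB : c₀ + c₁ * S.root b + c₂ * S.root b ^ 2 + c₃ * S.root b ^ 3 + c₄ * S.root b ^ 4 ≠ 0 :=
      fun h => by simpa using (hz b).1 h
    have eA : V₁ - S.root b * V₀ = 0 := by
      refine (mul_eq_zero.1 ?_).resolve_left hA
      linear_combination -S.root a * k2 - k1 - (S.root a * (s * c₃ + (s ^ 2 - 2 * r) * c₄)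
        - r * c₃ - r * s * c₄) * k3
    have eB : V₁ - S.root a * V₀ = 0 := by
      refine (mul_eq_zero.1 ?_).resolve_left hB
      linear_combination -S.root b * k2 - k1 - (S.root b * (s * c₃ + (s ^ 2 - 2 * r) * c₄)
        - r * c₃ - r * s * c₄) * k3
    have e0 : V₀ = 0 := by
      refine (mul_eq_zero.1 ?_).resolve_left (sub_ne_zero.2 hθ)
      linear_combination eA - eB
    have e1 : V₁ = 0 := by linear_combination eA + S.root b * e0
    exact ⟨e0, e1, by linear_combination s * e1 - r * e0 + k3⟩
  · rintro ⟨e0, e1, e2⟩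
    rw [e0, e1, e2] at k1 k2 k3
    simp only [mul_zero, add_zero] at k1 k2 k3
    ext k
    fin_cases k
    · simp [hself, k1, k2, k3]
    · exact k1
    · exact k2
    · exact k3

lemma join_nodeZero_eq_zero_iff (π : Fin 6 → K) :
    join (S.line (S.vec π)) ![0, 0, 0, 1] = 0 ↔ S.LowMoments ∅ π := by
  have hs : (signs ∅ : Fin 6 → K) * π = π := by ext m; simp [signs]
  rw [LowMoments, hs]
  constructor
  · intro h
    have h0 := congrFun h 0
    have h1 := congrFun h 1
    have h2 := congrFun h 2
    simp [join, line] at h0 h1 h2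
    exact ⟨h2, h1, h0⟩
  · rintro ⟨h0, h1, h2⟩
    ext k
    fin_cases k <;> simp [join, line, h0, h1, h2]

/-- The analogue of `join_node_eq_zero_iff` for the trope `T_i`. -/
lemma meet_tropeOne_eq_zero_iff (i : Fin 6) (π : Fin 6 → K) :
    meet (S.line (S.vec π)) ![S.root i ^ 2, -S.root i, 1, 0] = 0 ↔ S.LowMoments {i} π := by
  obtain ⟨c₀, c₁, c₂, c₃, c₄, c₅, ⟨h0, h1, h2, h3, h4, h5, h6⟩, hz⟩ := S.exists_coeffs_single i
  set t := S.root i with ht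
  have key (k : Fin 4) (d₀ d₁ d₂ : K) (c : K → K)
      (hC : ∀ x, meet (S.geomLine x) ![t ^ 2, -t, 1, 0] k
        = d₀ + d₁ * x + d₂ * x ^ 2
          + c x * (c₀ + c₁ * x + c₂ * x ^ 2 + c₃ * x ^ 3 + c₄ * x ^ 4 + c₅ * x ^ 5))
      (hI : meet (S.geomLine t) ![t ^ 2, -t, 1, 0] k = -(d₀ + d₁ * t + d₂ * t ^ 2)) :
      meet (S.line (S.vec π)) ![t ^ 2, -t, 1, 0] k
        = d₀ * S.vec (signs {i} * π) 0 + d₁ * S.vec (signs {i} * π) 1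
          + d₂ * S.vec (signs {i} * π) 2 := by
    refine S.meet_line_vec_apply fun m => ?_
    by_cases hm : m ∈ ({i} : Finset (Fin 6))
    · rw [signs_of_mem hm]
      rw [Finset.mem_singleton] at hm
      rw [hm, ← ht, hI]
      ring
    · rw [signs_of_notMem hm, hC, (hz m).2 hm]
      ring
  have k0 := key 0 t (-1) 0 0 (fun x => by simp [meet, dualLine, join, geomLine, line]; ring)
    (by simp [meet, dualLine, join, geomLine, line])
  have k1 := key 1 (t ^ 2) 0 (-1) 0
    (fun x => by simp [meet, dualLine, join, geomLine, line]; ring)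
    (by simp [meet, dualLine, join, geomLine, line])
  have k2 := key 2 0 (t ^ 2) (-t) 0
    (fun x => by simp [meet, dualLine, join, geomLine, line]; ring)
    (by simp [meet, dualLine, join, geomLine, line]; ring)
  have k3 := key 3 (-(c₀ + t * c₁)) (-(t * c₂ + t ^ 2 * c₃)) (-(t ^ 2 * c₄ + t ^ 3 * c₅))
    (fun _ => 2)
    (fun x => by simp [meet, dualLine, join, geomLine, line, h1, h2, h3, h4, h5, h6]; ring)
    (by simp [meet, dualLine, join, geomLine, line, h1, h2, h3, h4, h5, h6]; ring)
  have hA : c₀ + c₁ * t + c₂ * t ^ 2 + c₃ * t ^ 3 + c₄ * t ^ 4 + c₅ * t ^ 5 ≠ 0 :=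
    fun h => by simpa using (hz i).1 h
  constructor
  · intro h
    rw [h] at k0 k1 k2 k3
    simp only [Pi.zero_apply] at k0 k1 k2 k3
    set V₀ := S.vec (signs {i} * π) 0
    set V₁ := S.vec (signs {i} * π) 1
    set V₂ := S.vec (signs {i} * π) 2
    have e0 : V₀ = 0 := by
      refine (mul_eq_zero.1 ?_).resolve_left hA
      linear_combination k3 - (t * c₂ + t ^ 2 * c₃) * k0 - (t ^ 2 * c₄ + t ^ 3 * c₅) * k1
    have e1 : V₁ = 0 := by linear_combination t * e0 + k0
    exact ⟨e0, e1, by linear_combination t ^ 2 * e0 + k1⟩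
  · rintro ⟨e0, e1, e2⟩
    rw [e0, e1, e2] at k0 k1 k2 k3
    simp only [mul_zero, add_zero] at k0 k1 k2 k3
    ext k
    fin_cases k
    · exact k0
    · exact k1
    · exact k2
    · exact k3

/-- The analogue of `join_node_eq_zero_iff` for the trope `T_{ijk}`, whose coordinates come from the
factorization of `F` into two cubics. -/
lemma exists_tropeThree {i j k : Fin 6} (hij : i ≠ j) (hik : i ≠ k) (hjk : j ≠ k) :
    ∃ η : Fin 4 → K, η 3 = 1 ∧ ∀ π : Fin 6 → K,
      meet (S.line (S.vec π)) η = 0 ↔ S.LowMoments {i, j, k} π := by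
  obtain ⟨c₀, c₁, c₂, c₃, ⟨h0, h1, h2, h3, h4, h5, h6⟩, hz⟩ := S.exists_coeffs_triple hij hik hjk
  obtain ⟨e₁, he₁⟩ : ∃ e, S.root i + S.root j + S.root k = e := ⟨_, rfl⟩
  obtain ⟨e₂, he₂⟩ : ∃ e, S.root i * S.root j + S.root i * S.root k + S.root j * S.root k = e :=
    ⟨_, rfl⟩
  obtain ⟨e₃, he₃⟩ : ∃ e, S.root i * S.root j * S.root k = e := ⟨_, rfl⟩
  simp only [he₁, he₂, he₃] at h0 h1 h2 h3 h4 h5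
  refine ⟨![-e₁ * c₀ - e₃ * c₂, c₀ - c₃ * e₃, c₁ + c₃ * e₂, 1], rfl, fun π => ?_⟩
  set η : Fin 4 → K := ![-e₁ * c₀ - e₃ * c₂, c₀ - c₃ * e₃, c₁ + c₃ * e₂, 1] with hη
  have key (n : Fin 4) (d₀ d₁ d₂ : K) (c : K → K)
      (hC : ∀ x, meet (S.geomLine x) η n
        = d₀ + d₁ * x + d₂ * x ^ 2 + c x * (c₀ + c₁ * x + c₂ * x ^ 2 + c₃ * x ^ 3))
      (hI : ∀ x, x ^ 3 = e₁ * x ^ 2 - e₂ * x + e₃ →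
        meet (S.geomLine x) η n = -(d₀ + d₁ * x + d₂ * x ^ 2)) :
      meet (S.line (S.vec π)) η n
        = d₀ * S.vec (signs {i, j, k} * π) 0 + d₁ * S.vec (signs {i, j, k} * π) 1
          + d₂ * S.vec (signs {i, j, k} * π) 2 := by
    refine S.meet_line_vec_apply fun m => ?_
    by_cases hm : m ∈ ({i, j, k} : Finset (Fin 6))
    · rw [signs_of_mem hm, hI]
      · ring
      · simp only [Finset.mem_insert, Finset.mem_singleton] at hm
        rcases hm with rfl | rfl | rfl <;> rw [← he₁, ← he₂, ← he₃] <;> ring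
    · rw [signs_of_notMem hm, hC, (hz m).2 hm]
      ring
  have p4 (x : K) (hx : x ^ 3 = e₁ * x ^ 2 - e₂ * x + e₃) :
      x ^ 4 = (e₁ ^ 2 - e₂) * x ^ 2 + (e₃ - e₁ * e₂) * x + e₁ * e₃ := by
    linear_combination (x + e₁) * hx
  have p5 (x : K) (hx : x ^ 3 = e₁ * x ^ 2 - e₂ * x + e₃) :
      x ^ 5 = (e₁ * (e₁ ^ 2 - e₂) + (e₃ - e₁ * e₂)) * x ^ 2
        + (e₁ * e₃ - e₂ * (e₁ ^ 2 - e₂)) * x + (e₁ ^ 2 - e₂) * e₃ := by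
    linear_combination x * p4 x hx + (e₁ ^ 2 - e₂) * hx
  have h0C (x : K) : meet (S.geomLine x) η 0
        = (c₀ + c₃ * e₃) + (c₁ - c₃ * e₂) * x + (c₂ + c₃ * e₁) * x ^ 2
          + (-2) * (c₀ + c₁ * x + c₂ * x ^ 2 + c₃ * x ^ 3) := by
    simp [meet, dualLine, join, geomLine, line, hη, h1, h2, h3, h4, h5, h6]; ring
  have k0 := key 0 _ _ _ (fun _ => -2) h0C fun x hx => by
    rw [h0C]
    linear_combination - 2 * c₃ * hx
  have h1C (x : K) : meet (S.geomLine x) η 1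
        = -(-e₁ * c₀ + e₃ * c₂) - (c₀ - e₁ * c₁ - e₂ * c₂ + e₃ * c₃) * x
          - (c₁ - c₃ * e₂) * x ^ 2
          + (2 * (x - e₁)) * (c₀ + c₁ * x + c₂ * x ^ 2 + c₃ * x ^ 3) := by
    simp [meet, dualLine, join, geomLine, line, hη, h1, h2, h3, h4, h5, h6]; ring
  have k1 := key 1 (-(-e₁ * c₀ + e₃ * c₂)) (-(c₀ - e₁ * c₁ - e₂ * c₂ + e₃ * c₃))
      (-(c₁ - c₃ * e₂)) (fun x => 2 * (x - e₁)) (fun x => by rw [h1C]; ring) fun x hx => by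
    rw [h1C]
    linear_combination 2 * c₂ * hx + 2 * c₃ * p4 x hx - 2 * e₁ * c₃ * hx
  have h2C (x : K) : meet (S.geomLine x) η 2
        = (e₂ * c₀ + e₃ * c₁) + (-e₁ * c₀ + e₃ * c₂) * x + (c₀ + c₃ * e₃) * x ^ 2
          + (-2 * (x ^ 2 - e₁ * x + e₂)) * (c₀ + c₁ * x + c₂ * x ^ 2 + c₃ * x ^ 3) := by
    simp [meet, dualLine, join, geomLine, line, hη, h1, h2, h3, h4, h5, h6]; ring
  have k2 := key 2 _ _ _ (fun x => -2 * (x ^ 2 - e₁ * x + e₂)) h2C fun x hx => by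
    rw [h2C]
    linear_combination -2 * (c₁ * hx + c₂ * p4 x hx + c₃ * p5 x hx)
      + 2 * e₁ * (c₂ * hx + c₃ * p4 x hx) - 2 * e₂ * c₃ * hx
  have hself (l : Fin 6 → K) (η : Fin 4 → K) (h : η 3 = 1) :
      meet l η 3 = -(η 0 * meet l η 0 + η 1 * meet l η 1 + η 2 * meet l η 2) := by
    simp [meet, join, h]; ring
  constructor
  · intro h
    rw [h] at k0 k1 k2
    simp only [Pi.zero_apply] at k0 k1 k2
    set V₀ := S.vec (signs {i, j, k} * π) 0
    set V₁ := S.vec (signs {i, j, k} * π) 1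
    set V₂ := S.vec (signs {i, j, k} * π) 2
    have hroot (x y z : K) (hxyz : x + y + z = e₁ ∧ x * y + x * z + y * z = e₂ ∧ x * y * z = e₃)
        (hx : c₀ + c₁ * x + c₂ * x ^ 2 + c₃ * x ^ 3 ≠ 0) : V₂ - (y + z) * V₁ + y * z * V₀ = 0 := by
      obtain ⟨r₁, r₂, r₃⟩ := hxyz
      refine (mul_eq_zero.1 ?_).resolve_left hx
      rw [← r₁, ← r₂, ← r₃] at k0 k1 k2
      linear_combination -k2 + x * k1 - x ^ 2 * k0
    have hi := hroot (S.root i) (S.root j) (S.root k) ⟨he₁, he₂, he₃⟩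
      (fun h => by simpa using (hz i).1 h)
    have hj := hroot (S.root j) (S.root i) (S.root k)
      ⟨by rw [← he₁]; ring, by rw [← he₂]; ring, by rw [← he₃]; ring⟩
      (fun h => by simpa using (hz j).1 h)
    have hk := hroot (S.root k) (S.root i) (S.root j)
      ⟨by rw [← he₁]; ring, by rw [← he₂]; ring, by rw [← he₃]; ring⟩
      (fun h => by simpa using (hz k).1 h)
    have eij : V₁ - S.root k * V₀ = 0 := by
      refine (mul_eq_zero.1 ?_).resolve_left (sub_ne_zero.2 (S.root_injective.ne hij))
      linear_combination hi - hj
    have eik : V₁ - S.root j * V₀ = 0 := by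
      refine (mul_eq_zero.1 ?_).resolve_left (sub_ne_zero.2 (S.root_injective.ne hik))
      linear_combination hi - hk
    have e0 : V₀ = 0 := by
      refine (mul_eq_zero.1 ?_).resolve_left (sub_ne_zero.2 (S.root_injective.ne hjk))
      linear_combination eij - eik
    have e1 : V₁ = 0 := by linear_combination eij + S.root k * e0
    refine ⟨e0, e1, ?_⟩
    linear_combination hi + (S.root j + S.root k) * e1 - S.root j * S.root k * e0
  · rintro ⟨e0, e1, e2⟩
    rw [e0, e1, e2] at k0 k1 k2
    simp only [mul_zero, add_zero] at k0 k1 k2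
    ext n
    fin_cases n
    · exact k0
    · exact k1
    · exact k2
    · simp [hself _ η rfl, k0, k1, k2]

/-! ### The lines on the desingularized surface -/

lemma card_symmDiff_add {ι : Type*} [DecidableEq ι] (I J : Finset ι) :
    (I ∆ J).card + 2 * (I ∩ J).card = I.card + J.card := by
  have h1 := Finset.card_inter_add_card_sdiff I J
  have h2 := Finset.card_inter_add_card_sdiff J I
  rw [Finset.inter_comm] at h2
  have : (I ∆ J).card = (I \ J).card + (J \ I).card :=
    Finset.card_union_of_disjoint disjoint_sdiff_sdiff
  omega

lemma signs_mul_signs {R : Type*} [CommRing R] (I J : Finset (Fin 6)) :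
    (signs I : Fin 6 → R) * signs J = signs (I ∆ J) := by
  ext m
  by_cases hI : m ∈ I <;> by_cases hJ : m ∈ J <;>
    simp [signs, Finset.mem_symmDiff, hI, hJ]

lemma signs_mul_self {R : Type*} [CommRing R] (I : Finset (Fin 6)) (m : Fin 6) :
    (signs I m : R) * signs I m = 1 := by
  by_cases hI : m ∈ I <;> simp [signs, hI]

lemma signs_compl {R : Type*} [CommRing R] (I : Finset (Fin 6)) (m : Fin 6) :
    (signs Iᶜ m : R) = -signs I m := by
  by_cases hI : m ∈ I <;> simp [signs, hI]

/-- The image of `Δ₀` under the sign changes in `I`: the line of those `P` whose values at the roots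
are, up to these signs, those of a polynomial of degree at most one. -/
def lineSign (I : Finset (Fin 6)) : Set (ℙ K (Fin 6 → K)) :=
  {a | ∃ (p : Fin 6 → K) (hp : p ≠ 0), a = Projectivization.mk K p hp ∧
    ∃ c d : K, ∀ m, S.ev p m = signs I m * (c + d * S.root m)}

variable {S}

lemma mk_mem_lineSign {I : Finset (Fin 6)} {p : Fin 6 → K} (hp : p ≠ 0) :
    Projectivization.mk K p hp ∈ S.lineSign I ↔
      ∃ c d : K, ∀ m, S.ev p m = signs I m * (c + d * S.root m) := by
  constructor
  · rintro ⟨q, hq, e, c, d, h⟩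
    obtain ⟨u, rfl⟩ := (Projectivization.mk_eq_mk_iff' K _ _ _ _).1 e
    refine ⟨u * c, u * d, fun m => ?_⟩
    rw [ev_smul, Pi.smul_apply, h, smul_eq_mul]
    ring
  · exact fun h => ⟨p, hp, rfl, h⟩

variable (S)

lemma lineZero_eq : lineZero = S.lineSign ∅ := by
  ext a
  induction a using Projectivization.ind with | h p hp
  rw [mk_mem_lineSign]
  constructor
  · rintro ⟨q, hq, e, h2, h3, h4, h5⟩
    rw [← mk_mem_lineSign hp, e, mk_mem_lineSign]
    refine ⟨q 0, q 1, fun m => ?_⟩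
    simp [ev, eval_toPoly, Fin.sum_univ_six, h2, h3, h4, h5, signs]
  · rintro ⟨c, d, h⟩
    have : p = ![c, d, 0, 0, 0, 0] := by
      apply S.ev_injective
      ext m
      rw [h]
      simp [ev, eval_toPoly, Fin.sum_univ_six, signs]
    exact ⟨p, hp, rfl, by simp [this]⟩

lemma eval_P_eq_zero {i m : Fin 6} (h : m ≠ i) : (S.P i).eval (S.root m) = 0 := by
  simp only [P, Polynomial.eval_prod]
  exact Finset.prod_eq_zero (Finset.mem_erase.mpr ⟨h, Finset.mem_univ m⟩) (by simp)

lemma eval_P_ne_zero (i : Fin 6) : (S.P i).eval (S.root i) ≠ 0 := by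
  simp only [P, Polynomial.eval_prod, Polynomial.eval_sub, Polynomial.eval_X, Polynomial.eval_C]
  refine Finset.prod_ne_zero_iff.mpr fun m hm => sub_ne_zero.mpr fun h => ?_
  exact (Finset.ne_of_mem_erase hm) (S.root_injective h).symm

/-- Multiplication by `g_i` modulo `F` changes the sign of the value at `θ_i`. -/
lemma eval_g (i m : Fin 6) : (S.g i).eval (S.root m) = signs {i} m := by
  by_cases h : m = i
  · subst h
    simp [g, S.eval_P_ne_zero, signs]
    norm_num
  · simp [g, S.eval_P_eq_zero h, signs, h]

lemma ev_epsLin (i : Fin 6) (p : Fin 6 → K) : S.ev (S.epsLin i p) = signs {i} * S.ev p := by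
  have h : toPoly (S.epsLin i p) = (S.g i * toPoly p) % S.F := by
    ext n
    by_cases hn : n < 6
    · exact coeff_toPoly _ ⟨n, hn⟩
    · rw [Polynomial.coeff_eq_zero_of_natDegree_lt
        ((natDegree_toPoly_lt _).trans_le (not_lt.1 hn)), Polynomial.coeff_eq_zero_of_degree_lt]
      refine (Polynomial.degree_mod_lt _ S.F_ne_zero).trans_le ?_
      rw [Polynomial.degree_eq_natDegree S.F_ne_zero, natDegree_F]
      exact_mod_cast not_lt.mp hn
  ext m
  rw [ev, h, Pi.mul_apply, ← eval_g, ev, ← Polynomial.eval_mul]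
  conv_rhs => rw [← EuclideanDomain.div_add_mod (S.g i * toPoly p) S.F]
  simp [eval_F_root]

lemma eps_mk (i : Fin 6) {p : Fin 6 → K} (hp : p ≠ 0) :
    ∃ h, S.eps i (Projectivization.mk K p hp) = Projectivization.mk K (S.epsLin i p) h :=
  ⟨_, rfl⟩

lemma eps_eps (i : Fin 6) (a : ℙ K (Fin 6 → K)) : S.eps i (S.eps i a) = a := by
  induction a using Projectivization.ind with | h p hp
  obtain ⟨h, e⟩ := S.eps_mk i hp
  obtain ⟨h', e'⟩ := S.eps_mk i h
  have : S.epsLin i (S.epsLin i p) = p := by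
    apply S.ev_injective
    rw [ev_epsLin, ev_epsLin, ← mul_assoc, signs_mul_signs]
    ext m
    simp [signs]
  simp only [e, e', this]

lemma eps_mem_lineSign {i : Fin 6} {I : Finset (Fin 6)} {a : ℙ K (Fin 6 → K)}
    (ha : a ∈ S.lineSign I) : S.eps i a ∈ S.lineSign ({i} ∆ I) := by
  obtain ⟨p, hp, rfl, c, d, h⟩ := ha
  obtain ⟨h', e⟩ := S.eps_mk i hp
  rw [e, mk_mem_lineSign]
  refine ⟨c, d, fun m => ?_⟩
  rw [ev_epsLin, ← signs_mul_signs, Pi.mul_apply, Pi.mul_apply, h, mul_assoc]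

lemma eps_image_lineSign (i : Fin 6) (I : Finset (Fin 6)) :
    S.eps i '' S.lineSign I = S.lineSign ({i} ∆ I) := by
  ext a
  constructor
  · rintro ⟨b, hb, rfl⟩
    exact S.eps_mem_lineSign hb
  · intro ha
    have := S.eps_mem_lineSign (i := i) ha
    rw [symmDiff_symmDiff_cancel_left] at this
    exact ⟨_, this, S.eps_eps i a⟩

lemma lineOne_eq (i : Fin 6) : S.lineOne i = S.lineSign {i} := by
  rw [lineOne, S.lineZero_eq, eps_image_lineSign, ← Finset.bot_eq_empty, symmDiff_bot]

lemma lineTwo_eq {i j : Fin 6} (h : i ≠ j) : S.lineTwo i j = S.lineSign {i, j} := by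
  rw [lineTwo, ← lineOne, S.lineOne_eq, eps_image_lineSign]
  congr 1
  ext m
  simp only [Finset.mem_symmDiff, Finset.mem_singleton, Finset.mem_insert]
  aesop

lemma lineThree_eq {i j k : Fin 6} (hij : i ≠ j) (hik : i ≠ k) (hjk : j ≠ k) :
    S.lineThree i j k = S.lineSign {i, j, k} := by
  rw [lineThree, ← lineTwo, S.lineTwo_eq hjk, eps_image_lineSign]
  congr 1
  ext m
  simp only [Finset.mem_symmDiff, Finset.mem_singleton, Finset.mem_insert]
  aesop

lemma lineSign_compl (I : Finset (Fin 6)) : S.lineSign Iᶜ = S.lineSign I := by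
  ext a
  induction a using Projectivization.ind with | h p hp
  rw [mk_mem_lineSign, mk_mem_lineSign]
  constructor <;>
  · rintro ⟨c, d, h⟩
    refine ⟨-c, -d, fun m => ?_⟩
    rw [h, signs_compl]
    ring

/-! ### Intersections -/

/-- A polynomial of degree at most one with two roots is zero. -/
lemma eq_zero_of_affine {c d : K} {T : Finset (Fin 6)} (hT : 2 ≤ T.card)
    (h : ∀ m ∈ T, c + d * S.root m = 0) : c = 0 ∧ d = 0 := by
  obtain ⟨a, ha, b, hb, hab⟩ := Finset.one_lt_card.1 hT
  have hd : d = 0 := by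
    refine (mul_eq_zero.1 ?_).resolve_right (sub_ne_zero.2 (S.root_injective.ne hab))
    linear_combination h a ha - h b hb
  exact ⟨by simpa [hd] using h a ha, hd⟩

/-- On a common point two affine functions are opposite at the roots in `I ∆ J` and equal at the
others. There are at least two roots of each kind. -/
lemma lineSign_inter_eq_empty (hK : (2 : K) ≠ 0) {I J : Finset (Fin 6)} (h2 : 2 ≤ (I ∆ J).card)
    (h4 : (I ∆ J).card ≤ 4) : S.lineSign I ∩ S.lineSign J = ∅ := by
  rw [Set.eq_empty_iff_forall_notMem]
  rintro a ⟨⟨p, hp, rfl, c, d, h⟩, h'⟩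
  obtain ⟨c', d', h'⟩ := (mk_mem_lineSign hp).1 h'
  have e (m : Fin 6) : c + d * S.root m = signs (I ∆ J) m * (c' + d' * S.root m) := by
    rw [← signs_mul_signs, Pi.mul_apply, mul_assoc, ← h', h, ← mul_assoc, signs_mul_self, one_mul]
  obtain ⟨h1, h1'⟩ := S.eq_zero_of_affine (c := c + c') (d := d + d') h2 fun m hm => by
    have := e m
    rw [signs_of_mem hm] at this
    linear_combination this
  obtain ⟨h3, h3'⟩ := S.eq_zero_of_affine (c := 2 * c) (d := 2 * d) (T := (I ∆ J)ᶜ)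
    (by rw [Finset.card_compl, Fintype.card_fin]; omega) fun m hm => by
      have := e m
      rw [signs_of_notMem (Finset.mem_compl.1 hm)] at this
      linear_combination this + h1 + h1' * S.root m
  have hc := (mul_eq_zero.1 h3).resolve_left hK
  have hd := (mul_eq_zero.1 h3').resolve_left hK
  refine S.ev_ne_zero hp ?_
  ext m
  simp [h, hc, hd]

/-- The common point is the class of `X - θ_m`, up to signs. -/
lemma lineSign_inter_nonempty {I J : Finset (Fin 6)} {m : Fin 6} (h : I ∆ J = {m}) :
    (S.lineSign I ∩ S.lineSign J).Nonempty := by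
  let π : Fin 6 → K := fun n => signs I n * (-S.root m + 1 * S.root n)
  have hev := S.ev_coeffs_vec π
  have hp : S.coeffs (S.vec π) ≠ 0 := by
    intro h0
    obtain ⟨n, hn⟩ := exists_ne m
    have : S.ev 0 n = π n := by rw [← hev, h0]
    have h1 : S.ev 0 n = 0 := by simp [ev, eval_toPoly]
    rw [h1] at this
    have h2 : signs I n * π n = 0 := by rw [← this, mul_zero]
    simp only [π, ← mul_assoc, signs_mul_self, one_mul] at h2
    exact hn (S.root_injective (by linear_combination h2))
  refine ⟨Projectivization.mk K _ hp, (mk_mem_lineSign hp).2 ⟨_, _, fun n => congrFun hev n⟩,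
    (mk_mem_lineSign hp).2 ⟨-S.root m, 1, fun n => ?_⟩⟩
  rw [hev]
  by_cases hn : n = m
  · simp [π, hn]
  · have : n ∉ I ∆ J := by simpa [h] using hn
    have e : (signs (I ∆ J) n : K) = 1 := signs_of_notMem this
    rw [← signs_mul_signs, Pi.mul_apply] at e
    have : (signs I n : K) = signs J n := by
      linear_combination signs J n * e - signs I n * signs_mul_self (R := K) J n
    simp only [π, this]

lemma lineZero_inter_lineOne (i : Fin 6) (hK : (2 : K) ≠ 0) :
    lineZero ∩ S.lineOne i = {S.linearPoint i} := by
  rw [S.lineOne_eq, S.lineZero_eq]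
  have hmem {I : Finset (Fin 6)} (hI : ∀ m, m ≠ i → (signs I m : K) = 1) :
      S.linearPoint i ∈ S.lineSign I := by
    rw [linearPoint, mk_mem_lineSign]
    refine ⟨-S.root i, 1, fun m => ?_⟩
    by_cases hm : m = i
    · simp [ev, eval_toPoly, Fin.sum_univ_six, hm]
    · simp [ev, eval_toPoly, Fin.sum_univ_six, hI m hm]
  refine Set.Subset.antisymm ?_ (Set.singleton_subset_iff.2 ⟨hmem (by simp [signs]),
    hmem (by simp +contextual [signs])⟩)
  rintro a ⟨⟨p, hp, rfl, c, d, h⟩, h'⟩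
  obtain ⟨c', d', h'⟩ := (mk_mem_lineSign hp).1 h'
  have e (m : Fin 6) : c + d * S.root m = signs {i} m * (c' + d' * S.root m) := by
    rw [← h', h]; simp [signs]
  obtain ⟨h1, h2⟩ := S.eq_zero_of_affine (c := c - c') (d := d - d') (T := {i}ᶜ)
    (by rw [Finset.card_compl, Fintype.card_fin]; simp) fun m hm => by
      have := e m
      rw [signs_of_notMem (Finset.mem_compl.1 hm)] at this
      linear_combination this
  have hi : c + d * S.root i = 0 := by
    have := e i
    rw [signs_of_mem (by simp)] at this
    refine (mul_eq_zero.1 ?_).resolve_left hK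
    linear_combination this + h1 + h2 * S.root i
  refine (Projectivization.mk_eq_mk_iff' K _ _ _ _).2 ⟨d, S.ev_injective ?_⟩
  ext m
  rw [h]
  simp [ev, eval_toPoly, Fin.sum_univ_six, signs]
  linear_combination -hi

lemma lineThree_inter_lineTwo (hK : (2 : K) ≠ 0) {i j k m n : Fin 6} (hij : i ≠ j) (hik : i ≠ k)
    (hjk : j ≠ k) (hmn : m ≠ n) : (S.lineThree i j k ∩ S.lineTwo m n).Nonempty ↔
      (({m, n} : Finset (Fin 6)) ⊆ {i, j, k} ∨ Disjoint ({m, n} : Finset (Fin 6)) {i, j, k}) := by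
  rw [S.lineThree_eq hij hik hjk, S.lineTwo_eq hmn]
  have h3 : ({i, j, k} : Finset (Fin 6)).card = 3 :=
    Finset.card_eq_three.2 ⟨_, _, _, hij, hik, hjk, rfl⟩
  have h2 : ({m, n} : Finset (Fin 6)).card = 2 := Finset.card_pair hmn
  generalize ({i, j, k} : Finset (Fin 6)) = I at *
  have hJ : ({m, n} : Finset (Fin 6)) ⊆ I ∨ Disjoint ({m, n} : Finset (Fin 6)) I ∨
      ({m, n} ∩ I).card = 1 := by
    by_cases hm : m ∈ I <;> by_cases hn : n ∈ I
    · exact Or.inl (by simp [Finset.insert_subset_iff, hm, hn])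
    · exact Or.inr (Or.inr (by
        simp [Finset.insert_inter_of_mem hm, Finset.singleton_inter_of_notMem hn]))
    · exact Or.inr (Or.inr (by
        simp [Finset.insert_inter_of_notMem hm, Finset.singleton_inter_of_mem hn]))
    · exact Or.inr (Or.inl (by simp [hm, hn]))
  generalize ({m, n} : Finset (Fin 6)) = J at *
  have hcard : (I ∆ J).card + 2 * (J ∩ I).card = 5 := by
    rw [Finset.inter_comm, card_symmDiff_add, h3, h2]
  constructor
  · intro h
    rcases hJ with hJ | hJ | hJ
    · exact Or.inl hJ
    · exact Or.inr hJ
    · rw [S.lineSign_inter_eq_empty hK (by omega) (by omega)] at h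
      simp at h
  · rintro (h | h)
    · rw [Finset.inter_eq_left.2 h] at hcard
      obtain ⟨m, hm⟩ := Finset.card_eq_one.1 (show (I ∆ J).card = 1 by omega)
      exact S.lineSign_inter_nonempty hm
    · rw [Finset.disjoint_iff_inter_eq_empty.1 h, Finset.card_empty] at hcard
      rw [← S.lineSign_compl I]
      have : (Iᶜ ∆ J).card = 1 := by
        have e : Iᶜ ∆ J = (I ∆ J)ᶜ := by
          ext x
          simp only [Finset.mem_symmDiff, Finset.mem_compl]
          tauto
        rw [e, Finset.card_compl, Fintype.card_fin]
        omega
      obtain ⟨m, hm⟩ := Finset.card_eq_one.1 this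
      exact S.lineSign_inter_nonempty hm

/-! ### Coordinates of the nodes and tropes -/

/-- `ξ` is a coordinate vector of the node of `I`: the lines attached to `P` through it are those
for which the first three moments of `P`, with the signs of `I` changed, vanish. -/
structure IsNodeCoords (I : Finset (Fin 6)) (ξ : Fin 4 → K) : Prop where
  ne_zero : ξ ≠ 0
  join_eq_zero_iff (π : Fin 6 → K) : join (S.line (S.vec π)) ξ = 0 ↔ S.LowMoments I π

/-- `η` is a coordinate vector of the trope of `I`: the lines attached to `P` in it are those for
which the first three moments of `P`, with the signs of `I` changed, vanish. -/
structure IsTropeCoords (I : Finset (Fin 6)) (η : Fin 4 → K) : Prop where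
  ne_zero : η ≠ 0
  meet_eq_zero_iff (π : Fin 6 → K) : meet (S.line (S.vec π)) η = 0 ↔ S.LowMoments I π

lemma isNodeCoords_nodeZero : S.IsNodeCoords ∅ ![0, 0, 0, 1] :=
  ⟨fun h => by simpa using congrFun h 3, S.join_nodeZero_eq_zero_iff⟩

lemma isNodeCoords_node {a b : Fin 6} (hab : a ≠ b) :
    S.IsNodeCoords {a, b} (S.kummerCoords (S.root a) 0 (S.root b) 0) :=
  ⟨S.kummerCoords_ne_zero _ _ _ _, S.join_node_eq_zero_iff hab⟩

lemma isTropeCoords_one (i : Fin 6) : S.IsTropeCoords {i} ![S.root i ^ 2, -S.root i, 1, 0] :=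
  ⟨fun h => by simpa using congrFun h 2, S.meet_tropeOne_eq_zero_iff i⟩

lemma lowMoments_compl (I : Finset (Fin 6)) (π : Fin 6 → K) :
    S.LowMoments Iᶜ π ↔ S.LowMoments I π := by
  have h : (signs Iᶜ : Fin 6 → K) * π = (-1 : K) • (signs I * π) := by
    ext m; simp [signs_compl]
  rw [LowMoments, h, vec_smul]
  simp [LowMoments]

lemma vec_mulRoot {R : Type*} [CommRing R] [Algebra K R] (π : Fin 6 → R) (j : Fin 5) :
    S.vec (S.mulRoot π) j.castSucc = S.vec π j.succ := by
  simp only [vec, mulRoot]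
  refine Finset.sum_congr rfl fun m _ => ?_
  rw [← mul_assoc, ← map_mul]
  simp [pow_succ, mul_assoc]

lemma coeffs_affine (b : Fin 6 → K) (h0 : b 0 = 0) (h1 : b 1 = 0) (h2 : b 2 = 0) (h3 : b 3 = 0) :
    S.coeffs b = ![S.coeffs b 0, S.coeffs b 1, 0, 0, 0, 0] := by
  ext j
  fin_cases j <;> simp [coeffs, h0, h1, h2, h3]

lemma signs_mul_mulRoot (I : Finset (Fin 6)) (π : Fin 6 → K) :
    signs I * S.mulRoot π = S.mulRoot (signs I * π) := by
  ext m; simp [mulRoot]; ring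

/-- The lines attached to `P` and `X P` both satisfy the equations of `I` if and only if the first
four moments of the sign change of `P` vanish, i.e. it has degree at most one. -/
lemma lowMoments_and_mulRoot_iff (I : Finset (Fin 6)) (π : Fin 6 → K) :
    S.LowMoments I π ∧ S.LowMoments I (S.mulRoot π) ↔
      ∃ c d : K, ∀ m, π m = signs I m * (c + d * S.root m) := by
  have hm (j : Fin 5) := S.vec_mulRoot (signs I * π) j
  rw [LowMoments, LowMoments, signs_mul_mulRoot]
  have e0 := hm 0
  have e1 := hm 1
  have e2 := hm 2
  simp only [Fin.castSucc_zero, Fin.reduceCastSucc, Fin.reduceSucc] at e0 e1 e2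
  constructor
  · rintro ⟨⟨h0, h1, h2⟩, h3, h4, h5⟩
    have h := S.coeffs_affine _ h0 h1 h2 (e2 ▸ h5)
    have hev := S.ev_coeffs_vec (signs I * π)
    rw [h] at hev
    refine ⟨S.coeffs (S.vec (signs I * π)) 0, S.coeffs (S.vec (signs I * π)) 1, fun m => ?_⟩
    have := congrFun hev m
    simp only [ev, eval_toPoly, Fin.sum_univ_six, Pi.mul_apply] at this
    rw [← one_mul (π m), ← signs_mul_self (R := K) I m, mul_assoc, ← this]
    simp
  · rintro ⟨c, d, h⟩
    have hp : S.ev ![c, d, 0, 0, 0, 0] = signs I * π := by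
      ext m
      rw [Pi.mul_apply, h, ← mul_assoc, signs_mul_self]
      simp [ev, eval_toPoly, Fin.sum_univ_six]
    have hc : S.coeffs (S.vec (signs I * π)) = ![c, d, 0, 0, 0, 0] := by
      rw [← hp, coeffs_vec_ev]
    have h6 := S.f_six_ne_zero
    have c5 := congrFun hc 5
    have c4 := congrFun hc 4
    have c3 := congrFun hc 3
    have c2 := congrFun hc 2
    simp [coeffs, h6] at c5
    simp [coeffs, h6, c5] at c4
    simp [coeffs, h6, c5, c4] at c3
    simp [coeffs, h6, c5, c4, c3] at c2
    exact ⟨⟨c5, c4, c3⟩, e0.trans c4, e1.trans c3, e2.trans c2⟩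

lemma mem_lineSign_iff {I : Finset (Fin 6)} {p : Fin 6 → K} (hp : p ≠ 0) :
    Projectivization.mk K p hp ∈ S.lineSign I ↔
      S.LowMoments I (S.ev p) ∧ S.LowMoments I (S.mulRoot (S.ev p)) := by
  rw [mk_mem_lineSign, lowMoments_and_mulRoot_iff]

lemma lineSign_subset_desing (I : Finset (Fin 6)) : S.lineSign I ⊆ S.desing := by
  rintro _ ⟨p, hp, rfl, c, d, h⟩
  refine (S.mem_desing_iff hp).2 ⟨c ^ 2, 2 * c * d, d ^ 2, fun m => ?_⟩
  rw [h, mul_pow, pow_two, signs_mul_self]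
  ring

lemma isNull_affine {R : Type*} [CommRing R] [Algebra K R] (I : Finset (Fin 6)) (c d : R) :
    S.IsNull (fun m => signs I m * (c + d * algebraMap K R (S.root m))) :=
  S.isNull_of_sq_eq (c ^ 2) (2 * c * d) (d ^ 2) fun m => by
    rw [mul_pow, pow_two, signs_mul_self]; ring

variable {S}

/-- The lines `Δ_I` and `Δ_J` have a common point, and the line of `ℙ³` attached to it passes
through the node and lies in the trope. -/
lemma IsTropeCoords.dotProduct_node (hK : (2 : K) ≠ 0) {I J : Finset (Fin 6)} {ξ η : Fin 4 → K}
    (hη : S.IsTropeCoords I η) (hξ : S.IsNodeCoords J ξ) {m : Fin 6} (h : I ∆ J = {m}) :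
    η ⬝ᵥ ξ = 0 := by
  obtain ⟨a, ⟨p, hp, rfl, hI⟩, hJ⟩ := S.lineSign_inter_nonempty h
  have hI := ((S.mem_lineSign_iff hp).1 ⟨p, hp, rfl, hI⟩).1
  have hJ := ((S.mem_lineSign_iff hp).1 hJ).1
  rw [← hη.meet_eq_zero_iff] at hI
  rw [← hξ.join_eq_zero_iff] at hJ
  have hl : S.line (S.vec (S.ev p)) ≠ 0 := fun e => hp (by
    rw [← S.coeffs_vec_ev p, S.line_eq_zero hK e, coeffs_zero])
  obtain ⟨i, hi⟩ := Function.ne_iff.1 hl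
  exact (mul_eq_zero.1 (line_mul_incidence hJ hI i)).resolve_left hi

lemma IsTropeCoords.compl {I : Finset (Fin 6)} {η : Fin 4 → K} (hη : S.IsTropeCoords I η) :
    S.IsTropeCoords Iᶜ η :=
  ⟨hη.ne_zero, fun π => by rw [lowMoments_compl, hη.meet_eq_zero_iff]⟩

lemma orthogonal_mk {v w : Fin 4 → K} (hv : v ≠ 0) (hw : w ≠ 0) :
    Projectivization.orthogonal (Projectivization.mk K v hv) (Projectivization.mk K w hw)
      ↔ v ⬝ᵥ w = 0 := Projectivization.orthogonal_mk hv hw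

variable (S)

lemma isTropeOne_iff (hK : (2 : K) ≠ 0) (i : Fin 6) (T : ℙ K (Fin 4 → K)) :
    S.IsTropeOne i T ↔ T = Projectivization.mk K _ (S.isTropeCoords_one i).ne_zero := by
  constructor
  · induction T using Projectivization.ind with | h η hη
    rintro ⟨h0, h⟩
    rw [nodeZero, orthogonal_mk] at h0
    have h3 : η 3 = 0 := by simpa [dotProduct, Fin.sum_univ_four] using h0
    have e (j : Fin 6) (hj : j ≠ i) : (η 0 + η 1 * S.root i) + (η 1 + η 2 * S.root i) * S.root j
        = 0 := by
      have := h j hj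
      rw [node, kummerPoint, orthogonal_mk] at this
      simp [dotProduct, Fin.sum_univ_four, kummerCoords, h3] at this
      linear_combination this
    obtain ⟨e1, e2⟩ := S.eq_zero_of_affine (T := {i}ᶜ)
      (by rw [Finset.card_compl, Fintype.card_fin]; simp) fun m hm => e m (by simpa using hm)
    refine (Projectivization.mk_eq_mk_iff' K _ _ _ _).2 ⟨η 2, ?_⟩
    ext k
    fin_cases k
    · simp; linear_combination S.root i * e2 - e1
    · simp; linear_combination -e2
    · simp
    · simp [h3]
  · rintro rfl
    constructor
    · rw [nodeZero, orthogonal_mk]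
      exact (S.isTropeCoords_one i).dotProduct_node hK S.isNodeCoords_nodeZero
        (m := i) (by rw [← Finset.bot_eq_empty, symmDiff_bot])
    · intro j hj
      rw [node, kummerPoint, orthogonal_mk]
      refine (S.isTropeCoords_one i).dotProduct_node hK (S.isNodeCoords_node hj.symm) (m := j) ?_
      ext m
      simp only [Finset.mem_symmDiff, Finset.mem_singleton, Finset.mem_insert]
      aesop

lemma exists_isTropeThree_iff (hK : (2 : K) ≠ 0) {i j k : Fin 6} (hij : i ≠ j) (hik : i ≠ k)
    (hjk : j ≠ k) : ∃ (η : Fin 4 → K) (hη : S.IsTropeCoords {i, j, k} η),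
      ∀ T, S.IsTropeThree i j k T ↔ T = Projectivization.mk K η hη.ne_zero := by
  obtain ⟨η, h3, hη⟩ := S.exists_tropeThree hij hik hjk
  have hc : S.IsTropeCoords {i, j, k} η := ⟨fun h => by simp [h] at h3, hη⟩
  have hinc : S.IsTropeThree i j k (Projectivization.mk K η hc.ne_zero) := by
    intro m n hmn h
    rw [node, kummerPoint, orthogonal_mk]
    have hc3 : ({i, j, k} : Finset (Fin 6)).card = 3 :=
      Finset.card_eq_three.2 ⟨_, _, _, hij, hik, hjk, rfl⟩
    have hc2 : ({m, n} : Finset (Fin 6)).card = 2 := Finset.card_pair hmn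
    rcases h with h | h
    · have h1 : (({i, j, k} : Finset (Fin 6)) ∆ {m, n}).card = 1 := by
        rw [symmDiff_of_ge h, Finset.card_sdiff_of_subset h]
        omega
      obtain ⟨a, ha⟩ := Finset.card_eq_one.1 h1
      exact hc.dotProduct_node hK (S.isNodeCoords_node hmn) ha
    · have h1 : (({i, j, k} : Finset (Fin 6))ᶜ ∆ {m, n}).card = 1 := by
        have h' := Finset.subset_compl_iff_disjoint_right.2 h
        rw [symmDiff_of_ge h', Finset.card_sdiff_of_subset h', Finset.card_compl,
          Fintype.card_fin]
        omega
      obtain ⟨a, ha⟩ := Finset.card_eq_one.1 h1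
      exact hc.compl.dotProduct_node hK (S.isNodeCoords_node hmn) ha
  refine ⟨η, hc, fun T => ⟨?_, fun h => h ▸ hinc⟩⟩
  induction T using Projectivization.ind with | h ζ hζ
  intro hT
  -- the combination of the two planes that vanishes in the last coordinate
  have e (m n : Fin 6) (hmn : m ≠ n) (h : ({m, n} : Finset (Fin 6)) ⊆ {i, j, k}) :
      (ζ 0 - ζ 3 * η 0) + (ζ 1 - ζ 3 * η 1) * (S.root m + S.root n)
        + (ζ 2 - ζ 3 * η 2) * (S.root m * S.root n) = 0 := by
    have e1 := hT m n hmn (Or.inl h)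
    have e2 := hinc m n hmn (Or.inl h)
    rw [node, kummerPoint, orthogonal_mk] at e1 e2
    simp only [dotProduct, Fin.sum_univ_four, kummerCoords] at e1 e2
    simp at e1 e2
    rw [h3] at e2
    linear_combination e1 - ζ 3 * e2
  have eij := e i j hij (by simp)
  have eik := e i k hik (by simp)
  have ejk := e j k hjk (by simp)
  have a1 : (ζ 1 - ζ 3 * η 1) + (ζ 2 - ζ 3 * η 2) * S.root i = 0 := by
    refine (mul_eq_zero.1 ?_).resolve_left (sub_ne_zero.2 (S.root_injective.ne hjk))
    linear_combination eij - eik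
  have a2 : (ζ 1 - ζ 3 * η 1) + (ζ 2 - ζ 3 * η 2) * S.root j = 0 := by
    refine (mul_eq_zero.1 ?_).resolve_left (sub_ne_zero.2 (S.root_injective.ne hik))
    linear_combination eij - ejk
  have b2 : ζ 2 - ζ 3 * η 2 = 0 := by
    refine (mul_eq_zero.1 ?_).resolve_left (sub_ne_zero.2 (S.root_injective.ne hij))
    linear_combination a1 - a2
  have b1 : ζ 1 - ζ 3 * η 1 = 0 := by linear_combination a1 - S.root i * b2
  have b0 : ζ 0 - ζ 3 * η 0 = 0 := by
    linear_combination eij - (S.root i + S.root j) * b1 - S.root i * S.root j * b2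
  refine (Projectivization.mk_eq_mk_iff' K _ _ _ _).2 ⟨ζ 3, ?_⟩
  ext k
  fin_cases k
  · simp; linear_combination -b0
  · simp; linear_combination -b1
  · simp; linear_combination -b2
  · simp [h3]

/-! ### Equations of the graphs -/

section Algebra

variable {R R' : Type*} [CommRing R] [Algebra K R] [CommRing R'] [Algebra K R'] (φ : R →ₐ[K] R')
  (b : Fin 6 → R) (ξ : Fin 4 → R)

lemma map_join_line : (fun i => φ (join (S.line b) ξ i))
    = join (S.line (fun i => φ (b i))) (fun i => φ (ξ i)) := by
  rw [← map_line]; exact map_join (φ : R →+* R') _ _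

lemma map_join_lineX : (fun i => φ (join (S.lineX b) ξ i))
    = join (S.lineX (fun i => φ (b i))) (fun i => φ (ξ i)) := by
  rw [← map_lineX]; exact map_join (φ : R →+* R') _ _

lemma map_meet_line : (fun i => φ (meet (S.line b) ξ i))
    = meet (S.line (fun i => φ (b i))) (fun i => φ (ξ i)) := by
  rw [← map_line]; exact map_meet (φ : R →+* R') _ _

lemma map_meet_lineX : (fun i => φ (meet (S.lineX b) ξ i))
    = meet (S.lineX (fun i => φ (b i))) (fun i => φ (ξ i)) := by
  rw [← map_lineX]; exact map_meet (φ : R →+* R') _ _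

end Algebra

/-- The coordinates of a point of `ℙ³` and the values of a polynomial at the roots as polynomial
functions of all coordinates. -/
lemma exists_polynomial_values : ∃ (V : Fin 4 → MvPolynomial (Fin 4 ⊕ Fin 6) K)
    (W : Fin 6 → MvPolynomial (Fin 4 ⊕ Fin 6) K), ∀ (v : Fin 4 → K) (w : Fin 6 → K),
      (fun i => MvPolynomial.aeval (R := K) (Sum.elim v w) (V i)) = v ∧
      (fun i => MvPolynomial.aeval (R := K) (Sum.elim v w) (W i)) = S.ev w := by
  refine ⟨fun i => MvPolynomial.X (Sum.inl i), fun m => ∑ j : Fin 6, MvPolynomial.X (Sum.inr j) *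
    MvPolynomial.C (S.root m ^ (j : ℕ)), fun v w => ⟨?_, ?_⟩⟩
  · ext i; simp
  · ext m; simp [ev, eval_toPoly]

lemma forall_eq_zero_of_mem_closure {A : Set (ℙ K (Fin 4 → K) × ℙ K (Fin 6 → K))}
    {G : Fin 4 → MvPolynomial (Fin 4 ⊕ Fin 6) K} {N : (Fin 4 → K) → (Fin 6 → K) → Fin 4 → K}
    (hG : ∀ v w, (fun i => MvPolynomial.aeval (R := K) (Sum.elim v w) (G i)) = N v w)
    (h : ∀ (v : Fin 4 → K) (hv : v ≠ 0) (w : Fin 6 → K) (hw : w ≠ 0),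
      (Projectivization.mk K v hv, Projectivization.mk K w hw) ∈ A → N v w = 0)
    {v : Fin 4 → K} (hv : v ≠ 0) {w : Fin 6 → K} (hw : w ≠ 0)
    (hA : (Projectivization.mk K v hv, Projectivization.mk K w hw) ∈ zariskiClosureProd A) :
    N v w = 0 := by
  have e (v w i) : MvPolynomial.eval (Sum.elim v w) (G i) = N v w i := by
    rw [← hG]; rfl
  ext i
  rw [← e]
  exact hA (G i) (fun v hv w hw hvw => by rw [e, h v hv w hw hvw]; rfl) v hv w hw rfl

variable {S}

lemma join_eq_zero_of_mem_kappaGeneric {v : Fin 4 → K} (hv : v ≠ 0) {w : Fin 6 → K} (hw : w ≠ 0)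
    (hK : (2 : K) ≠ 0)
    (h : (Projectivization.mk K v hv, Projectivization.mk K w hw) ∈ S.kappaGeneric) :
    join (S.line (S.vec (S.ev w))) v = 0 ∧ join (S.lineX (S.vec (S.ev w))) v = 0 := by
  obtain ⟨x, y, u, t, hy, ht, hy0, ht0, hxu, M, hM, hMx, hMu, hMF, p, hp, hdvd, e⟩ := h
  rw [Prod.mk.injEq] at e
  obtain ⟨c, hc⟩ := (Projectivization.mk_eq_mk_iff' K _ _ _ _).1 e.1
  obtain ⟨d, hd⟩ := (Projectivization.mk_eq_mk_iff' K _ _ _ _).1 e.2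
  have hgen := S.isGenericMoments_of_cubic hy ht hy0 ht0 hM hMx hMu hMF hdvd
  have hne : 2 * y * t * (x - u) ^ 3 ≠ 0 := by simp [hK, hy0, ht0, sub_eq_zero, hxu]
  obtain ⟨h1, h2⟩ := hgen.join_kummerCoords hne hxu
  rw [← hc, ← hd, ev_smul, vec_smul, line_smul, lineX_smul, join_smul_left, join_smul_left,
    join_smul_right, join_smul_right, h1, h2]
  simp

lemma gradient_smul (c : K) (ξ : Fin 4 → K) : S.gradient (c • ξ) = c ^ 3 • S.gradient ξ := by
  rw [gradient_eq, gradient_eq]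
  ext i
  fin_cases i <;> simp <;> ring

lemma meet_eq_zero_of_isTangentPlane {ξ : ℙ K (Fin 4 → K)} {v : Fin 4 → K} (hv : v ≠ 0)
    {w : Fin 6 → K} (hw : w ≠ 0) (hK : (2 : K) ≠ 0)
    (ht : S.IsTangentPlane (Projectivization.mk K v hv) ξ)
    (h : (ξ, Projectivization.mk K w hw) ∈ S.kappaGeneric) :
    meet (S.line (S.vec (S.ev w))) v = 0 ∧ meet (S.lineX (S.vec (S.ev w))) v = 0 := by
  obtain ⟨x, y, u, t, hy, ht', hy0, ht0, hxu, M, hM, hMx, hMu, hMF, p, hp, hdvd, e⟩ := h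
  obtain ⟨ζ, hζ, η, hη, rfl, hvη, hgrad⟩ := ht
  rw [Prod.mk.injEq] at e
  obtain ⟨c, hc⟩ := (Projectivization.mk_eq_mk_iff' K _ _ _ _).1 e.1
  obtain ⟨d, hd⟩ := (Projectivization.mk_eq_mk_iff' K _ _ _ _).1 e.2
  obtain ⟨a, ha⟩ := (Projectivization.mk_eq_mk_iff' K _ _ _ _).1 hvη
  have hgen := S.isGenericMoments_of_cubic hy ht' hy0 ht0 hM hMx hMu hMF hdvd
  have hne : 2 * y * t * (x - u) ^ 3 ≠ 0 := by simp [hK, hy0, ht0, sub_eq_zero, hxu]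
  obtain ⟨h1, h2⟩ := hgen.meet_gradient hne hxu
  have hη' : η = S.gradient ζ := funext hgrad
  rw [← ha, hη', ← hc, gradient_smul, ← hd, ev_smul, vec_smul, line_smul, lineX_smul,
    meet_smul_left, meet_smul_left, meet_smul_right, meet_smul_right, meet_smul_right,
    meet_smul_right, h1, h2]
  simp

/-- The equations of the graph of `κ`: the point lies on the lines attached to `P` and `X P`. -/
lemma join_eq_zero_of_mem_kappaGraph (hK : (2 : K) ≠ 0) {v : Fin 4 → K} (hv : v ≠ 0)
    {w : Fin 6 → K} (hw : w ≠ 0)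
    (h : (Projectivization.mk K v hv, Projectivization.mk K w hw) ∈ S.kappaGraph) :
    join (S.line (S.vec (S.ev w))) v = 0 ∧ join (S.lineX (S.vec (S.ev w))) v = 0 := by
  obtain ⟨V, W, hVW⟩ := S.exists_polynomial_values
  constructor
  · refine forall_eq_zero_of_mem_closure (A := S.kappaGeneric)
      (G := join (S.line (S.vec W)) V) (N := fun v w => join (S.line (S.vec (S.ev w))) v)
      (fun v w => ?_) (fun v hv w hw h => (join_eq_zero_of_mem_kappaGeneric hv hw hK h).1) hv hw h
    obtain ⟨e1, e2⟩ := hVW v w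
    rw [map_join_line, map_vec, e1, e2]
  · refine forall_eq_zero_of_mem_closure (A := S.kappaGeneric)
      (G := join (S.lineX (S.vec W)) V) (N := fun v w => join (S.lineX (S.vec (S.ev w))) v)
      (fun v w => ?_) (fun v hv w hw h => (join_eq_zero_of_mem_kappaGeneric hv hw hK h).2) hv hw h
    obtain ⟨e1, e2⟩ := hVW v w
    rw [map_join_lineX, map_vec, e1, e2]

/-- The equations of the graph of `κ*`: the plane contains the lines attached to `P` and `X P`. -/
lemma meet_eq_zero_of_mem_kappaDualGraph (hK : (2 : K) ≠ 0) {v : Fin 4 → K} (hv : v ≠ 0)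
    {w : Fin 6 → K} (hw : w ≠ 0)
    (h : (Projectivization.mk K v hv, Projectivization.mk K w hw) ∈ S.kappaDualGraph) :
    meet (S.line (S.vec (S.ev w))) v = 0 ∧ meet (S.lineX (S.vec (S.ev w))) v = 0 := by
  obtain ⟨V, W, hVW⟩ := S.exists_polynomial_values
  constructor
  · refine forall_eq_zero_of_mem_closure
      (A := {a | ∃ ξ, S.IsTangentPlane a.1 ξ ∧ (ξ, a.2) ∈ S.kappaGeneric})
      (G := meet (S.line (S.vec W)) V) (N := fun v w => meet (S.line (S.vec (S.ev w))) v)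
      (fun v w => ?_) (fun v hv w hw ⟨ξ, ht, hξ⟩ =>
        (meet_eq_zero_of_isTangentPlane hv hw hK ht hξ).1) hv hw h
    obtain ⟨e1, e2⟩ := hVW v w
    rw [map_meet_line, map_vec, e1, e2]
  · refine forall_eq_zero_of_mem_closure
      (A := {a | ∃ ξ, S.IsTangentPlane a.1 ξ ∧ (ξ, a.2) ∈ S.kappaGeneric})
      (G := meet (S.lineX (S.vec W)) V) (N := fun v w => meet (S.lineX (S.vec (S.ev w))) v)
      (fun v w => ?_) (fun v hv w hw ⟨ξ, ht, hξ⟩ =>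
        (meet_eq_zero_of_isTangentPlane hv hw hK ht hξ).2) hv hw h
    obtain ⟨e1, e2⟩ := hVW v w
    rw [map_meet_lineX, map_vec, e1, e2]

lemma IsNodeCoords.blowUp_subset (hK : (2 : K) ≠ 0) {I : Finset (Fin 6)} {ξ : Fin 4 → K}
    (hξ : S.IsNodeCoords I ξ) :
    S.blowUp S.kappaGraph (Projectivization.mk K ξ hξ.ne_zero) ⊆ S.lineSign I := by
  rintro a ⟨-, ha⟩
  induction a using Projectivization.ind with | h p hp
  obtain ⟨h1, h2⟩ := join_eq_zero_of_mem_kappaGraph hK _ _ ha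
  rw [lineX_vec] at h2
  exact (S.mem_lineSign_iff hp).2 ⟨(hξ.join_eq_zero_iff _).1 h1, (hξ.join_eq_zero_iff _).1 h2⟩

lemma IsTropeCoords.blowUp_subset (hK : (2 : K) ≠ 0) {I : Finset (Fin 6)} {η : Fin 4 → K}
    (hη : S.IsTropeCoords I η) :
    S.blowUp S.kappaDualGraph (Projectivization.mk K η hη.ne_zero) ⊆ S.lineSign I := by
  rintro a ⟨-, ha⟩
  induction a using Projectivization.ind with | h p hp
  obtain ⟨h1, h2⟩ := meet_eq_zero_of_mem_kappaDualGraph hK _ _ ha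
  rw [lineX_vec] at h2
  exact (S.mem_lineSign_iff hp).2 ⟨(hη.meet_eq_zero_iff _).1 h1, (hη.meet_eq_zero_iff _).1 h2⟩

variable (S)

lemma zariskiClosure_lineSign (I : Finset (Fin 6)) :
    zariskiClosure (S.lineSign I) ⊆ S.lineSign I := by
  intro a ha
  induction a using Projectivization.ind with | h p hp
  rw [mem_lineSign_iff]
  -- the moments of `P` are linear forms in the coefficients of `P`
  have key (c : Fin 6 → K) (h : ∀ w (hw : w ≠ 0), Projectivization.mk K w hw ∈ S.lineSign I →
      ∑ m, c m * S.ev w m = 0) : ∑ m, c m * S.ev p m = 0 := by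
    have e (w : Fin 6 → K) : MvPolynomial.eval w (∑ m : Fin 6, MvPolynomial.C (c m) *
        ∑ j : Fin 6, MvPolynomial.X j * MvPolynomial.C (S.root m ^ (j : ℕ)))
        = ∑ m, c m * S.ev w m := by
      simp [ev, eval_toPoly]
    rw [← e]
    exact ha _ (fun w hw hm => by rw [e]; exact h w hw hm) p hp rfl
  have k1 (j : Fin 6) (h : ∀ w (hw : w ≠ 0), Projectivization.mk K w hw ∈ S.lineSign I →
      S.vec (signs I * S.ev w) j = 0) : S.vec (signs I * S.ev p) j = 0 := by
    have e (w : Fin 6 → K) : S.vec (signs I * S.ev w) j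
        = ∑ m, (S.weight m * S.root m ^ (j : ℕ) * signs I m) * S.ev w m := by
      simp [vec, mul_assoc]
    rw [e]
    exact key _ fun w hw hm => by rw [← e]; exact h w hw hm
  have k2 (j : Fin 6) (h : ∀ w (hw : w ≠ 0), Projectivization.mk K w hw ∈ S.lineSign I →
      S.vec (signs I * S.mulRoot (S.ev w)) j = 0) :
      S.vec (signs I * S.mulRoot (S.ev p)) j = 0 := by
    have e (w : Fin 6 → K) : S.vec (signs I * S.mulRoot (S.ev w)) j
        = ∑ m, (S.weight m * S.root m ^ (j : ℕ) * signs I m * S.root m) * S.ev w m := by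
      simp [vec, mulRoot, mul_assoc]
    rw [e]
    exact key _ fun w hw hm => by rw [← e]; exact h w hw hm
  exact ⟨⟨k1 0 fun w hw h => ((S.mem_lineSign_iff hw).1 h).1.1,
    k1 1 fun w hw h => ((S.mem_lineSign_iff hw).1 h).1.2.1,
    k1 2 fun w hw h => ((S.mem_lineSign_iff hw).1 h).1.2.2⟩,
    ⟨k2 0 fun w hw h => ((S.mem_lineSign_iff hw).1 h).2.1,
    k2 1 fun w hw h => ((S.mem_lineSign_iff hw).1 h).2.2.1,
    k2 2 fun w hw h => ((S.mem_lineSign_iff hw).1 h).2.2.2⟩⟩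

/-! ### Points over a trope conic -/

/-- If the first three moments vanish, the interpolating polynomial has degree at most two. -/
lemma exists_quadratic_of_lowMoments {I : Finset (Fin 6)} {π : Fin 6 → K}
    (h : S.LowMoments I π) :
    ∃ q₀ q₁ q₂ : K, ∀ m, signs I m * π m = q₀ + q₁ * S.root m + q₂ * S.root m ^ 2 := by
  obtain ⟨h0, h1, h2⟩ := h
  have hev := S.ev_coeffs_vec (signs I * π)
  refine ⟨S.coeffs (S.vec (signs I * π)) 0, S.coeffs (S.vec (signs I * π)) 1,
    S.coeffs (S.vec (signs I * π)) 2, fun m => ?_⟩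
  have e (j : Fin 6) (hj : 3 ≤ j) : S.coeffs (S.vec (signs I * π)) j = 0 := by
    fin_cases j <;> simp_all [coeffs]
  have := congrFun hev m
  rw [ev, eval_toPoly, Fin.sum_univ_six, e 3 (by decide), e 4 (by decide), e 5 (by decide)] at this
  rw [← Pi.mul_apply, ← this]
  simp

/-- If `π²` and `(α + β X) π` are interpolated by polynomials `H` and `Q` of degree at most two,
then `Q² = (α + β X)² H` because both sides have degree four. So `α + β X` divides `Q`, and `H` is
the square of the quotient. -/
lemma exists_affine_of_mul_affine {α β h₀ h₁ h₂ q₀ q₁ q₂ : K} {π : Fin 6 → K}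
    (hαβ : α ≠ 0 ∨ β ≠ 0)
    (hH : ∀ m, π m ^ 2 = h₀ + h₁ * S.root m + h₂ * S.root m ^ 2)
    (hQ : ∀ m, (α + β * S.root m) * π m = q₀ + q₁ * S.root m + q₂ * S.root m ^ 2) :
    ∃ c d : K, (∀ m, α + β * S.root m ≠ 0 → π m = c + d * S.root m) ∧
      ∀ m, π m ^ 2 = (c + d * S.root m) ^ 2 := by
  have hz : ![α ^ 2 * h₀ - q₀ ^ 2, α ^ 2 * h₁ + 2 * α * β * h₀ - 2 * q₀ * q₁,
      α ^ 2 * h₂ + 2 * α * β * h₁ + β ^ 2 * h₀ - (q₁ ^ 2 + 2 * q₀ * q₂),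
      2 * α * β * h₂ + β ^ 2 * h₁ - 2 * q₁ * q₂, β ^ 2 * h₂ - q₂ ^ 2, 0] = 0 := by
    apply S.ev_injective
    ext m
    simp [ev, eval_toPoly, Fin.sum_univ_six]
    linear_combination (-(α + β * S.root m) ^ 2) * hH m
      + ((α + β * S.root m) * π m + (q₀ + q₁ * S.root m + q₂ * S.root m ^ 2)) * hQ m
  have z0 := congrFun hz 0
  have z1 := congrFun hz 1
  have z2 := congrFun hz 2
  have z3 := congrFun hz 3
  have z4 := congrFun hz 4
  simp at z0 z1 z2 z3 z4
  suffices H : ∃ c d : K, (q₀ = α * c ∧ q₁ = α * d + β * c ∧ q₂ = β * d) ∧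
      h₀ = c ^ 2 ∧ h₁ = 2 * c * d ∧ h₂ = d ^ 2 by
    obtain ⟨c, d, ⟨e0, e1, e2⟩, e3, e4, e5⟩ := H
    refine ⟨c, d, fun m hm => ?_, fun m => ?_⟩
    · apply mul_left_cancel₀ hm
      rw [hQ, e0, e1, e2]
      ring
    · rw [hH, e3, e4, e5]
      ring
  by_cases hβ : β = 0
  · have hα : α ≠ 0 := hαβ.resolve_right (by simpa using hβ)
    have hq2 : q₂ = 0 := by simpa [hβ] using z4
    refine ⟨q₀ / α, q₁ / α, ⟨?_, ?_, ?_⟩, ?_, ?_, ?_⟩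
    · field_simp
    · rw [hβ]; field_simp; ring
    · simp [hβ, hq2]
    all_goals
      field_simp
      simp only [hβ, hq2] at z0 z1 z2
    · linear_combination z0
    · linear_combination z1
    · linear_combination z2
  · have hr : q₀ * β ^ 2 - q₁ * α * β + q₂ * α ^ 2 = 0 := by
      rw [← sq_eq_zero_iff]
      linear_combination -(β ^ 4 * z0 - α * β ^ 3 * z1 + α ^ 2 * β ^ 2 * z2 - α ^ 3 * β * z3
        + α ^ 4 * z4)
    have e2 : h₂ = (q₂ / β) ^ 2 := by field_simp; linear_combination z4
    have e1 : h₁ = 2 * ((q₁ - α * (q₂ / β)) / β) * (q₂ / β) := by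
      rw [e2] at z3
      field_simp at z3 ⊢
      linear_combination z3
    refine ⟨(q₁ - α * (q₂ / β)) / β, q₂ / β, ⟨?_, ?_, ?_⟩, ?_, e1, e2⟩
    · field_simp
      linear_combination hr
    · field_simp
      ring
    · field_simp
    · rw [e1, e2] at z2
      field_simp at z2 ⊢
      linear_combination z2 + 2 * q₂ * hr

/-- If a member `(α + β X) P` of the pencil satisfies the equations of `I`, then `P` lies on `Δ_I`
or on a line `Δ_J` where `J` and `I` differ by one index, that of the root of `α + β X`. -/
lemma mem_lineSign_or_of_meet {I : Finset (Fin 6)} {p : Fin 6 → K} (hp : p ≠ 0)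
    (hd : Projectivization.mk K p hp ∈ S.desing) {α β : K} (hαβ : α ≠ 0 ∨ β ≠ 0)
    (h : S.LowMoments I (fun m => (α + β * S.root m) * S.ev p m)) :
    Projectivization.mk K p hp ∈ S.lineSign I ∨
      ∃ m, Projectivization.mk K p hp ∈ S.lineSign (I ∆ {m}) := by
  obtain ⟨q₀, q₁, q₂, hQ⟩ := S.exists_quadratic_of_lowMoments h
  obtain ⟨h₀, h₁, h₂, hH⟩ := (S.mem_desing_iff hp).1 hd
  obtain ⟨c, d, h1, h2⟩ := S.exists_affine_of_mul_affine (π := signs I * S.ev p) hαβ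
    (fun m => by rw [← hH, Pi.mul_apply, mul_pow, pow_two, signs_mul_self, one_mul])
    (fun m => by rw [← hQ, Pi.mul_apply]; ring)
  have key (m : Fin 6) (hm : (signs I * S.ev p : Fin 6 → K) m = c + d * S.root m) :
      S.ev p m = signs I m * (c + d * S.root m) := by
    rw [← hm, Pi.mul_apply, ← mul_assoc, signs_mul_self, one_mul]
  by_cases hall : ∀ m, (signs I * S.ev p : Fin 6 → K) m = c + d * S.root m
  · exact Or.inl ((mk_mem_lineSign hp).2 ⟨c, d, fun m => key m (hall m)⟩)
  · right
    push Not at hall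
    obtain ⟨m, hm⟩ := hall
    have hm0 : α + β * S.root m = 0 := by
      by_contra h0
      exact hm (h1 m h0)
    refine ⟨m, (mk_mem_lineSign hp).2 ⟨c, d, fun n => ?_⟩⟩
    rw [← signs_mul_signs, Pi.mul_apply]
    by_cases hn : n = m
    · subst hn
      have := (sq_eq_sq_iff_eq_or_eq_neg.1 (h2 n)).resolve_left hm
      rw [signs_of_mem (I := {n}) (by simp), mul_assoc, neg_one_mul, ← this, Pi.mul_apply,
        ← mul_assoc, signs_mul_self, one_mul]
    · rw [signs_of_notMem (I := {m}) (by simpa using hn), mul_one]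
      refine key n (h1 n fun h0 => ?_)
      have hβ : β * (S.root n - S.root m) = 0 := by linear_combination h0 - hm0
      have hβ := (mul_eq_zero.1 hβ).resolve_right (sub_ne_zero.2 (S.root_injective.ne hn))
      rw [hβ, zero_mul, add_zero] at hm0
      exact hαβ.elim (fun h => h hm0) (fun h => h hβ)

variable {S}

lemma exists_smul_eq_of_proportional {n : ℕ} {a b : Fin n → K} (ha : a ≠ 0)
    (h : ∀ i j, a i * b j = a j * b i) : ∃ c : K, b = c • a := by
  obtain ⟨i, hi⟩ := Function.ne_iff.1 ha
  refine ⟨b i / a i, ?_⟩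
  ext j
  simp only [Pi.zero_apply] at hi
  rw [Pi.smul_apply, smul_eq_mul]
  field_simp
  linear_combination h i j

/-- Over a point `ξ` of the trope of `I` that is not a node. Each line of the pencil spanned by the
lines of `P` and `X P` passes through `ξ`, so one of them lies in the plane. The second case of
`mem_lineSign_or_of_meet` would make `ξ` a node. -/
lemma mem_lineSign_of_join (hK : (2 : K) ≠ 0) {I : Finset (Fin 6)} {η : Fin 4 → K}
    (hη : S.IsTropeCoords I η)
    (hnode : ∀ m, ∃ (ξ : Fin 4 → K) (h : S.IsNodeCoords (I ∆ {m}) ξ),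
      Projectivization.mk K ξ h.ne_zero ∈ S.nodes)
    {ξ : Fin 4 → K} (hξ : ξ ≠ 0) (hdot : η ⬝ᵥ ξ = 0)
    (hξn : Projectivization.mk K ξ hξ ∉ S.nodes) {p : Fin 6 → K} (hp : p ≠ 0)
    (hd : Projectivization.mk K p hp ∈ S.desing)
    (h1 : join (S.line (S.vec (S.ev p))) ξ = 0) (h2 : join (S.lineX (S.vec (S.ev p))) ξ = 0) :
    Projectivization.mk K p hp ∈ S.lineSign I := by
  obtain ⟨s, hs⟩ := exists_smul_eq_of_proportional hξ (meet_proportional h1 hdot)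
  obtain ⟨t, ht⟩ := exists_smul_eq_of_proportional hξ (meet_proportional h2 hdot)
  -- some member of the pencil spanned by the two lines lies in the plane
  obtain ⟨α, β, hαβ, h0⟩ : ∃ α β : K, (α ≠ 0 ∨ β ≠ 0) ∧ α * s + β * t = 0 := by
    by_cases h : s = 0
    · exact ⟨1, 0, by simp, by simp [h]⟩
    · exact ⟨-t, s, Or.inr h, by ring⟩
  have hlow : S.LowMoments I (fun m => (α + β * S.root m) * S.ev p m) := by
    rw [← hη.meet_eq_zero_iff]
    have e : (fun m => (α + β * S.root m) * S.ev p m)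
        = α • S.ev p + β • S.mulRoot (S.ev p) := by
      ext m; simp [mulRoot]; ring
    rw [e, vec_add, vec_smul, vec_smul, line_add, line_smul, line_smul, ← lineX_vec,
      meet_add_left, meet_smul_left, meet_smul_left, hs, ht, smul_smul, smul_smul, ← add_smul, h0,
      zero_smul]
  rcases S.mem_lineSign_or_of_meet hp hd hαβ hlow with h | ⟨m, h⟩
  · exact h
  · obtain ⟨ξ', h', hn⟩ := hnode m
    refine absurd ?_ hξn
    rw [mem_lineSign_iff, ← h'.join_eq_zero_iff, ← h'.join_eq_zero_iff, ← lineX_vec] at h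
    rwa [IsNull.point_unique hK (S.isNull_of_mem_desing hp hd) (S.ev_ne_zero hp) hξ h'.ne_zero
      h1 h2 h.1 h.2]

lemma IsTropeCoords.strictTransform_subset (hK : (2 : K) ≠ 0) {I : Finset (Fin 6)}
    {η : Fin 4 → K} (hη : S.IsTropeCoords I η)
    (hnode : ∀ m, ∃ (ξ : Fin 4 → K) (h : S.IsNodeCoords (I ∆ {m}) ξ),
      Projectivization.mk K ξ h.ne_zero ∈ S.nodes) :
    S.strictTransform (S.planeSection (Projectivization.mk K η hη.ne_zero)) ⊆ S.lineSign I := by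
  refine (zariskiClosure_mono ?_).trans (S.zariskiClosure_lineSign I)
  rintro a ⟨ξ, ⟨-, hξ⟩, hξn, had, ha⟩
  induction a using Projectivization.ind with | h p hp
  induction ξ using Projectivization.ind with | h ξ hξ0
  rw [orthogonal_mk] at hξ
  obtain ⟨h1, h2⟩ := join_eq_zero_of_mem_kappaGraph hK _ _ ha
  exact mem_lineSign_of_join hK hη hnode hξ0 hξ hξn hp had h1 h2

lemma IsNodeCoords.of_compl {I : Finset (Fin 6)} {ξ : Fin 4 → K} (hξ : S.IsNodeCoords Iᶜ ξ) :
    S.IsNodeCoords I ξ :=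
  ⟨hξ.ne_zero, fun π => by rw [hξ.join_eq_zero_iff, lowMoments_compl]⟩

variable (S)

/-- Sets of four or six indices have the nodes of their complements. -/
lemma exists_isNodeCoords_of_card {I : Finset (Fin 6)} (h : Even I.card) :
    ∃ (ξ : Fin 4 → K) (h : S.IsNodeCoords I ξ), Projectivization.mk K ξ h.ne_zero ∈ S.nodes := by
  have key (I : Finset (Fin 6)) (h : I.card = 0 ∨ I.card = 2) : ∃ (ξ : Fin 4 → K)
      (h : S.IsNodeCoords I ξ), Projectivization.mk K ξ h.ne_zero ∈ S.nodes := by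
    rcases h with h | h
    · rw [Finset.card_eq_zero] at h
      subst h
      exact ⟨_, S.isNodeCoords_nodeZero, Or.inl rfl⟩
    · obtain ⟨a, b, hab, rfl⟩ := Finset.card_eq_two.1 h
      exact ⟨_, S.isNodeCoords_node hab, Or.inr ⟨a, b, hab, rfl⟩⟩
  have hc : Iᶜ.card = 6 - I.card := by rw [Finset.card_compl, Fintype.card_fin]
  have h6 : I.card ≤ 6 := by simpa using Finset.card_le_univ I
  by_cases h' : I.card = 0 ∨ I.card = 2
  · exact key I h'
  · obtain ⟨ξ, hξ, hn⟩ := key Iᶜ (by rw [hc]; obtain ⟨k, hk⟩ := h; omega)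
    exact ⟨ξ, hξ.of_compl, hn⟩

lemma exists_isNodeCoords_symmDiff {I : Finset (Fin 6)} (h : Odd I.card) (m : Fin 6) :
    ∃ (ξ : Fin 4 → K) (h : S.IsNodeCoords (I ∆ {m}) ξ),
      Projectivization.mk K ξ h.ne_zero ∈ S.nodes := by
  apply S.exists_isNodeCoords_of_card
  by_cases hm : m ∈ I
  · rw [symmDiff_of_ge (by simpa using hm), Finset.card_sdiff_of_subset (by simpa using hm),
      Finset.card_singleton]
    obtain ⟨k, hk⟩ := h
    exact ⟨k, by omega⟩
  · have : Disjoint I {m} := by simpa using hm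
    rw [this.symmDiff_eq_sup, Finset.sup_eq_union, Finset.card_union_of_disjoint this,
      Finset.card_singleton]
    obtain ⟨k, hk⟩ := h
    exact ⟨k + 1, by omega⟩

variable {S}

/-! ### Recognizing points of the graphs -/

/-- If the lines attached to `P` and `X P` have a common point, then `P` is on `𝒮`. -/
lemma isNull_of_join_eq_zero (hK : (2 : K) ≠ 0) {π : Fin 6 → K} {ξ : Fin 4 → K} (hξ : ξ ≠ 0)
    (h1 : join (S.line (S.vec π)) ξ = 0) (h2 : join (S.lineX (S.vec π)) ξ = 0) : S.IsNull π := by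
  have hz (l : Fin 6 → K) : meet l 0 = 0 := join_zero_right _
  have q1 := meet_join_self (S.line (S.vec π)) ξ
  have q2 := meet_join_self (S.lineX (S.vec π)) ξ
  have q3 := meet_join_add (S.line (S.vec π)) (S.lineX (S.vec π)) ξ
  rw [h1, hz] at q1
  rw [h2, hz] at q2
  rw [h1, h2, hz, hz, add_zero] at q3
  have p1 : linePair (S.line (S.vec π)) (S.line (S.vec π)) = 0 := by
    rw [linePair_self, (smul_eq_zero.1 q1.symm).resolve_right hξ, mul_zero]
  have p2 : linePair (S.lineX (S.vec π)) (S.lineX (S.vec π)) = 0 := by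
    rw [linePair_self, (smul_eq_zero.1 q2.symm).resolve_right hξ, mul_zero]
  have p3 := (smul_eq_zero.1 q3.symm).resolve_right hξ
  rw [lineX_vec, linePair_line_vec, mul_eq_zero] at p2 p3
  rw [linePair_line_vec, mul_eq_zero] at p1
  have p1 := p1.resolve_left hK
  have p2 := p2.resolve_left hK
  have p3 := p3.resolve_left hK
  intro k hk
  interval_cases k
  · rw [← p1]
    exact Finset.sum_congr rfl fun m _ => by simp [pow_two]
  · rw [← p3]
    exact Finset.sum_congr rfl fun m _ => by simp [mulRoot]; ring
  · rw [← p2]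
    exact Finset.sum_congr rfl fun m _ => by simp [mulRoot]; ring

lemma exists_quadratic_of_isNull {π : Fin 6 → K} (h : S.IsNull π) :
    ∃ q₀ q₁ q₂ : K, ∀ m, π m ^ 2 = q₀ + q₁ * S.root m + q₂ * S.root m ^ 2 := by
  have hl : S.LowMoments ∅ (fun m => π m ^ 2) := by
    have e (j : Fin 6) : S.vec (signs ∅ * fun m => π m ^ 2) j
        = ∑ m, algebraMap K K (S.weight m * S.root m ^ (j : ℕ)) * π m ^ 2 := by
      simp [vec, signs]
    refine ⟨?_, ?_, ?_⟩
    · rw [e]; exact h 0 (by norm_num)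
    · rw [e]; exact h 1 (by norm_num)
    · rw [e]; exact h 2 (by norm_num)
  simpa [signs] using S.exists_quadratic_of_lowMoments hl

lemma exists_eq_C_mul_F {Q : Polynomial K} (hQ : Q.natDegree ≤ 6)
    (h : ∀ m, Q.eval (S.root m) = 0) : ∃ c, Q = Polynomial.C c * S.F := by
  refine ⟨Q.coeff 6 / S.f 6, ?_⟩
  rw [← sub_eq_zero]
  apply S.eq_zero_of_eval_root
  · have : (Q - Polynomial.C (Q.coeff 6 / S.f 6) * S.F).natDegree ≤ 6 :=
      (Polynomial.natDegree_sub_le _ _).trans (max_le hQ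
        ((Polynomial.natDegree_C_mul_le _ _).trans S.natDegree_F.le))
    refine lt_of_le_of_ne this fun h6 => ?_
    have h0 : (Q - Polynomial.C (Q.coeff 6 / S.f 6) * S.F).coeff 6 = 0 := by
      have := S.f_six_ne_zero
      rw [Polynomial.coeff_sub, Polynomial.coeff_C_mul]
      change Q.coeff 6 - Q.coeff 6 / S.f 6 * S.f 6 = 0
      field_simp
      ring
    have hl := Polynomial.leadingCoeff_eq_zero.1 ((congrArg _ h6).trans h0)
    rw [hl] at h6
    simp at h6
  · intro m
    simp [h, eval_F_root]

section Algebra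

variable {R : Type*} [CommRing R] [Algebra K R]

/-- The last coordinates of the two joins with `ξ` say that the first two moments of `G P` vanish,
where `G = ξ₁ X² - ξ₂ X + ξ₃`. -/
lemma vec_mul_eq_zero {π : Fin 6 → R} {ξ : Fin 4 → R}
    (h1 : join (S.line (S.vec π)) ξ = 0) (h2 : join (S.lineX (S.vec π)) ξ = 0) :
    S.vec (fun m => (ξ 0 * algebraMap K R (S.root m) ^ 2 - ξ 1 * algebraMap K R (S.root m) + ξ 2)
      * π m) 0 = 0 ∧
    S.vec (fun m => (ξ 0 * algebraMap K R (S.root m) ^ 2 - ξ 1 * algebraMap K R (S.root m) + ξ 2)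
      * π m) 1 = 0 := by
  have hvec (j : Fin 6) : S.vec (fun m => (ξ 0 * algebraMap K R (S.root m) ^ 2
        - ξ 1 * algebraMap K R (S.root m) + ξ 2) * π m) j
      = ξ 0 * S.vec (S.mulRoot (S.mulRoot π)) j - ξ 1 * S.vec (S.mulRoot π) j
        + ξ 2 * S.vec π j := by
    simp only [vec, Finset.mul_sum, ← Finset.sum_add_distrib, ← Finset.sum_sub_distrib]
    refine Finset.sum_congr rfl fun m _ => ?_
    simp only [mulRoot]
    ring
  have m0 := S.vec_mulRoot π 0
  have m1 := S.vec_mulRoot π 1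
  have m2 := S.vec_mulRoot π 2
  have n0 := S.vec_mulRoot (S.mulRoot π) 0
  have n1 := S.vec_mulRoot (S.mulRoot π) 1
  simp only [Fin.castSucc_zero, Fin.reduceCastSucc, Fin.reduceSucc] at m0 m1 m2 n0 n1
  have j1 := congrFun h1 3
  have j2 := congrFun h2 3
  simp [join, line, lineX] at j1 j2
  rw [hvec, hvec, n0, n1, m0, m1, m2]
  exact ⟨by linear_combination -j1, by linear_combination -j2⟩

/-- If the first two moments vanish, the interpolating polynomial has degree at most three. -/
lemma exists_cubic {π : Fin 6 → R} (h0 : S.vec π 0 = 0) (h1 : S.vec π 1 = 0) :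
    ∃ m₀ m₁ m₂ m₃ : R, ∀ n, m₀ + m₁ * algebraMap K R (S.root n)
      + m₂ * algebraMap K R (S.root n) ^ 2 + m₃ * algebraMap K R (S.root n) ^ 3 = π n := by
  refine ⟨S.coeffs (S.vec π) 0, S.coeffs (S.vec π) 1, S.coeffs (S.vec π) 2, S.coeffs (S.vec π) 3,
    fun n => ?_⟩
  have e4 : S.coeffs (S.vec π) 4 = 0 := by simp [coeffs, h0, h1]
  have e5 : S.coeffs (S.vec π) 5 = 0 := by simp [coeffs, h0]
  rw [← S.sum_coeffs_vec π n, Fin.sum_univ_six, e4, e5]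
  simp

end Algebra

/-- A polynomial of degree at most one lies over the node `N₀` only. -/
lemma coord_zero_eq_zero_of_affine (hK : (2 : K) ≠ 0) {π : Fin 6 → K} (hπ : π ≠ 0)
    {ξ : Fin 4 → K} (hξ : ξ ≠ 0) (h1 : join (S.line (S.vec π)) ξ = 0)
    (h2 : join (S.lineX (S.vec π)) ξ = 0) {c d : K} (h : ∀ m, π m = c + d * S.root m) :
    ξ 0 = 0 := by
  have hl := (S.lowMoments_and_mulRoot_iff ∅ π).2 ⟨c, d, by simpa [signs] using h⟩
  rw [← S.join_nodeZero_eq_zero_iff, ← S.join_nodeZero_eq_zero_iff, ← lineX_vec] at hl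
  have := IsNull.point_unique hK (isNull_of_join_eq_zero hK hξ h1 h2) hπ hξ
    S.isNodeCoords_nodeZero.ne_zero h1 h2 hl.1 hl.2
  obtain ⟨a, ha⟩ := (Projectivization.mk_eq_mk_iff' K _ _ _ _).1 this
  rw [← ha]
  simp

lemma exists_roots [IsAlgClosed K] {ξ : Fin 4 → K} (h0 : ξ 0 ≠ 0)
    (hdisc : ξ 1 ^ 2 - 4 * ξ 0 * ξ 2 ≠ 0) :
    ∃ x u : K, x ≠ u ∧ ξ 1 = ξ 0 * (x + u) ∧ ξ 2 = ξ 0 * (x * u) := by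
  have hdeg : (Polynomial.C (ξ 0) * Polynomial.X ^ 2 + Polynomial.C (-ξ 1) * Polynomial.X
      + Polynomial.C (ξ 2)).degree ≠ 0 := by
    rw [Polynomial.degree_quadratic h0]; norm_num
  obtain ⟨x, hx⟩ := IsAlgClosed.exists_root _ hdeg
  simp [Polynomial.IsRoot] at hx
  have e1 : ξ 1 = ξ 0 * (x + (ξ 1 / ξ 0 - x)) := by field_simp; ring
  have e2 : ξ 2 = ξ 0 * (x * (ξ 1 / ξ 0 - x)) := by
    field_simp; linear_combination hx
  refine ⟨x, ξ 1 / ξ 0 - x, fun h => hdisc ?_, e1, e2⟩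
  rw [← h] at e1 e2
  rw [e1, e2]
  ring

set_option maxHeartbeats 1000000 in
/-- The equations define the graph of `κ` over a nonempty open set of points: if `P² ≡ H` and
`G P ≡ M` modulo `F`, where `G` is the quadratic form of the divisor and `M` is a cubic, then
`M² - G² H` has degree at most six, so it is `c F`. Here `c ≠ 0`, since otherwise `P` is of degree
at most one. After scaling, `M` is the cubic that defines `κ`. -/
lemma mem_kappaGeneric_of_join [IsAlgClosed K] (hK : (2 : K) ≠ 0) {ξ : Fin 4 → K}
    (hξ : ξ ≠ 0) {p : Fin 6 → K} (hp : p ≠ 0) (h0 : ξ 0 ≠ 0)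
    (hdisc : ξ 1 ^ 2 - 4 * ξ 0 * ξ 2 ≠ 0)
    (hG : ∀ m, ξ 0 * S.root m ^ 2 - ξ 1 * S.root m + ξ 2 ≠ 0)
    (h1 : join (S.line (S.vec (S.ev p))) ξ = 0) (h2 : join (S.lineX (S.vec (S.ev p))) ξ = 0) :
    (Projectivization.mk K ξ hξ, Projectivization.mk K p hp) ∈ S.kappaGeneric := by
  obtain ⟨x, u, hxu, e1, e2⟩ := exists_roots h0 hdisc
  have hroot (m : Fin 6) : S.root m ≠ x ∧ S.root m ≠ u := by
    have := hG m
    have e : ξ 0 * S.root m ^ 2 - ξ 1 * S.root m + ξ 2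
        = ξ 0 * ((S.root m - x) * (S.root m - u)) := by rw [e1, e2]; ring
    rw [e] at this
    simpa [h0, sub_eq_zero] using this
  have hFx : S.F.eval x ≠ 0 := fun h => by
    obtain ⟨m, hm⟩ := S.exists_root_of_eval_F h
    exact (hroot m).1 hm.symm
  have hFu : S.F.eval u ≠ 0 := fun h => by
    obtain ⟨m, hm⟩ := S.exists_root_of_eval_F h
    exact (hroot m).2 hm.symm
  have hnull := isNull_of_join_eq_zero hK hξ h1 h2
  obtain ⟨q₀, q₁, q₂, hq⟩ := exists_quadratic_of_isNull hnull
  set H : Polynomial K := Polynomial.C q₂ * Polynomial.X ^ 2 + Polynomial.C q₁ * Polynomial.X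
    + Polynomial.C q₀ with hH
  have hHdeg : H.natDegree ≤ 2 := Polynomial.natDegree_quadratic_le
  set G : Polynomial K := (Polynomial.X - Polynomial.C x) * (Polynomial.X - Polynomial.C u)
    with hGdef
  have hGdeg : G.natDegree = 2 := by
    rw [hGdef, Polynomial.natDegree_mul (Polynomial.X_sub_C_ne_zero x)
      (Polynomial.X_sub_C_ne_zero u), Polynomial.natDegree_X_sub_C, Polynomial.natDegree_X_sub_C]
  -- the last coordinates of the two joins say that `G P` is congruent to a cubic
  obtain ⟨M, hM, hMev⟩ : ∃ M : Polynomial K, M.natDegree ≤ 3 ∧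
      ∀ m, M.eval (S.root m) = G.eval (S.root m) * S.ev p m := by
    obtain ⟨v0, v1⟩ := vec_mul_eq_zero h1 h2
    obtain ⟨m₀, m₁, m₂, m₃, hm⟩ := exists_cubic v0 v1
    refine ⟨Polynomial.C (ξ 0)⁻¹ * (Polynomial.C m₃ * Polynomial.X ^ 3
      + Polynomial.C m₂ * Polynomial.X ^ 2 + Polynomial.C m₁ * Polynomial.X + Polynomial.C m₀),
      (Polynomial.natDegree_C_mul_le _ _).trans Polynomial.natDegree_cubic_le, fun m => ?_⟩
    have := hm m
    simp only [Algebra.algebraMap_self, RingHom.id_apply, e1, e2] at this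
    simp [hGdef]
    field_simp
    linear_combination this
  obtain ⟨c, hc⟩ := S.exists_eq_C_mul_F (Q := M ^ 2 - G ^ 2 * H) (by
      refine (Polynomial.natDegree_sub_le _ _).trans (max_le ?_ ?_)
      · exact Polynomial.natDegree_pow_le.trans (by omega)
      · refine Polynomial.natDegree_mul_le.trans ?_
        have := Polynomial.natDegree_pow_le (p := G) (n := 2)
        omega) (fun m => by
      simp only [Polynomial.eval_sub, Polynomial.eval_pow, Polynomial.eval_mul, hMev, mul_pow, hq]
      simp [hH]
      ring)
  have hc0 : c ≠ 0 := by
    rintro rfl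
    rw [Polynomial.C_0, zero_mul, sub_eq_zero] at hc
    have hx0 : M.eval x = 0 := by
      have := congrArg (Polynomial.eval x) hc
      simpa [hGdef] using this
    have hu0 : M.eval u = 0 := by
      have := congrArg (Polynomial.eval u) hc
      simpa [hGdef] using this
    obtain ⟨L, hL⟩ : G ∣ M :=
      (Polynomial.isCoprime_X_sub_C_of_isUnit_sub (sub_ne_zero.2 hxu).isUnit).mul_dvd
        (Polynomial.dvd_iff_isRoot.2 hx0) (Polynomial.dvd_iff_isRoot.2 hu0)
    have hLdeg : L.natDegree ≤ 1 := by
      by_cases hL0 : L = 0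
      · simp [hL0]
      · have hG0 : G ≠ 0 := fun h => by simp [h] at hGdeg
        rw [hL, Polynomial.natDegree_mul hG0 hL0] at hM
        omega
    refine h0 (coord_zero_eq_zero_of_affine hK (S.ev_ne_zero hp) hξ h1 h2 (c := L.coeff 0)
      (d := L.coeff 1) fun m => ?_)
    have hGm : G.eval (S.root m) ≠ 0 := by
      simp [hGdef, sub_eq_zero, (hroot m).1, (hroot m).2]
    have := hMev m
    rw [hL, Polynomial.eval_mul] at this
    rw [← mul_left_cancel₀ hGm this, Polynomial.eq_X_add_C_of_natDegree_le_one hLdeg]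
    simp
    ring
  obtain ⟨e, he⟩ := IsAlgClosed.exists_pow_nat_eq c (n := 2) (by norm_num)
  have he0 : e ≠ 0 := fun h => hc0 (by rw [← he, h]; norm_num)
  have hp' : e⁻¹ • p ≠ 0 := smul_ne_zero (inv_ne_zero he0) hp
  have hM2 : (Polynomial.C e⁻¹ * M) ^ 2 - S.F = G ^ 2 * (Polynomial.C (e⁻¹ ^ 2) * H) := by
    have h1 : Polynomial.C (e⁻¹ ^ 2) * (Polynomial.C c * S.F) = S.F := by
      rw [← mul_assoc, ← Polynomial.C_mul, ← he]
      field_simp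
      simp
    conv_lhs => rw [← h1, ← hc]
    rw [map_pow]
    ring
  have hx2 : ((Polynomial.C e⁻¹ * M).eval x) ^ 2 = S.F.eval x := by
    have := congrArg (Polynomial.eval x) hM2
    simp [hGdef] at this
    simp
    linear_combination this
  have hu2 : ((Polynomial.C e⁻¹ * M).eval u) ^ 2 = S.F.eval u := by
    have := congrArg (Polynomial.eval u) hM2
    simp [hGdef] at this
    simp
    linear_combination this
  have hmem : (S.kummerPoint x ((Polynomial.C e⁻¹ * M).eval x) u ((Polynomial.C e⁻¹ * M).eval u),
      Projectivization.mk K p hp) ∈ S.kappaGeneric := by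
    refine ⟨x, _, u, _, hx2, hu2, fun h => hFx (by rw [← hx2, h]; norm_num),
      fun h => hFu (by rw [← hu2, h]; norm_num), hxu, _,
      (Polynomial.natDegree_C_mul_le _ _).trans hM, rfl, rfl, ⟨_, hM2⟩, e⁻¹ • p, hp', ?_, ?_⟩
    · refine S.F_dvd_iff.2 fun m => ?_
      have e1 : (toPoly (e⁻¹ • p)).eval (S.root m) = e⁻¹ * S.ev p m :=
        congrFun (S.ev_smul e⁻¹ p) m
      rw [Polynomial.eval_sub, Polynomial.eval_mul, e1, Polynomial.eval_C_mul, hMev]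
      ring
    · rw [Prod.mk.injEq]
      exact ⟨rfl, ((Projectivization.mk_eq_mk_iff' K _ _ _ _).2 ⟨e⁻¹, rfl⟩).symm⟩
  have hj := join_eq_zero_of_mem_kappaGeneric (S.kummerCoords_ne_zero _ _ _ _) hp hK hmem
  rw [IsNull.point_unique hK hnull (S.ev_ne_zero hp) hξ (S.kummerCoords_ne_zero _ _ _ _)
    h1 h2 hj.1 hj.2]
  exact hmem

/-- Over the general points a plane that contains the lines attached to `P` and `X P` is the tangent
plane. -/
lemma isTangentPlane_of_meet (hK : (2 : K) ≠ 0) {ξ : ℙ K (Fin 4 → K)} {p : Fin 6 → K} (hp : p ≠ 0)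
    (h : (ξ, Projectivization.mk K p hp) ∈ S.kappaGeneric) {η : Fin 4 → K} (hη : η ≠ 0)
    (h1 : meet (S.line (S.vec (S.ev p))) η = 0) (h2 : meet (S.lineX (S.vec (S.ev p))) η = 0) :
    S.IsTangentPlane (Projectivization.mk K η hη) ξ := by
  have h' := h
  obtain ⟨x, y, u, t, hy, ht, hy0, ht0, hxu, M, hM, hMx, hMu, hMF, q, hq, hdvd, e⟩ := h
  rw [Prod.mk.injEq] at e
  have hgrad : S.gradient (S.kummerCoords x y u t) ≠ 0 := fun h => by
    have := gradient_kummerCoords_three (S := S) hxu y t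
    have h4 : (4 : K) ≠ 0 := by
      have := mul_ne_zero hK hK
      norm_num at this
      exact this
    rw [h] at this
    simp [h4, hy0, ht0] at this
  have htan : S.IsTangentPlane (Projectivization.mk K _ hgrad) ξ :=
    ⟨_, S.kummerCoords_ne_zero _ _ _ _, _, hgrad, e.1, rfl, fun _ => rfl⟩
  obtain ⟨m1, m2⟩ := meet_eq_zero_of_isTangentPlane hgrad hp hK htan h'
  induction ξ using Projectivization.ind with | h ξ hξ
  obtain ⟨j1, j2⟩ := join_eq_zero_of_mem_kappaGeneric hξ hp hK h'
  rw [IsNull.plane_unique hK (isNull_of_join_eq_zero hK hξ j1 j2) (S.ev_ne_zero hp) hη hgrad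
    h1 h2 m1 m2]
  exact htan

/-! ### Arcs on the graphs -/

section Algebra

variable {R : Type*} [CommRing R] [Algebra K R]

variable (S) in
/-- The product of `ξ₁`, the discriminant and the values at the roots of the quadratic polynomial
`ξ₁ X² - ξ₂ X + ξ₃`. Where it does not vanish, the equations describe the graph of `κ`. -/
def nonDegenerate (ξ : Fin 4 → R) : R :=
  ξ 0 * (ξ 1 ^ 2 - 4 * ξ 0 * ξ 2) * ∏ m, (ξ 0 * algebraMap K R (S.root m) ^ 2
    - ξ 1 * algebraMap K R (S.root m) + ξ 2)

lemma map_nonDegenerate {R' : Type*} [CommRing R'] [Algebra K R'] (φ : R →ₐ[K] R')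
    (ξ : Fin 4 → R) : φ (S.nonDegenerate ξ) = S.nonDegenerate (fun i => φ (ξ i)) := by
  simp [nonDegenerate, map_prod, map_ofNat φ 4]

lemma exists_ne_zero_of_coeffs_ne_zero (φ : R →ₐ[K] K) {b : Fin 6 → R} {p : Fin 6 → K}
    (hp : p ≠ 0) (hbp : S.coeffs (fun i => φ (b i)) = p) : ∃ j, b j ≠ 0 := by
  by_contra! h
  refine hp ?_
  rw [← hbp, show (fun i => φ (b i)) = 0 from funext fun i => by simp [h i], coeffs_zero]

end Algebra

lemma mem_kappaGeneric_of_nonDegenerate [IsAlgClosed K] (hK : (2 : K) ≠ 0) {ξ : Fin 4 → K}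
    (hu : S.nonDegenerate ξ ≠ 0) {b : Fin 6 → K} (hb : b ≠ 0)
    (h1 : join (S.line b) ξ = 0) (h2 : join (S.lineX b) ξ = 0) :
    ∃ (hξ : ξ ≠ 0) (hp : S.coeffs b ≠ 0),
      (Projectivization.mk K ξ hξ, Projectivization.mk K _ hp) ∈ S.kappaGeneric := by
  simp only [nonDegenerate, ne_eq, mul_eq_zero, not_or, Finset.prod_eq_zero_iff, not_exists,
    Finset.mem_univ, true_and, Algebra.algebraMap_self, RingHom.id_apply] at hu
  obtain ⟨⟨hu0, hu1⟩, hu2⟩ := hu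
  have hp : S.coeffs b ≠ 0 := fun h => hb (S.coeffs_injective (h.trans S.coeffs_zero.symm))
  have hξ : ξ ≠ 0 := fun h => hu0 (by simp [h])
  exact ⟨hξ, hp, mem_kappaGeneric_of_join hK hξ hp hu0 hu1 hu2 (by rwa [vec_ev_coeffs])
    (by rwa [vec_ev_coeffs])⟩

lemma eval_eq_map {σ : Type*} (a : σ → K) {n : ℕ} (V : Fin n → MvPolynomial σ K) :
    (fun i => MvPolynomial.eval a (V i)) = fun i => MvPolynomial.aeval (R := K) a (V i) := rfl

section Arc

variable {R : Type*} [CommRing R] [IsDomain R] [Algebra K R]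

/-- A solution of the equations of the graph of `κ` over a domain `R`, such as the power series
ring, which is nondegenerate over `R` has all its specializations in the graph. -/
lemma mem_kappaGraph_of_arc [IsAlgClosed K] (hK : (2 : K) ≠ 0) (φ : R →ₐ[K] K)
    {ξ : Fin 4 → R} {b : Fin 6 → R} (h1 : join (S.line b) ξ = 0) (h2 : join (S.lineX b) ξ = 0)
    (hu : S.nonDegenerate ξ ≠ 0) {v : Fin 4 → K} (hv : v ≠ 0) (hξv : (fun i => φ (ξ i)) = v)
    {p : Fin 6 → K} (hp : p ≠ 0) (hbp : S.coeffs (fun i => φ (b i)) = p) :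
    (Projectivization.mk K v hv, Projectivization.mk K p hp) ∈ S.kappaGraph := by
  obtain ⟨j, hj⟩ := exists_ne_zero_of_coeffs_ne_zero φ hp hbp
  let Ξ : Fin 4 → MvPolynomial (Fin 4 ⊕ Fin 6) K := fun i => MvPolynomial.X (Sum.inl i)
  let B : Fin 6 → MvPolynomial (Fin 4 ⊕ Fin 6) K := fun i => MvPolynomial.X (Sum.inr i)
  have hΞ' : (fun i => MvPolynomial.aeval (R := K) (Sum.elim ξ b) (Ξ i)) = ξ := by simp [Ξ]
  have hB' : (fun i => MvPolynomial.aeval (R := K) (Sum.elim ξ b) (B i)) = b := by simp [B]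
  refine mem_zariskiClosureProd_of_specialize φ
    (Set.range (join (S.line B) Ξ) ∪ Set.range (join (S.lineX B) Ξ))
    (S.nonDegenerate Ξ * B j) Ξ (S.coeffs B) (fun a ha hua => ?_) (Sum.elim ξ b) ?_ ?_ hv ?_ hp ?_
  · rw [eval_eq_map, eval_eq_map, map_coeffs]
    have ha1 : join (S.line (fun i => MvPolynomial.aeval (R := K) a (B i)))
        (fun i => MvPolynomial.aeval (R := K) a (Ξ i)) = 0 := by
      rw [← map_join_line]
      exact funext fun i => ha _ (Or.inl ⟨i, rfl⟩)
    have ha2 : join (S.lineX (fun i => MvPolynomial.aeval (R := K) a (B i)))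
        (fun i => MvPolynomial.aeval (R := K) a (Ξ i)) = 0 := by
      rw [← map_join_lineX]
      exact funext fun i => ha _ (Or.inr ⟨i, rfl⟩)
    rw [map_mul] at hua
    refine mem_kappaGeneric_of_nonDegenerate hK ?_ ?_ ha1 ha2
    · rw [← map_nonDegenerate]
      exact left_ne_zero_of_mul hua
    · exact fun h => right_ne_zero_of_mul hua (congrFun h j)
  · rintro e (⟨i, rfl⟩ | ⟨i, rfl⟩)
    · have := S.map_join_line (MvPolynomial.aeval (Sum.elim ξ b)) B Ξ
      rw [hΞ', hB', h1] at this
      exact congrFun this i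
    · have := S.map_join_lineX (MvPolynomial.aeval (Sum.elim ξ b)) B Ξ
      rw [hΞ', hB', h2] at this
      exact congrFun this i
  · rw [map_mul, map_nonDegenerate, hΞ']
    exact mul_ne_zero hu (by simpa [B] using hj)
  · rw [← hξv]; simp [Ξ]
  · have := S.map_coeffs (MvPolynomial.aeval (Sum.elim ξ b)) B
    rw [hB'] at this
    rw [← hbp, ← map_coeffs, ← this]

/-- The analogue of `mem_kappaGraph_of_arc` for `κ*`. -/
lemma mem_kappaDualGraph_of_arc [IsAlgClosed K] (hK : (2 : K) ≠ 0) (φ : R →ₐ[K] K)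
    {ξ η : Fin 4 → R} {b : Fin 6 → R}
    (h1 : join (S.line b) ξ = 0) (h2 : join (S.lineX b) ξ = 0)
    (h3 : meet (S.line b) η = 0) (h4 : meet (S.lineX b) η = 0)
    (hu : S.nonDegenerate ξ ≠ 0) {v : Fin 4 → K} (hv : v ≠ 0) (hηv : (fun i => φ (η i)) = v)
    {p : Fin 6 → K} (hp : p ≠ 0) (hbp : S.coeffs (fun i => φ (b i)) = p) :
    (Projectivization.mk K v hv, Projectivization.mk K p hp) ∈ S.kappaDualGraph := by
  obtain ⟨j, hj⟩ := exists_ne_zero_of_coeffs_ne_zero φ hp hbp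
  obtain ⟨k, hk⟩ : ∃ k, η k ≠ 0 := by
    by_contra! h
    exact hv (by rw [← hηv]; ext i; simp [h])
  let Ξ : Fin 4 → MvPolynomial (Fin 4 ⊕ Fin 4 ⊕ Fin 6) K := fun i => MvPolynomial.X (Sum.inl i)
  let H : Fin 4 → MvPolynomial (Fin 4 ⊕ Fin 4 ⊕ Fin 6) K :=
    fun i => MvPolynomial.X (Sum.inr (Sum.inl i))
  let B : Fin 6 → MvPolynomial (Fin 4 ⊕ Fin 4 ⊕ Fin 6) K :=
    fun i => MvPolynomial.X (Sum.inr (Sum.inr i))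
  have hΞ' : (fun i => MvPolynomial.aeval (R := K) (Sum.elim ξ (Sum.elim η b)) (Ξ i)) = ξ := by
    simp [Ξ]
  have hH' : (fun i => MvPolynomial.aeval (R := K) (Sum.elim ξ (Sum.elim η b)) (H i)) = η := by
    simp [H]
  have hB' : (fun i => MvPolynomial.aeval (R := K) (Sum.elim ξ (Sum.elim η b)) (B i)) = b := by
    simp [B]
  refine mem_zariskiClosureProd_of_specialize φ
    (Set.range (join (S.line B) Ξ) ∪ Set.range (join (S.lineX B) Ξ) ∪
      (Set.range (meet (S.line B) H) ∪ Set.range (meet (S.lineX B) H)))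
    (S.nonDegenerate Ξ * B j * H k) H (S.coeffs B) (fun a ha hua => ?_)
    (Sum.elim ξ (Sum.elim η b)) ?_ ?_ hv ?_ hp ?_
  · rw [eval_eq_map, eval_eq_map, map_coeffs]
    have ha1 : join (S.line (fun i => MvPolynomial.aeval (R := K) a (B i)))
        (fun i => MvPolynomial.aeval (R := K) a (Ξ i)) = 0 := by
      rw [← map_join_line]
      exact funext fun i => ha _ (Or.inl (Or.inl ⟨i, rfl⟩))
    have ha2 : join (S.lineX (fun i => MvPolynomial.aeval (R := K) a (B i)))
        (fun i => MvPolynomial.aeval (R := K) a (Ξ i)) = 0 := by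
      rw [← map_join_lineX]
      exact funext fun i => ha _ (Or.inl (Or.inr ⟨i, rfl⟩))
    have ha3 : meet (S.line (fun i => MvPolynomial.aeval (R := K) a (B i)))
        (fun i => MvPolynomial.aeval (R := K) a (H i)) = 0 := by
      rw [← map_meet_line]
      exact funext fun i => ha _ (Or.inr (Or.inl ⟨i, rfl⟩))
    have ha4 : meet (S.lineX (fun i => MvPolynomial.aeval (R := K) a (B i)))
        (fun i => MvPolynomial.aeval (R := K) a (H i)) = 0 := by
      rw [← map_meet_lineX]
      exact funext fun i => ha _ (Or.inr (Or.inr ⟨i, rfl⟩))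
    rw [map_mul, map_mul] at hua
    have hη : (fun i => MvPolynomial.aeval (R := K) a (H i)) ≠ 0 :=
      fun h => right_ne_zero_of_mul hua (congrFun h k)
    have hua := left_ne_zero_of_mul hua
    obtain ⟨hξ, hp, hmem⟩ := mem_kappaGeneric_of_nonDegenerate hK (by
      rw [← map_nonDegenerate]
      exact left_ne_zero_of_mul hua) (fun h => right_ne_zero_of_mul hua (congrFun h j)) ha1 ha2
    exact ⟨hη, hp, _, isTangentPlane_of_meet hK hp hmem hη (by rwa [vec_ev_coeffs])
      (by rwa [vec_ev_coeffs]), hmem⟩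
  · rintro e ((⟨i, rfl⟩ | ⟨i, rfl⟩) | (⟨i, rfl⟩ | ⟨i, rfl⟩))
    · have := S.map_join_line (MvPolynomial.aeval (Sum.elim ξ (Sum.elim η b))) B Ξ
      rw [hΞ', hB', h1] at this
      exact congrFun this i
    · have := S.map_join_lineX (MvPolynomial.aeval (Sum.elim ξ (Sum.elim η b))) B Ξ
      rw [hΞ', hB', h2] at this
      exact congrFun this i
    · have := S.map_meet_line (MvPolynomial.aeval (Sum.elim ξ (Sum.elim η b))) B H
      rw [hH', hB', h3] at this
      exact congrFun this i
    · have := S.map_meet_lineX (MvPolynomial.aeval (Sum.elim ξ (Sum.elim η b))) B H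
      rw [hH', hB', h4] at this
      exact congrFun this i
  · rw [map_mul, map_mul, map_nonDegenerate, hΞ']
    exact mul_ne_zero (mul_ne_zero hu (by simpa [B] using hj)) (by simpa [H] using hk)
  · rw [← hηv]; simp [H]
  · have := S.map_coeffs (MvPolynomial.aeval (Sum.elim ξ (Sum.elim η b))) B
    rw [hB'] at this
    rw [← hbp, ← map_coeffs, ← this]

end Arc

/-! ### Lines as closures of general points -/

variable (S) in
/-- The point of `Δ_I` that is the image of `c + d X` under the sign changes in `I`. -/
def linePoint (I : Finset (Fin 6)) (c d : K) : Fin 6 → K :=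
  S.coeffs (S.vec fun m => signs I m * (c + d * S.root m))

lemma ev_linePoint (I : Finset (Fin 6)) (c d : K) :
    S.ev (S.linePoint I c d) = fun m => signs I m * (c + d * S.root m) := S.ev_coeffs_vec _

lemma linePoint_add_smul (I : Finset (Fin 6)) (c d c' d' τ : K) :
    S.linePoint I c d + τ • S.linePoint I c' d' = S.linePoint I (c + τ * c') (d + τ * d') := by
  apply S.ev_injective
  ext m
  have e (p q : Fin 6 → K) : S.ev (p + q) = S.ev p + S.ev q := by
    ext m; simp [ev, eval_toPoly, add_mul, Finset.sum_add_distrib]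
  rw [e, ev_smul, ev_linePoint, ev_linePoint, ev_linePoint]
  simp
  ring

lemma smul_linePoint (I : Finset (Fin 6)) (c d τ : K) :
    τ • S.linePoint I c d = S.linePoint I (τ * c) (τ * d) := by
  apply S.ev_injective
  ext m
  rw [ev_smul, ev_linePoint, ev_linePoint]
  simp
  ring

lemma linePoint_ne_zero {I : Finset (Fin 6)} {c d : K} (h : c ≠ 0 ∨ d ≠ 0) :
    S.linePoint I c d ≠ 0 := by
  intro h0
  have e (m : Fin 6) : c + d * S.root m = 0 := by
    have := congrFun (S.ev_linePoint I c d) m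
    rw [h0] at this
    have h1 : S.ev 0 m = 0 := by simp [ev, eval_toPoly]
    rw [h1] at this
    linear_combination (-signs I m) * this - (c + d * S.root m) * signs_mul_self (R := K) I m
  obtain ⟨hc, hd⟩ := S.eq_zero_of_affine (T := Finset.univ) (by simp) fun m _ => e m
  exact h.elim (fun h => h hc) (fun h => h hd)

lemma finite_setOf_affine_eq_zero {a b : K} (h : a ≠ 0 ∨ b ≠ 0) :
    {τ : K | a + τ * b = 0}.Finite := by
  refine Set.Subsingleton.finite fun τ hτ τ' hτ' => ?_
  simp only [Set.mem_ofPred_eq] at hτ hτ'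
  have hb : b ≠ 0 := by
    rintro rfl
    simp at hτ
    simp [hτ] at h
  apply mul_right_cancel₀ hb
  linear_combination hτ - hτ'

/-- A closed property `Q` that holds at the points of `Δ_I` given by `X - z` for almost all `z`
holds on all of `Δ_I`. Closedness enters through its consequence `hQ` for points on a line. -/
lemma forall_mem_lineSign {Q : ℙ K (Fin 6 → K) → Prop}
    (hQ : ∀ (p q : Fin 6 → K) (hp : p ≠ 0) (B : Set K), B.Finite →
      (∀ τ ∉ B, ∃ hτ : p + τ • q ≠ 0, Q (Projectivization.mk K _ hτ)) →
      Q (Projectivization.mk K p hp))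
    {I : Finset (Fin 6)} {Z : Set K} (hZ : Z.Finite)
    (h : ∀ z ∉ Z, ∀ hp : S.linePoint I (-z) 1 ≠ 0, Q (Projectivization.mk K _ hp)) :
    ∀ a ∈ S.lineSign I, Q a := by
  rintro a ⟨p, hp, rfl, c, d, hcd⟩
  have hp' : p = S.linePoint I c d := S.ev_injective (by rw [ev_linePoint]; exact funext hcd)
  subst hp'
  have hcd0 : c ≠ 0 ∨ d ≠ 0 := by
    by_contra! h0
    refine S.ev_ne_zero hp ?_
    ext m
    rw [hcd, h0.1, h0.2]
    simp
  -- a second point of the line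
  obtain ⟨c', d', hdet⟩ : ∃ c' d', c * d' - c' * d ≠ 0 := by
    rcases hcd0 with hc | hd
    · exact ⟨0, 1, by simpa using hc⟩
    · exact ⟨1, 0, by simpa using hd⟩
  refine hQ _ (S.linePoint I c' d') hp ({τ | d + τ * d' = 0} ∪
    ⋃ z ∈ Z, {τ | (c + z * d) + τ * (c' + z * d') = 0}) (Set.Finite.union ?_ (hZ.biUnion
      fun z _ => ?_)) fun τ hτ => ?_
  · apply finite_setOf_affine_eq_zero
    by_contra! h0
    simp [h0.1, h0.2] at hdet
  · apply finite_setOf_affine_eq_zero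
    by_contra! h0
    apply hdet
    linear_combination d' * h0.1 - d * h0.2
  · simp only [Set.mem_union, Set.mem_ofPred_eq, Set.mem_iUnion, not_or, not_exists] at hτ
    obtain ⟨h1, h2⟩ := hτ
    have hz : -((c + τ * c') / (d + τ * d')) ∉ Z := fun hz => h2 _ hz (by
      field_simp
      ring)
    have e : S.linePoint I c d + τ • S.linePoint I c' d'
        = (d + τ * d') • S.linePoint I (-(-((c + τ * c') / (d + τ * d')))) 1 := by
      rw [linePoint_add_smul, smul_linePoint]
      congr 1 <;> field_simp
    have hne : S.linePoint I (-(-((c + τ * c') / (d + τ * d')))) 1 ≠ 0 :=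
      linePoint_ne_zero (Or.inr one_ne_zero)
    have hτ0 : S.linePoint I c d + τ • S.linePoint I c' d' ≠ 0 := by
      rw [e]; exact smul_ne_zero h1 hne
    refine ⟨hτ0, ?_⟩
    have := h _ hz hne
    rwa [← (Projectivization.mk_eq_mk_iff' K _ _ hτ0 hne).2 ⟨_, e.symm⟩] at this

lemma forall_mem_lineSign_prod [Infinite K] {A : Set (ℙ K (Fin 4 → K) × ℙ K (Fin 6 → K))}
    {ξ : ℙ K (Fin 4 → K)} {I : Finset (Fin 6)} {Z : Set K} (hZ : Z.Finite)
    (h : ∀ z ∉ Z, ∀ hp : S.linePoint I (-z) 1 ≠ 0,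
      (ξ, Projectivization.mk K _ hp) ∈ zariskiClosureProd A) :
    ∀ a ∈ S.lineSign I, (ξ, a) ∈ zariskiClosureProd A :=
  forall_mem_lineSign (Q := fun a => (ξ, a) ∈ zariskiClosureProd A)
    (fun _ _ hp _ hB h => zariskiClosureProd_line hp hB h) hZ h

/-! ### The node `N₀` -/

/-- The constant coefficient of power series, as a homomorphism of `K`-algebras. -/
def specialize (K : Type*) [Field K] : PowerSeries K →ₐ[K] K :=
  { PowerSeries.constantCoeff (R := K) with
    commutes' := fun r => by simp }

@[simp] lemma specialize_apply (a : PowerSeries K) :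
    specialize K a = PowerSeries.constantCoeff a := rfl

lemma linePoint_empty (c d : K) : S.linePoint ∅ c d = ![c, d, 0, 0, 0, 0] := by
  apply S.ev_injective
  rw [ev_linePoint]
  ext m
  simp [ev, eval_toPoly, Fin.sum_univ_six, signs]

lemma exists_isGenericMoments {R : Type*} [CommRing R] [Algebra K R] {x u y v : R}
    (hy : y ^ 2 = Polynomial.aeval x S.F) (hv : v ^ 2 = Polynomial.aeval u S.F) :
    ∃ b, S.IsGenericMoments x u y v b := by
  have h6 : algebraMap K R (S.f 6) * algebraMap K R (S.f 6)⁻¹ = 1 := by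
    rw [← map_mul, mul_inv_cancel₀ S.f_six_ne_zero, map_one]
  obtain ⟨b₄, h4⟩ : ∃ b₄, algebraMap K R (S.f 6) * b₄ =
      algebraMap K R (S.f 6) * (2 * (x - u) ^ 2 * (y * u ^ 4 - v * x ^ 4)) +
      (Polynomial.aeval x S.F.derivative * (x - u) * v - 4 * v * y ^ 2
        + (Polynomial.aeval u S.F.derivative * (x - u) * y + 4 * v ^ 2 * y)) :=
    ⟨_, by rw [← mul_assoc (algebraMap K R (S.f 6)) (algebraMap K R (S.f 6)⁻¹), h6, one_mul]⟩
  obtain ⟨b₅, h5⟩ : ∃ b₅, algebraMap K R (S.f 6) * b₅ =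
      (algebraMap K R (S.f 6) * (2 * (x - u) ^ 2 * (y * u ^ 5 - v * x ^ 5)) +
    algebraMap K R (S.f 5) * (2 * (x - u) ^ 2 * (y * u ^ 4 - v * x ^ 4)) +
      2 * v * (x - u) * y ^ 2 + 2 * v ^ 2 * (x - u) * y
      - u * (Polynomial.aeval x S.F.derivative * (x - u) * v - 4 * v * y ^ 2)
      - x * (Polynomial.aeval u S.F.derivative * (x - u) * y + 4 * v ^ 2 * y))
      - algebraMap K R (S.f 5) * b₄ :=
    ⟨_, by rw [← mul_assoc (algebraMap K R (S.f 6)) (algebraMap K R (S.f 6)⁻¹), h6, one_mul]⟩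
  refine ⟨![2 * (x - u) ^ 2 * (y - v), 2 * (x - u) ^ 2 * (y * u - v * x),
    2 * (x - u) ^ 2 * (y * u ^ 2 - v * x ^ 2), 2 * (x - u) ^ 2 * (y * u ^ 3 - v * x ^ 3), b₄, b₅],
    hy, hv, fun j hj => ?_, h4, ?_⟩
  · fin_cases j <;> simp at hj ⊢
  · simp [h5]

open PowerSeries in
/-- The divisors `(x, y) + (x + t, v)` with `v = -y + ⋯` tend to a canonical divisor, and their
points on `𝒦` to `N₀`. The limit of `κ` along this arc is the class of `X - x`. -/
lemma mem_kappaGraph_nodeZero [IsAlgClosed K] (hK : (2 : K) ≠ 0) {x : K} (hx : S.F.eval x ≠ 0)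
    (hp : S.linePoint ∅ (-x) 1 ≠ 0) :
    (nodeZero, Projectivization.mk K _ hp) ∈ S.kappaGraph := by
  obtain ⟨y, hy⟩ := IsAlgClosed.exists_pow_nat_eq (S.F.eval x) (n := 2) (by norm_num)
  have hy0 : y ≠ 0 := fun h => hx (by rw [← hy, h]; norm_num)
  have h4 : (4 : K) ≠ 0 := by
    have := mul_ne_zero hK hK
    norm_num at this
    exact this
  -- the second point of the divisor tends to the conjugate of the first one
  let u : PowerSeries K := C x + X
  have hφu : specialize K u = x := by simp [u]
  obtain ⟨w, hw, hw0⟩ := exists_powerSeries_sq hK (Polynomial.aeval u S.F) (-y) (neg_ne_zero.2 hy0)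
    (by
      rw [← specialize_apply, ← Polynomial.aeval_algHom_apply, hφu, neg_sq, hy]
      simp)
  obtain ⟨b, hb⟩ := S.exists_isGenericMoments (x := algebraMap K (PowerSeries K) x) (u := u)
    (y := algebraMap K (PowerSeries K) y) (v := w)
    (by rw [← map_pow, hy, Polynomial.aeval_algebraMap_apply]; simp) hw
  have hxu : algebraMap K (PowerSeries K) x - u = -X := by simp [u]
  have hX : (X : PowerSeries K) ≠ 0 := X_ne_zero
  have hroot (m : Fin 6) : x ≠ S.root m := fun h => hx (by rw [h, eval_F_root])
  have hu : S.nonDegenerate (S.scaledCoords (algebraMap K (PowerSeries K) x) u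
      (algebraMap K (PowerSeries K) y) w) ≠ 0 := by
    have e : S.nonDegenerate (S.scaledCoords (algebraMap K (PowerSeries K) x) u
      (algebraMap K (PowerSeries K) y) w) = (algebraMap K (PowerSeries K) x - u) ^ 8 *
        ∏ m, ((algebraMap K (PowerSeries K) x - u) ^ 2 *
          ((algebraMap K (PowerSeries K) (S.root m) - algebraMap K (PowerSeries K) x)
          * (algebraMap K (PowerSeries K) (S.root m) - u))) := by
      rw [nonDegenerate]
      congr 1
      · simp [scaledCoords]; ring
      · refine Finset.prod_congr rfl fun m _ => ?_
        simp [scaledCoords]; ring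
    rw [e, hxu]
    refine mul_ne_zero (pow_ne_zero _ (neg_ne_zero.2 hX)) (Finset.prod_ne_zero_iff.2 fun m _ =>
      mul_ne_zero (pow_ne_zero _ (neg_ne_zero.2 hX)) (mul_ne_zero ?_ ?_))
    · intro h
      have := congrArg (specialize K) h
      simp [sub_eq_zero] at this
      exact hroot m this.symm
    · intro h
      have := congrArg (specialize K) h
      rw [map_sub, hφu] at this
      simp [sub_eq_zero] at this
      exact hroot m this.symm
  have hφ0 : specialize K (algebraMap K (PowerSeries K) x - u) = 0 := by rw [hxu]; simp
  have hφx : specialize K (algebraMap K (PowerSeries K) x) = x := AlgHom.commutes _ _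
  have hφy : specialize K (algebraMap K (PowerSeries K) y) = y := AlgHom.commutes _ _
  have hφw : specialize K w = -y := hw0
  have hv : (fun i => specialize K (S.scaledCoords (algebraMap K (PowerSeries K) x) u
      (algebraMap K (PowerSeries K) y) w i)) = (4 * y ^ 2) • ![0, 0, 0, 1] := by
    rw [eval_F] at hy
    ext i
    fin_cases i <;> simp only [scaledCoords, map_mul, map_pow, map_sub, map_add, hφ0, hφu, hφx,
      hφy, hφw, AlgHom.commutes, map_ofNat, Fin.zero_eta, Fin.mk_one, Fin.reduceFinMk,
      Matrix.cons_val, Matrix.cons_val_zero, Matrix.cons_val_one] <;> simp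
    linear_combination (-2) * hy
  have klow (j : Fin 6) (hj : (j : ℕ) ≤ 3) : specialize K (b j) = 0 := by
    rw [hb.low j hj, map_mul, map_mul, map_pow, hφ0]
    simp
  have k4 := congrArg (specialize K) hb.four
  have k5 := congrArg (specialize K) hb.five
  simp only [map_mul, map_pow, map_sub, map_add, hφ0, hφu, hφx, hφy, hφw, AlgHom.commutes,
    map_ofNat] at k4 k5
  have hbp : S.coeffs (fun i => specialize K (b i)) = (8 * y ^ 3) • S.linePoint ∅ (-x) 1 := by
    rw [linePoint_empty]
    have k0 := klow 0 (by decide)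
    have k1 := klow 1 (by decide)
    have k2 := klow 2 (by decide)
    have k3 := klow 3 (by decide)
    ext i
    fin_cases i <;> simp only [coeffs, k0, k1, k2, k3] <;>
      simp [-specialize_apply]
    · linear_combination k5
    · linear_combination k4
  have hv0 : (4 * y ^ 2) • ![0, 0, 0, 1] ≠ (0 : Fin 4 → K) :=
    smul_ne_zero (mul_ne_zero h4 (pow_ne_zero 2 hy0)) S.isNodeCoords_nodeZero.ne_zero
  have hp0 : (8 * y ^ 3) • S.linePoint ∅ (-x) 1 ≠ 0 := by
    refine smul_ne_zero (mul_ne_zero ?_ (pow_ne_zero 3 hy0)) hp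
    have := mul_ne_zero hK h4
    norm_num at this
    exact this
  have := mem_kappaGraph_of_arc hK (specialize K) hb.join_line hb.join_lineX hu hv0 hv hp0 hbp
  rwa [(Projectivization.mk_eq_mk_iff' K _ _ hv0 S.isNodeCoords_nodeZero.ne_zero).2 ⟨_, rfl⟩,
    (Projectivization.mk_eq_mk_iff' K _ _ hp0 hp).2 ⟨_, rfl⟩] at this

lemma lineZero_subset_blowUp [IsAlgClosed K] (hK : (2 : K) ≠ 0) :
    S.lineSign ∅ ⊆ S.blowUp S.kappaGraph nodeZero := by
  intro a ha
  refine ⟨S.lineSign_subset_desing _ ha, ?_⟩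
  refine forall_mem_lineSign_prod (Z := Set.range S.root) (Set.finite_range _) (fun x hx hp => ?_)
    a ha
  refine mem_kappaGraph_nodeZero hK (fun h => hx ?_) hp
  obtain ⟨m, hm⟩ := S.exists_root_of_eval_F h
  exact ⟨m, hm.symm⟩

/-! ### Arcs through the lines -/

/-- If `θ_m` is a root of the quadratic form `G` of the divisor, the congruences `P² ≡ H`, `G P ≡ M`
at the five other roots give `A² = (G / (X - θ_m))² H` with `A = M / (X - θ_m)`, an equality of
polynomials because both sides have degree at most four. -/
lemma exists_sq_eq_of_root {R : Type*} [CommRing R] [IsDomain R] [Algebra K R] {π : Fin 6 → R}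
    {ξ : Fin 4 → R} (h1 : join (S.line (S.vec π)) ξ = 0) (h2 : join (S.lineX (S.vec π)) ξ = 0)
    {h₀ h₁ h₂ : R} (hπ : ∀ n, π n ^ 2 = h₀ + h₁ * algebraMap K R (S.root n)
      + h₂ * algebraMap K R (S.root n) ^ 2) {m : Fin 6}
    (hm : ξ 0 * algebraMap K R (S.root m) ^ 2 - ξ 1 * algebraMap K R (S.root m) + ξ 2 = 0)
    (w : R) : ∃ a : R, a ^ 2 = (ξ 0 * w + (ξ 0 * algebraMap K R (S.root m) - ξ 1)) ^ 2
      * (h₀ + h₁ * w + h₂ * w ^ 2) := by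
  obtain ⟨v0, v1⟩ := vec_mul_eq_zero h1 h2
  obtain ⟨m₀, m₁, m₂, m₃, hM⟩ := exists_cubic v0 v1
  set t := algebraMap K R (S.root m) with ht
  have hinj : Function.Injective (fun n => algebraMap K R (S.root n)) :=
    (algebraMap K R).injective.comp S.root_injective
  have hMm : m₀ + m₁ * t + m₂ * t ^ 2 + m₃ * t ^ 3 = 0 := by
    rw [hM m, ← ht, hm, zero_mul]
  -- divide the cubic and the quadratic form by `X - θ_m`
  let A : Polynomial R := Polynomial.C m₃ * Polynomial.X ^ 2
    + Polynomial.C (m₂ + m₃ * t) * Polynomial.X + Polynomial.C (m₁ + m₂ * t + m₃ * t ^ 2)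
  let G : Polynomial R := Polynomial.C (ξ 0) * Polynomial.X + Polynomial.C (ξ 0 * t - ξ 1)
  let H : Polynomial R := Polynomial.C h₂ * Polynomial.X ^ 2 + Polynomial.C h₁ * Polynomial.X
    + Polynomial.C h₀
  have hz : A ^ 2 - G ^ 2 * H = 0 := by
    refine Polynomial.eq_zero_of_natDegree_lt_card_of_eval_eq_zero (ι := {n // n ≠ m}) _
      (f := fun n => algebraMap K R (S.root n)) (hinj.comp Subtype.val_injective) ?_ ?_
    · rintro ⟨n, hn⟩
      have hne : algebraMap K R (S.root n) - t ≠ 0 := sub_ne_zero.2 (hinj.ne hn)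
      have hAn : A.eval (algebraMap K R (S.root n)) = G.eval (algebraMap K R (S.root n)) * π n := by
        apply mul_left_cancel₀ hne
        simp only [A, G, Polynomial.eval_add, Polynomial.eval_mul, Polynomial.eval_pow,
          Polynomial.eval_C, Polynomial.eval_X]
        linear_combination hM n - hMm + π n * hm
      rw [Polynomial.eval_sub, Polynomial.eval_mul, Polynomial.eval_pow, Polynomial.eval_pow,
        hAn, mul_pow, hπ n]
      simp [H]
      ring
    · have hA : A.natDegree ≤ 2 := Polynomial.natDegree_quadratic_le
      have hG : G.natDegree ≤ 1 := Polynomial.natDegree_linear_le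
      have hH : H.natDegree ≤ 2 := Polynomial.natDegree_quadratic_le
      have h5 : Fintype.card {n // n ≠ m} = 5 := by simp
      rw [h5, Nat.lt_succ_iff]
      refine (Polynomial.natDegree_sub_le _ _).trans (max_le ?_ ?_)
      · exact Polynomial.natDegree_pow_le.trans (by omega)
      · refine Polynomial.natDegree_mul_le.trans ?_
        have := Polynomial.natDegree_pow_le (p := G) (n := 2)
        omega
  refine ⟨A.eval w, ?_⟩
  have := congrArg (Polynomial.eval w) hz
  simp [H, G] at this
  linear_combination this

open PowerSeries in
/-- For the arc with `H = (X - z)² + t` the equality of `exists_sq_eq_of_root` is impossible: at `z`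
and at `z + t` the series `H` has the odd order one, so that `G / (X - θ_m)`, which has degree at
most one, vanishes at both points. -/
lemma quadratic_ne_zero_of_arc {z : K} {π : Fin 6 → PowerSeries K}
    (hπ : ∀ n, π n ^ 2 = (C (S.root n - z)) ^ 2 + X) {ξ : Fin 4 → PowerSeries K}
    (h1 : join (S.line (S.vec π)) ξ = 0) (h2 : join (S.lineX (S.vec π)) ξ = 0) (h0 : ξ 0 ≠ 0)
    (m : Fin 6) : ξ 0 * algebraMap K (PowerSeries K) (S.root m) ^ 2
      - ξ 1 * algebraMap K (PowerSeries K) (S.root m) + ξ 2 ≠ 0 := by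
  intro hm
  have key := exists_sq_eq_of_root h1 h2 (h₀ := C z ^ 2 + X) (h₁ := -2 * C z) (h₂ := 1)
    (fun n => by rw [hπ, map_sub]; simp; ring) hm
  obtain ⟨a, ha⟩ := key (C z)
  obtain ⟨a', ha'⟩ := key (C z + X)
  have e1 : ξ 0 * C z + (ξ 0 * algebraMap K (PowerSeries K) (S.root m) - ξ 1) = 0 :=
    eq_zero_of_sq_eq_sq_mul_X (w := 1) (by simp) (ha.trans (by ring))
  have e2 : ξ 0 * (C z + X) + (ξ 0 * algebraMap K (PowerSeries K) (S.root m) - ξ 1) = 0 :=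
    eq_zero_of_sq_eq_sq_mul_X (w := 1 + X) (by simp) (ha'.trans (by ring))
  have : ξ 0 * X = 0 := by linear_combination e2 - e1
  exact h0 ((mul_eq_zero.1 this).resolve_right X_ne_zero)

/-- For almost all points of `Δ_I` the common point `ξ` of the two lines is nondegenerate as far as
`ξ₁` and the discriminant are concerned, provided that this holds at one point `z₀`. By assumption
that point also lies on `Δ_{ab}`, and so `ξ` is there the node `N_{ab}`. -/
lemma exists_generic_point (hK : (2 : K) ≠ 0) {I : Finset (Fin 6)} {a b : Fin 6} (hab : a ≠ b)
    {z₀ : K} {c₀ d₀ : K} (h : ∀ m, signs I m * (-z₀ + 1 * S.root m)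
      = signs {a, b} m * (c₀ + d₀ * S.root m)) :
    ∃ (c : Fin 4 → K) (Z : Set K), Z.Finite ∧ ∀ z ∉ Z,
      let b := S.vec fun m => signs I m * (-z + 1 * S.root m)
      let ξ := meet (S.line b) (join (S.lineX b) c)
      ξ 0 ≠ 0 ∧ ξ 1 ^ 2 - 4 * ξ 0 * ξ 2 ≠ 0 := by
  set π : Fin 6 → K := fun m => signs I m * (-z₀ + 1 * S.root m) with hπ
  have hnull : S.IsNull π := S.isNull_affine I (-z₀) 1
  have hπ0 : π ≠ 0 := by
    intro h0
    refine linePoint_ne_zero (S := S) (I := I) (c := -z₀) (d := 1) (Or.inr one_ne_zero) ?_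
    apply S.ev_injective
    rw [ev_linePoint, ← hπ, h0]
    ext m
    simp [ev, eval_toPoly]
  obtain ⟨c, hc⟩ := hnull.exists_point hK hπ0
  obtain ⟨hj1, hj2⟩ := hnull.join_meet_join hK c
  have hl := (S.lowMoments_and_mulRoot_iff {a, b} π).2 ⟨c₀, d₀, h⟩
  have hN := S.isNodeCoords_node hab
  rw [← hN.join_eq_zero_iff, ← hN.join_eq_zero_iff, ← lineX_vec] at hl
  obtain ⟨s, hs⟩ := (Projectivization.mk_eq_mk_iff' K _ _ _ _).1
    (IsNull.point_unique hK hnull hπ0 hc hN.ne_zero hj1 hj2 hl.1 hl.2)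
  have hs0 : s ≠ 0 := by
    rintro rfl
    rw [zero_smul] at hs
    exact hc hs.symm
  let B : Fin 6 → Polynomial K :=
    S.vec fun m => signs I m * (-Polynomial.X + 1 * algebraMap K _ (S.root m))
  let Ξ := meet (S.line B) (join (S.lineX B) (fun i => algebraMap K (Polynomial K) (c i)))
  have hΞ (z : K) : (fun i => Polynomial.aeval z (Ξ i))
      = meet (S.line (S.vec fun m => signs I m * (-z + 1 * S.root m)))
        (join (S.lineX (S.vec fun m => signs I m * (-z + 1 * S.root m))) c) := by
    have hB : (fun i => Polynomial.aeval z (B i))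
        = S.vec fun m => signs I m * (-z + 1 * S.root m) := by
      rw [map_vec]
      congr 1
      ext m
      by_cases hm : m ∈ I <;> simp [signs, hm]
    rw [map_meet_line, map_join_lineX, hB]
    congr 2
    ext i
    simp
  let D : Polynomial K := Ξ 0 * (Ξ 1 ^ 2 - 4 * Ξ 0 * Ξ 2)
  have hD (z : K) : D.eval z = Polynomial.aeval z (Ξ 0) * (Polynomial.aeval z (Ξ 1) ^ 2
      - 4 * Polynomial.aeval z (Ξ 0) * Polynomial.aeval z (Ξ 2)) := by
    simp [D]
  have hD0 : D ≠ 0 := by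
    intro h0
    have := hD z₀
    have e (i) : Polynomial.aeval z₀ (Ξ i) = s * S.kummerCoords (S.root a) 0 (S.root b) 0 i :=
      (congrFun (hΞ z₀) i).trans (congrFun hs i).symm
    rw [h0, e, e, e] at this
    simp [kummerCoords, hs0] at this
    have h2 : s ^ 2 * (S.root a - S.root b) ^ 2 = 0 := by linear_combination this
    simp [hs0, sub_eq_zero, S.root_injective.eq_iff, hab] at h2
  refine ⟨c, {z | D.IsRoot z}, Polynomial.finite_setOfPred_isRoot hD0, fun z hz => ?_⟩
  have hz' : D.eval z ≠ 0 := hz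
  rw [hD] at hz'
  have e (i) := congrFun (hΞ z) i
  rw [e, e, e] at hz'
  exact ⟨left_ne_zero_of_mul hz', right_ne_zero_of_mul hz'⟩

lemma signs_linear_ne_zero (I : Finset (Fin 6)) (z : K) :
    (fun m => signs I m * (-z + 1 * S.root m) : Fin 6 → K) ≠ 0 := by
  intro h
  apply linePoint_ne_zero (S := S) (I := I) (c := -z) (d := 1) (Or.inr one_ne_zero)
  apply S.ev_injective
  rw [ev_linePoint, h]
  ext m
  simp [ev, eval_toPoly]

open PowerSeries in
/-- The arc `π_m = ± √((θ_m - z)² + t)` on `𝒮` through a point of `Δ_I`, where the signs are those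
of `I`. -/
lemma exists_arc [IsAlgClosed K] (hK : (2 : K) ≠ 0) (I : Finset (Fin 6)) {z : K}
    (hz : ∀ m, z ≠ S.root m) :
    ∃ π : Fin 6 → PowerSeries K, (∀ n, π n ^ 2 = (C (S.root n - z)) ^ 2 + X) ∧
      (fun m => specialize K (π m)) = fun m => signs I m * (-z + 1 * S.root m) := by
  have h (m : Fin 6) : ∃ g : PowerSeries K, g ^ 2 = (C (S.root m - z)) ^ 2 + X ∧
      constantCoeff g = S.root m - z :=
    exists_powerSeries_sq hK _ _ (sub_ne_zero.2 (hz m).symm) (by simp)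
  choose g hg hg0 using h
  refine ⟨fun m => signs I m * g m, fun n => ?_, ?_⟩
  · rw [mul_pow, pow_two (signs I n), signs_mul_self, one_mul, hg]
  · ext m
    have : specialize K (signs I m) = signs I m := by
      by_cases hm : m ∈ I <;> simp [signs, hm]
    rw [map_mul, this, specialize_apply, hg0]
    ring

/-- The arc of `exists_arc`, together with the common points and common planes of its pairs of
lines, shows that a general point of `Δ_I` is paired with its common point and plane in the two
graphs. -/
lemma mem_graphs_of_generic_point [IsAlgClosed K] (hK : (2 : K) ≠ 0) (I : Finset (Fin 6)) {z : K}
    (hz : ∀ m, z ≠ S.root m) {c : Fin 4 → K} {b : Fin 6 → K}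
    (hb : b = S.vec fun m => signs I m * (-z + 1 * S.root m)) {ξ : Fin 4 → K}
    (hξ : ξ = meet (S.line b) (join (S.lineX b) c)) (h0 : ξ 0 ≠ 0)
    (hdisc : ξ 1 ^ 2 - 4 * ξ 0 * ξ 2 ≠ 0) (hξ0 : ξ ≠ 0) (hp : S.linePoint I (-z) 1 ≠ 0) :
    (Projectivization.mk K ξ hξ0, Projectivization.mk K _ hp) ∈ S.kappaGraph ∧
    ∀ (c' : Fin 4 → K) (hη : join (S.line b) (meet (S.lineX b) c') ≠ 0),
      (Projectivization.mk K _ hη, Projectivization.mk K _ hp) ∈ S.kappaDualGraph := by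
  obtain ⟨π, hπ, hπ0⟩ := S.exists_arc hK I hz
  have hnull : S.IsNull π := S.isNull_of_sq_eq (PowerSeries.C z ^ 2 + PowerSeries.X)
    (-2 * PowerSeries.C z) 1 fun m => by rw [hπ, map_sub]; simp; ring
  have hvec : (fun i => specialize K (S.vec π i)) = b := by rw [map_vec, hπ0, hb]
  have hconst (c : Fin 4 → K) :
      (fun i => specialize K (algebraMap K (PowerSeries K) (c i))) = c := by
    ext i; exact AlgHom.commutes _ _
  let Ξ := meet (S.line (S.vec π)) (join (S.lineX (S.vec π))
    (fun i => algebraMap K (PowerSeries K) (c i)))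
  have hΞ : (fun i => specialize K (Ξ i)) = ξ := by
    rw [map_meet_line, map_join_lineX, hvec, hconst, hξ]
  obtain ⟨j1, j2⟩ := hnull.join_meet_join hK (fun i => algebraMap K (PowerSeries K) (c i))
  have e (i) : specialize K (Ξ i) = ξ i := congrFun hΞ i
  have hΞ0 : Ξ 0 ≠ 0 := fun h => h0 (by rw [← e, h, map_zero])
  have hu : S.nonDegenerate Ξ ≠ 0 := by
    refine mul_ne_zero (mul_ne_zero hΞ0 fun h => hdisc ?_) (Finset.prod_ne_zero_iff.2 fun m _ =>
      quadratic_ne_zero_of_arc hπ j1 j2 hΞ0 m)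
    have := congrArg (specialize K) h
    rwa [map_sub, map_mul, map_mul, map_pow, map_ofNat, e, e, e, map_zero] at this
  have hbp : S.coeffs (fun i => specialize K (S.vec π i)) = S.linePoint I (-z) 1 := by
    rw [hvec, hb, linePoint]
  refine ⟨mem_kappaGraph_of_arc hK (specialize K) j1 j2 hu hξ0 hΞ hp hbp, fun c' hη => ?_⟩
  obtain ⟨k1, k2⟩ := hnull.meet_join_meet hK (fun i => algebraMap K (PowerSeries K) (c' i))
  refine mem_kappaDualGraph_of_arc hK (specialize K) j1 j2 k1 k2 hu hη ?_ hp hbp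
  rw [map_join_line, map_meet_lineX, hvec, hconst]

lemma linePoint_mem_lineSign (I : Finset (Fin 6)) {c d : K} (hp : S.linePoint I c d ≠ 0) :
    Projectivization.mk K _ hp ∈ S.lineSign I :=
  (mk_mem_lineSign hp).2 ⟨c, d, fun m => congrFun (ev_linePoint I c d) m⟩

/-- Almost all points of `Δ_I` are paired in the graph of `κ` with the common point of their two
lines, and in the graph of `κ*` with the trope of `I`, if there is one. -/
lemma exists_generic_points [IsAlgClosed K] (hK : (2 : K) ≠ 0) {I : Finset (Fin 6)} {a b : Fin 6}
    (hab : a ≠ b) {z₀ c₀ d₀ : K} (h : ∀ m, signs I m * (-z₀ + 1 * S.root m)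
      = signs {a, b} m * (c₀ + d₀ * S.root m)) :
    ∃ Z : Set K, Z.Finite ∧ (∀ z ∉ Z, ∀ m, z ≠ S.root m) ∧
      ∀ z ∉ Z, ∀ hp : S.linePoint I (-z) 1 ≠ 0,
      (∃ (ξ : Fin 4 → K) (hξ : ξ ≠ 0),
        (join (S.line (S.vec fun m => signs I m * (-z + 1 * S.root m))) ξ = 0 ∧
          join (S.lineX (S.vec fun m => signs I m * (-z + 1 * S.root m))) ξ = 0) ∧
        (Projectivization.mk K ξ hξ, Projectivization.mk K _ hp) ∈ S.kappaGraph) ∧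
      ∀ (η : Fin 4 → K) (hη : η ≠ 0), S.IsTropeCoords I η →
        (Projectivization.mk K η hη, Projectivization.mk K _ hp) ∈ S.kappaDualGraph := by
  obtain ⟨c, Z, hZ, hc⟩ := exists_generic_point hK hab h
  refine ⟨Z ∪ Set.range S.root, hZ.union (Set.finite_range _),
    fun z hz m e => hz (Or.inr ⟨m, e.symm⟩), fun z hz hp => ?_⟩
  have hz' : ∀ m, z ≠ S.root m := fun m e => hz (Or.inr ⟨m, e.symm⟩)
  obtain ⟨h0, hdisc⟩ := hc z fun h => hz (Or.inl h)
  set π : Fin 6 → K := fun m => signs I m * (-z + 1 * S.root m) with hπ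
  have hnull : S.IsNull π := S.isNull_affine I (-z) 1
  have hπ0 : π ≠ 0 := signs_linear_ne_zero I z
  have hξ0 : meet (S.line (S.vec π)) (join (S.lineX (S.vec π)) c) ≠ 0 := fun h => h0 (by
    rw [h]; rfl)
  obtain ⟨h1, h2⟩ := mem_graphs_of_generic_point hK I hz' rfl rfl h0 hdisc hξ0 hp
  refine ⟨⟨_, hξ0, hnull.join_meet_join hK c, h1⟩, fun η hη hT => ?_⟩
  obtain ⟨c', hc'⟩ := hnull.exists_plane hK hπ0
  obtain ⟨k1, k2⟩ := hnull.meet_join_meet hK c'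
  have hl := (S.lowMoments_and_mulRoot_iff I π).2 ⟨-z, 1, fun m => rfl⟩
  rw [← hT.meet_eq_zero_iff, ← hT.meet_eq_zero_iff, ← lineX_vec] at hl
  rw [IsNull.plane_unique hK hnull hπ0 hη hc' hl.1 hl.2 k1 k2]
  exact h2 c' hc'

/-! ### Lower bounds for the transforms -/

lemma IsNodeCoords.lineSign_subset_blowUp [IsAlgClosed K] (hK : (2 : K) ≠ 0) {a b : Fin 6}
    (hab : a ≠ b) {ξ : Fin 4 → K} (hξ : S.IsNodeCoords {a, b} ξ) :
    S.lineSign {a, b} ⊆ S.blowUp S.kappaGraph (Projectivization.mk K ξ hξ.ne_zero) := by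
  intro p hp
  refine ⟨S.lineSign_subset_desing _ hp, ?_⟩
  obtain ⟨Z, hZ, -, hgen⟩ := exists_generic_points (S := S) (I := {a, b}) hK hab (z₀ := 0)
    (c₀ := -0) (d₀ := 1) fun m => rfl
  refine forall_mem_lineSign_prod hZ (fun z hz hp => ?_) p hp
  obtain ⟨⟨ζ, hζ, hj, hmem⟩, -⟩ := hgen z hz hp
  have hl := (S.lowMoments_and_mulRoot_iff {a, b} (fun m => signs {a, b} m * (-z + 1 * S.root m))).2
    ⟨-z, 1, fun m => rfl⟩
  rw [← hξ.join_eq_zero_iff, ← hξ.join_eq_zero_iff, ← lineX_vec] at hl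
  rwa [IsNull.point_unique hK (S.isNull_affine {a, b} (-z) 1) (signs_linear_ne_zero _ z) hζ
    hξ.ne_zero hj.1 hj.2 hl.1 hl.2] at hmem

lemma even_card_of_linePoint_mem (hK : (2 : K) ≠ 0) {I J : Finset (Fin 6)} {z : K}
    (hz : ∀ m, z ≠ S.root m) (hp : S.linePoint I (-z) 1 ≠ 0)
    (h : Projectivization.mk K _ hp ∈ S.lineSign J) : Even (I ∆ J).card := by
  obtain ⟨c, d, h⟩ := (mk_mem_lineSign hp).1 h
  have e (m : Fin 6) : -z + 1 * S.root m = signs (I ∆ J) m * (c + d * S.root m) := by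
    have := h m
    rw [ev_linePoint] at this
    rw [← signs_mul_signs, Pi.mul_apply, mul_assoc, ← this, ← mul_assoc, signs_mul_self]
    ring
  by_cases h2 : 2 ≤ (I ∆ J).card
  · obtain ⟨h1, h1'⟩ := S.eq_zero_of_affine (c := -z + c) (d := 1 + d) h2 fun m hm => by
      have := e m
      rw [signs_of_mem hm] at this
      linear_combination this
    have : I ∆ J = Finset.univ := by
      by_contra hne
      obtain ⟨m, hm⟩ : ∃ m, m ∉ I ∆ J := by
        by_contra! hall
        exact hne (Finset.eq_univ_of_forall hall)
      have hm' := e m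
      rw [signs_of_notMem hm] at hm'
      refine hz m (mul_left_cancel₀ hK ?_)
      linear_combination -hm' - h1 - h1' * S.root m
    rw [this, Finset.card_univ, Fintype.card_fin]
    decide
  · obtain ⟨h1, h1'⟩ := S.eq_zero_of_affine (c := -z - c) (d := 1 - d) (T := (I ∆ J)ᶜ)
      (by rw [Finset.card_compl, Fintype.card_fin]; omega) fun m hm => by
        have := e m
        rw [signs_of_notMem (Finset.mem_compl.1 hm)] at this
        linear_combination this
    have : I ∆ J = ∅ := by
      by_contra hne
      obtain ⟨m, hm⟩ := Finset.nonempty_iff_ne_empty.2 hne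
      have hm' := e m
      rw [signs_of_mem hm] at hm'
      refine hz m (mul_left_cancel₀ hK ?_)
      linear_combination -hm' - h1 - h1' * S.root m
    rw [this]
    simp

lemma exists_isNodeCoords_of_mem_nodes {ξ : Fin 4 → K} (hξ : ξ ≠ 0)
    (h : Projectivization.mk K ξ hξ ∈ S.nodes) :
    ∃ (J : Finset (Fin 6)) (ζ : Fin 4 → K) (hζ : S.IsNodeCoords J ζ), Even J.card ∧
      Projectivization.mk K ξ hξ = Projectivization.mk K ζ hζ.ne_zero := by
  rcases h with h | ⟨i, j, hij, h⟩
  · exact ⟨∅, _, S.isNodeCoords_nodeZero, by simp, h⟩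
  · exact ⟨{i, j}, _, S.isNodeCoords_node hij, by rw [Finset.card_pair hij]; decide, h⟩

lemma kappaGeneric_fst_subset : Prod.fst '' S.kappaGeneric ⊆ {ξ | ∃ x y u v : K,
    y ^ 2 = S.F.eval x ∧ v ^ 2 = S.F.eval u ∧ x ≠ u ∧ ξ = S.kummerPoint x y u v} := by
  rintro _ ⟨a, ⟨x, y, u, v, hy, hv, -, -, hxu, M, -, -, -, -, p, hp, -, rfl⟩, rfl⟩
  exact ⟨x, y, u, v, hy, hv, hxu, rfl⟩

lemma mem_kummer_of_mem_kappaGraph {ξ : ℙ K (Fin 4 → K)} {p : ℙ K (Fin 6 → K)}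
    (h : (ξ, p) ∈ S.kappaGraph) : ξ ∈ S.kummer :=
  zariskiClosure_mono kappaGeneric_fst_subset (zariskiClosureProd_fst h)

lemma mem_dualKummer_of_mem_kappaDualGraph {η : ℙ K (Fin 4 → K)} {p : ℙ K (Fin 6 → K)}
    (h : (η, p) ∈ S.kappaDualGraph) : η ∈ S.dualKummer := by
  refine zariskiClosure_mono ?_ (zariskiClosureProd_fst h)
  rintro _ ⟨a, ⟨ξ, ht, hξ⟩, rfl⟩
  exact ⟨ξ, subset_zariskiClosure _ (kappaGeneric_fst_subset ⟨_, hξ, rfl⟩), ht⟩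

/-- Lower bounds for the total and the strict transform. In the strict transform, a general point of
`Δ_I` does not come from a node: nodes belong to even index sets `J`, and for such a `J` a general
point of `Δ_I` is not on `Δ_J`. -/
lemma IsTropeCoords.lineSign_subset [IsAlgClosed K] (hK : (2 : K) ≠ 0) {I : Finset (Fin 6)}
    (hI : Odd I.card) {j : Fin 6} (hj : (I ∆ {j}).card = 2) {η : Fin 4 → K}
    (hη : S.IsTropeCoords I η) :
    S.lineSign I ⊆ S.blowUp S.kappaDualGraph (Projectivization.mk K η hη.ne_zero) ∧
    S.lineSign I ⊆ S.strictTransform (S.planeSection (Projectivization.mk K η hη.ne_zero)) := by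
  obtain ⟨a, b, hab, e⟩ := Finset.card_eq_two.1 hj
  -- the point of `Δ_I` given by `X - θ_j` also lies on `Δ_{ab}`, where `I ∆ {j} = {a, b}`
  obtain ⟨Z, hZ, hroot, hgen⟩ := exists_generic_points (S := S) (I := I) hK hab (z₀ := S.root j)
    (c₀ := -S.root j) (d₀ := 1) fun m => by
      rw [← e, ← signs_mul_signs, Pi.mul_apply]
      by_cases hm : m = j
      · simp [hm]
      · rw [signs_of_notMem (I := {j}) (by simpa using hm), mul_one]
  constructor
  · intro p hp
    refine ⟨S.lineSign_subset_desing _ hp, ?_⟩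
    exact forall_mem_lineSign_prod hZ (fun z hz hp => (hgen z hz hp).2 η hη.ne_zero hη) p hp
  · refine forall_mem_lineSign (Q := fun a => a ∈ zariskiClosure _)
      (fun _ _ hp _ hB h => zariskiClosure_line hp hB h) hZ fun z hz hp =>
        subset_zariskiClosure _ ?_
    obtain ⟨⟨ξ, hξ, ⟨h1, h2⟩, hmem⟩, -⟩ := hgen z hz hp
    refine ⟨Projectivization.mk K ξ hξ, ⟨mem_kummer_of_mem_kappaGraph hmem, ?_⟩, fun hn => ?_,
      S.lineSign_subset_desing I (linePoint_mem_lineSign I hp), hmem⟩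
    · rw [orthogonal_mk]
      have hl := (S.lowMoments_and_mulRoot_iff I (fun m => signs I m * (-z + 1 * S.root m))).2
        ⟨-z, 1, fun m => rfl⟩
      rw [← hη.meet_eq_zero_iff] at hl
      have hne : S.line (S.vec fun m => signs I m * (-z + 1 * S.root m)) ≠ 0 := fun h => hp (by
        rw [linePoint, S.line_eq_zero hK h, coeffs_zero])
      obtain ⟨i, hi⟩ := Function.ne_iff.1 hne
      exact (mul_eq_zero.1 (line_mul_incidence h1 hl.1 i)).resolve_left hi
    · obtain ⟨J, ζ, hζ, hJ, e⟩ := exists_isNodeCoords_of_mem_nodes hξ hn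
      obtain ⟨s, rfl⟩ := (Projectivization.mk_eq_mk_iff' K _ _ _ _).1 e.symm
      have hmem' : Projectivization.mk K _ hp ∈ S.lineSign J := by
        rw [mem_lineSign_iff, ev_linePoint, ← hζ.join_eq_zero_iff, ← hζ.join_eq_zero_iff,
          ← lineX_vec, join_smul_right, join_smul_right, h1, h2]
        simp
      have h' := even_card_of_linePoint_mem hK (hroot z hz) hp hmem'
      have hcard := card_symmDiff_add I J
      obtain ⟨k1, hk1⟩ := h'
      obtain ⟨k2, hk2⟩ := hJ
      obtain ⟨k3, hk3⟩ := hI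
      omega

lemma IsTropeCoords.mem_dualKummer_and_transforms [IsAlgClosed K] (hK : (2 : K) ≠ 0)
    {I : Finset (Fin 6)} (hI : Odd I.card) {j : Fin 6} (hj : (I ∆ {j}).card = 2) {η : Fin 4 → K}
    (hη : S.IsTropeCoords I η) :
    Projectivization.mk K η hη.ne_zero ∈ S.dualKummer ∧
      S.blowUp S.kappaDualGraph (Projectivization.mk K η hη.ne_zero) = S.lineSign I ∧
      S.strictTransform (S.planeSection (Projectivization.mk K η hη.ne_zero)) =
        S.lineSign I := by
  obtain ⟨h1, h2⟩ := hη.lineSign_subset hK hI hj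
  have hp : S.linePoint I 0 1 ≠ 0 := linePoint_ne_zero (Or.inr one_ne_zero)
  exact ⟨mem_dualKummer_of_mem_kappaDualGraph (h1 (linePoint_mem_lineSign I hp)).2,
    (hη.blowUp_subset hK).antisymm h1,
    (hη.strictTransform_subset hK fun m => S.exists_isNodeCoords_symmDiff hI m).antisymm h2⟩

end Sextic

end

end KummerSurface

theorem lemma3p3 {K : Type*} [Field K] [IsAlgClosed K] (hK : (2 : K) ≠ 0)
    (S : KummerSurface.Sextic K) :
    -- `κ` blows up the nodes `N₀` and `N_{ij}` into `Δ₀` and `Δ_{ij}`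
    S.blowUp S.kappaGraph KummerSurface.Sextic.nodeZero = KummerSurface.Sextic.lineZero ∧
    (∀ i j : Fin 6, i ≠ j → S.blowUp S.kappaGraph (S.node i j) = S.lineTwo i j) ∧
    -- `κ*` blows up the tropes `T_i` and `T_{ijk}` into `Δ_i` and `Δ_{ijk}`, and these lines are
    -- the strict transforms by `κ` of the conics cut on `𝒦` by the tropes
    (∀ i : Fin 6, (∃! T, S.IsTropeOne i T) ∧
      ∀ T, S.IsTropeOne i T → T ∈ S.dualKummer ∧
        S.blowUp S.kappaDualGraph T = S.lineOne i ∧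
        S.strictTransform (S.planeSection T) = S.lineOne i) ∧
    (∀ i j k : Fin 6, i ≠ j → i ≠ k → j ≠ k → (∃! T, S.IsTropeThree i j k T) ∧
      ∀ T, S.IsTropeThree i j k T → T ∈ S.dualKummer ∧
        S.blowUp S.kappaDualGraph T = S.lineThree i j k ∧
        S.strictTransform (S.planeSection T) = S.lineThree i j k) ∧
    -- the intersections of these lines
    (∀ i : Fin 6, KummerSurface.Sextic.lineZero ∩ S.lineOne i = {S.linearPoint i}) ∧
    (∀ i j : Fin 6, i ≠ j → KummerSurface.Sextic.lineZero ∩ S.lineTwo i j = ∅) ∧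
    (∀ i j k : Fin 6, i ≠ j → i ≠ k → j ≠ k →
      KummerSurface.Sextic.lineZero ∩ S.lineThree i j k = ∅) ∧
    (∀ i j k m n : Fin 6, i ≠ j → i ≠ k → j ≠ k → m ≠ n →
      ((S.lineThree i j k ∩ S.lineTwo m n).Nonempty ↔
        (({m, n} : Finset (Fin 6)) ⊆ {i, j, k} ∨
          Disjoint ({m, n} : Finset (Fin 6)) {i, j, k}))) := by
  open scoped symmDiff in
  refine ⟨?_, fun i j hij => ?_, fun i => ?_, fun i j k hij hik hjk => ?_,
    fun i => S.lineZero_inter_lineOne i hK, fun i j hij => ?_, fun i j k hij hik hjk => ?_,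
    fun i j k m n hij hik hjk hmn => S.lineThree_inter_lineTwo hK hij hik hjk hmn⟩
  · rw [S.lineZero_eq]
    exact (S.isNodeCoords_nodeZero.blowUp_subset hK).antisymm (S.lineZero_subset_blowUp hK)
  · rw [S.lineTwo_eq hij]
    exact ((S.isNodeCoords_node hij).blowUp_subset hK).antisymm
      ((S.isNodeCoords_node hij).lineSign_subset_blowUp hK hij)
  · simp only [S.isTropeOne_iff hK]
    refine ⟨⟨_, rfl, fun _ h => h⟩, ?_⟩
    rintro _ rfl
    obtain ⟨j, hj⟩ := exists_ne i
    rw [S.lineOne_eq]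
    refine (S.isTropeCoords_one i).mem_dualKummer_and_transforms hK (by simp) (j := j) ?_
    rw [show ({i} : Finset (Fin 6)) ∆ {j} = {i, j} by ext m; simp [Finset.mem_symmDiff]; grind,
      Finset.card_pair hj.symm]
  · obtain ⟨η, hη, h⟩ := S.exists_isTropeThree_iff hK hij hik hjk
    have hcard : ({i, j, k} : Finset (Fin 6)).card = 3 := Finset.card_eq_three.2
      ⟨i, j, k, hij, hik, hjk, rfl⟩
    simp only [h]
    refine ⟨⟨_, rfl, fun _ h => h⟩, ?_⟩
    rintro _ rfl
    rw [S.lineThree_eq hij hik hjk]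
    refine hη.mem_dualKummer_and_transforms hK (by rw [hcard]; decide) (j := i) ?_
    rw [show ({i, j, k} : Finset (Fin 6)) ∆ {i} = {j, k} by
      ext m; simp [Finset.mem_symmDiff]; grind, Finset.card_pair hjk]
  · rw [S.lineZero_eq, S.lineTwo_eq hij]
    apply S.lineSign_inter_eq_empty hK <;>
      simp [← Finset.bot_eq_empty, Finset.card_pair hij]
  · have hcard : ({i, j, k} : Finset (Fin 6)).card = 3 := Finset.card_eq_three.2
      ⟨i, j, k, hij, hik, hjk, rfl⟩
    rw [S.lineZero_eq, S.lineThree_eq hij hik hjk]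
    apply S.lineSign_inter_eq_empty hK <;>
      simp [← Finset.bot_eq_empty, hcard]
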